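/- Let $p$ be an odd prime and let $g \ge 1$ be an integer. For a pro-$p$ group $G$ put $d(G)=\dim H^1(G,\mathbb F_p)$ and $r(G)=\dim H^2(G,\mathbb F_p)$ (continuous cohomology), and let $P_0(G)=G$, $P_{n+1}(G)=[G,P_n(G)]P_n(G)^p$ (closed subgroups) be the lower $p$-central series; $G$ has $p$-class $c$ if $P_c(G)=1$ and $P_n(G)\neq 1$ for $n<c$. A GI-automorphism of $G$ is an automorphism $\sigma$ of order $2$ acting as inversion on $G^{\mathrm{ab}}$. A Schur$+1$ $\sigma$-group of rank $g$ is a finitely presented pro-$p$ group $G$ such that $G^{\mathrm{ab}}$ is finite, $d(G)=g$, $r(G)\in\{g,g+1\}$, and $G$ has a GI-automorphism that acts as inversion on $H^2(G,\mathbb F_p)$. A Schur$+1$ $\sigma$-ancestor group is a (finite) group isomorphic to $H/P_n(H)$ for some Schur$+1$ $\sigma$-group $H$ and some $n$. Let $F$ be the free pro-$p$ group on $x_1,\dots,x_g$, let $\sigma$ be its automorphism with $\sigma(x_i)=x_i^{-1}$, and let $F_n=F/P_n(F)$ with the induced automorphism $\sigma$. Put $X_n=\{s\in\Phi(F_n)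 : \sigma(s)=s^{-1}\}$, where $\Phi$ is the Frattini subgroup. For a finite group $G$ with $d(G)=g$, let $T_n(G)$ be the set of tuples $v\in X_n^{g+1}$ such that $F_n/\langle v\rangle\cong G$, where $\langle v\rangle$ is the normal subgroup generated by the entries of $v$, and put $\mathrm{Meas}_n(G)=|T_n(G)|/|X_n|^{g+1}$. If $G$ has $p$-class $c$, then $\mathrm{Meas}(G)$ denotes the constant value of $\mathrm{Meas}_n(G)$ for $n\ge c+1$. Put $\eta_j(p)=\prod_{k=1}^{j}(1-p^{-k})$. Let $G$ be a Schur$+1$ $\sigma$-ancestor group of $p$-class $c$ with $d(G)=g$. For a GI-automorphism $\sigma$ of $G$, let $y(G)$ be the number of elements of $G$ fixed by $\sigma$, and let $\mathrm{Aut}_\sigma(G)$ be the group of automorphisms of $G$ that commute with $\sigma$. Write $G=F/R$, put $R^*=\overline{R^p[F,R]}$, and let $h=h(G)=\dim_{\mathbb F_p} R/R^*P_c(F)$. Then, for every choice of $\sigma$ and of the presentation $G=F/R$, we have $h\le g+1$ and $$\mathrm{Meas}_c(G)=\frac{y(G)}{|\mathrm{Aut}_\sigma(G)|\,|G|}\;p^{g(g+1)}\;\frac{\eta_g(p)\,\eta_{g+1}(p)}{\eta_{g+1-h}(p)}.$$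 If $G$ is also a Schur$+1$ $\sigma$-group (of rank $g$), with $r=r(G)$, then $$\mathrm{Meas}(G)=\frac{y(G)}{|\mathrm{Aut}_\sigma(G)|\,|G|}\;p^{g(g+1)}\;\frac{\eta_g(p)\,\eta_{g+1}(p)}{\eta_{g+1-r}(p)}.$$ If $G$ is not a Schur$+1$ $\sigma$-group, then $\mathrm{Meas}(G)=0$. -/

import Mathlib

noncomputable section

namespace SchurPlusOne

universe u

/-! ### Pro-`p` groups and the lower `p`-central series -/

/-- `G` is a pro-`p` group: a profinite group all of whose finite continuous quotients are
`p`-groups. -/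
structure IsProP (p : ℕ) (G : Type u) [Group G] [TopologicalSpace G] [IsTopologicalGroup G] :
    Prop where
  compact : CompactSpace G
  t2 : T2Space G
  totallyDisconnected : TotallyDisconnectedSpace G
  isPGroup_quotient : ∀ N : Subgroup G, N.Normal → IsOpen (N : Set G) → ∃ k : ℕ, N.index = p ^ k

section Series

variable (p : ℕ) {G : Type u} [Group G] [TopologicalSpace G] [IsTopologicalGroup G]

/-- `[G, N] N ^ p`, as a closed subgroup. -/
def pStar (N : Subgroup G) : Subgroup G :=
  (⁅(⊤ : Subgroup G), N⁆ ⊔ Subgroup.closure ((fun x : G => x ^ p) '' N)).topologicalClosure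

theorem commutator_mem_pStar {N : Subgroup G} (a : G) {b : G} (hb : b ∈ N) :
    a * b * a⁻¹ * b⁻¹ ∈ pStar p N :=
  Subgroup.le_topologicalClosure _
    (Subgroup.mem_sup_left (Subgroup.commutator_mem_commutator (Subgroup.mem_top a) hb))

theorem pow_mem_pStar {N : Subgroup G} {b : G} (hb : b ∈ N) : b ^ p ∈ pStar p N :=
  Subgroup.le_topologicalClosure _
    (Subgroup.mem_sup_right (Subgroup.subset_closure ⟨b, hb, rfl⟩))

instance pStar_normal (N : Subgroup G) [hN : N.Normal] : (pStar p N).Normal := by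
  have : (Subgroup.closure ((fun x : G => x ^ p) '' (N : Set G))).Normal := by
    refine ⟨fun n hn g => ?_⟩
    induction hn using Subgroup.closure_induction with
    | mem x hx =>
      obtain ⟨y, hy, rfl⟩ := hx
      exact Subgroup.subset_closure ⟨g * y * g⁻¹, hN.conj_mem y hy g, conj_pow⟩
    | one => simp
    | mul x y _ _ hx hy =>
      have h := mul_mem hx hy
      rwa [conj_mul] at h
    | inv x _ hx =>
      have h := inv_mem hx
      rwa [← conj_inv]
  exact Subgroup.is_normal_topologicalClosure _

variable (G) in
/-- The lower `p`-central series: `P₀(G) = G` and `Pₙ₊₁(G) = [G, Pₙ(G)] Pₙ(G) ^ p`. -/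
def lowerP : ℕ → Subgroup G
  | 0 => ⊤
  | n + 1 => pStar p (lowerP n)

instance lowerP_normal : ∀ n : ℕ, (lowerP p G n).Normal
  | 0 => (inferInstance : (⊤ : Subgroup G).Normal)
  | n + 1 => by
    have := lowerP_normal n
    exact pStar_normal p (lowerP p G n)

theorem map_pStar_le (φ : G →* G) (hφ : Continuous φ) {N : Subgroup G}
    (hN : N ≤ N.comap φ) : pStar p N ≤ (pStar p N).comap φ := by
  refine Subgroup.topologicalClosure_minimal _ (sup_le ?_ ?_)
    ((Subgroup.isClosed_topologicalClosure _).preimage hφ)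
  · rw [Subgroup.commutator_le]
    intro a _ b hb
    have hb' : φ b ∈ N := hN hb
    simpa [commutatorElement_def] using commutator_mem_pStar p (φ a) hb'
  · rw [Subgroup.closure_le]
    rintro _ ⟨b, hb, rfl⟩
    have hb' : φ b ∈ N := hN hb
    simpa using pow_mem_pStar p hb'

theorem lowerP_le_comap (φ : G →* G) (hφ : Continuous φ) :
    ∀ n : ℕ, lowerP p G n ≤ (lowerP p G n).comap φ
  | 0 => fun _ _ => Subgroup.mem_top _
  | n + 1 => map_pStar_le p φ hφ (lowerP_le_comap φ hφ n)

variable (G) in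
/-- `G` has `p`-class `c`: `P_c(G) = 1`, and `P_n(G) ≠ 1` for `n < c`. -/
def HasPClass (c : ℕ) : Prop :=
  lowerP p G c = ⊥ ∧ ∀ n < c, lowerP p G n ≠ ⊥

end Series

/-! ### The free pro-`p` group -/

section Free

variable (p g : ℕ)

/-- The normal subgroups of `p`-power index of the abstract free group on `g` letters. -/
def PIndex : Type :=
  {N : Subgroup (FreeGroup (Fin g)) // N.Normal ∧ ∃ k : ℕ, N.index = p ^ k}

variable {p g}

instance (N : PIndex p g) : N.1.Normal := N.2.1

/-- The quotient of the free group by `N`, a finite `p`-group with the discrete topology. -/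
def Level (N : PIndex p g) : Type := FreeGroup (Fin g) ⧸ N.1

instance (N : PIndex p g) : Group (Level N) :=
  inferInstanceAs (Group (FreeGroup (Fin g) ⧸ N.1))

instance (N : PIndex p g) : TopologicalSpace (Level N) := ⊥

instance (N : PIndex p g) : DiscreteTopology (Level N) := ⟨rfl⟩

/-- The transition map between two levels. -/
def Level.trans {N M : PIndex p g} (h : N.1 ≤ M.1) : Level N →* Level M :=
  QuotientGroup.map N.1 M.1 (MonoidHom.id _) h

variable (p g)

/-- The inverse limit of all levels, inside their product. -/
def freeProPSubgroup : Subgroup (∀ N : PIndex p g, Level N) where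
  carrier := {x | ∀ (N M : PIndex p g) (h : N.1 ≤ M.1), Level.trans h (x N) = x M}
  mul_mem' := fun {x y} hx hy N M h => by
    simp only [Pi.mul_apply, map_mul, hx N M h, hy N M h]
  one_mem' := fun N M h => by simp only [Pi.one_apply, map_one]
  inv_mem' := fun {x} hx N M h => by simp only [Pi.inv_apply, map_inv, hx N M h]

/-- The free pro-`p` group `F` on `g` generators: the pro-`p` completion of the free group on `g`
letters, with the inverse limit topology. -/
abbrev FreeProP : Type := freeProPSubgroup p g

variable {p g}

/-- The canonical generators `x₁, …, x_g` of `F`. -/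
def FreeProP.of (i : Fin g) : FreeProP p g :=
  ⟨fun N => QuotientGroup.mk' N.1 (FreeGroup.of i), fun _ _ _ => rfl⟩

/-- The endomorphism of the free group that inverts each of the free generators. -/
def invGen (g : ℕ) : FreeGroup (Fin g) →* FreeGroup (Fin g) :=
  FreeGroup.lift fun i => (FreeGroup.of i)⁻¹

theorem invGen_invGen (w : FreeGroup (Fin g)) : invGen g (invGen g w) = w := by
  have h : (invGen g).comp (invGen g) = MonoidHom.id _ := by
    ext i
    simp [invGen]
  exact DFunLike.congr_fun h w

/-- The preimage of `N` under `invGen`. -/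
def PIndex.flip (N : PIndex p g) : PIndex p g :=
  ⟨N.1.comap (invGen g), inferInstance, by
    obtain ⟨k, hk⟩ := N.2.2
    exact ⟨k, by
      rw [Subgroup.index_comap_of_surjective _ fun w => ⟨invGen g w, invGen_invGen w⟩, hk]⟩⟩

/-- The map of levels induced by `invGen`. -/
def Level.flip (N : PIndex p g) : Level N.flip →* Level N :=
  QuotientGroup.map N.flip.1 N.1 (invGen g) le_rfl

theorem Level.flip_trans {N M : PIndex p g} (h : N.1 ≤ M.1) (h' : N.flip.1 ≤ M.flip.1)
    (a : Level N.flip) :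
    Level.trans h (Level.flip N a) = Level.flip M (Level.trans h' a) := by
  induction a using QuotientGroup.induction_on with
  | H w => rfl

theorem Level.flip_flip (N : PIndex p g) (h : N.flip.flip.1 ≤ N.1) (a : Level N.flip.flip) :
    Level.flip N (Level.flip N.flip a) = Level.trans h a := by
  induction a using QuotientGroup.induction_on with
  | H w => exact congrArg (QuotientGroup.mk' N.1) (invGen_invGen w)

variable (p g)

/-- The homomorphism underlying the generator-inverting automorphism of `F`. -/
def sigmaHom : FreeProP p g →* FreeProP p g where
  toFun x := ⟨fun N => Level.flip N (x.1 N.flip), fun N M h => by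
    have h' : N.flip.1 ≤ M.flip.1 := Subgroup.comap_mono h
    rw [Level.flip_trans h h', x.2 _ _ h']⟩
  map_one' := Subtype.ext (funext fun N => map_one (Level.flip N))
  map_mul' x y := Subtype.ext (funext fun N => map_mul (Level.flip N) (x.1 _) (y.1 _))

theorem continuous_sigmaHom : Continuous (sigmaHom p g) := by
  refine Continuous.subtype_mk (continuous_pi fun N => ?_) _
  exact (continuous_of_discreteTopology (f := Level.flip N)).comp
    ((continuous_apply N.flip).comp continuous_subtype_val)

theorem sigmaHom_sigmaHom (x : FreeProP p g) : sigmaHom p g (sigmaHom p g x) = x := by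
  refine Subtype.ext (funext fun N => ?_)
  have h : N.flip.flip.1 ≤ N.1 := fun w hw => by
    have hw' : invGen g (invGen g w) ∈ N.1 := hw
    rwa [invGen_invGen] at hw'
  exact (Level.flip_flip N h _).trans (x.2 _ _ h)

/-- The generator-inverting automorphism `σ` of `F`. -/
def sigma : FreeProP p g ≃ₜ* FreeProP p g where
  toFun := sigmaHom p g
  invFun := sigmaHom p g
  left_inv := sigmaHom_sigmaHom p g
  right_inv := sigmaHom_sigmaHom p g
  map_mul' := map_mul (sigmaHom p g)
  continuous_toFun := continuous_sigmaHom p g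
  continuous_invFun := continuous_sigmaHom p g

theorem sigma_of (i : Fin g) : sigma p g (FreeProP.of i) = (FreeProP.of i)⁻¹ := by
  refine Subtype.ext (funext fun N => ?_)
  exact congrArg (QuotientGroup.mk' N.1) (by simp [invGen])

/-- `F_c = F / P_c(F)`, a finite `p`-group. -/
abbrev FreeQuot (c : ℕ) : Type := FreeProP p g ⧸ lowerP p (FreeProP p g) c

/-- The automorphism that `σ` induces on `F_c`. -/
def sigmaQuot (c : ℕ) : FreeQuot p g c →* FreeQuot p g c :=
  QuotientGroup.map _ _ (sigmaHom p g) (lowerP_le_comap p _ (continuous_sigmaHom p g) c)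

end Free

/-- `G` is finitely presented as a pro-`p` group: it is a quotient of a free pro-`p` group of finite
rank by the closed normal subgroup generated by a finite set. -/
def IsFinitelyPresentedProP (p : ℕ) (G : Type u) [Group G] [TopologicalSpace G] : Prop :=
  ∃ (n : ℕ) (π : FreeProP p n →* G), Continuous π ∧ Function.Surjective π ∧
    ∃ s : Set (FreeProP p n), s.Finite ∧ π.ker = (Subgroup.normalClosure s).topologicalClosure

/-! ### Continuous cohomology in degrees one and two, with trivial coefficients `𝔽_p`

Continuous cochains with values in the discrete module `ZMod p` are locally constant functions. -/

section Cohomology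

variable (p : ℕ) (G : Type u) [Group G] [TopologicalSpace G]

/-- `H¹(G, 𝔽_p)`: the continuous homomorphisms from `G` to `𝔽_p` (the action being trivial, all
`1`-coboundaries vanish). -/
def H1 : Submodule (ZMod p) (LocallyConstant G (ZMod p)) where
  carrier := {f | ∀ x y, f (x * y) = f x + f y}
  add_mem' := fun {f f'} hf hf' x y => by
    simp only [LocallyConstant.coe_add, Pi.add_apply, hf x y, hf' x y]; ring
  zero_mem' := fun x y => by simp
  smul_mem' := fun a f hf x y => by
    simp only [LocallyConstant.coe_smul, Pi.smul_apply, hf x y, smul_add]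

/-- Continuous inhomogeneous `2`-cocycles. -/
def Z2 : Submodule (ZMod p) (LocallyConstant (G × G) (ZMod p)) where
  carrier := {f | ∀ x y z, f (y, z) - f (x * y, z) + f (x, y * z) - f (x, y) = 0}
  add_mem' := fun {f f'} hf hf' x y z => by
    simp only [LocallyConstant.coe_add, Pi.add_apply]
    linear_combination hf x y z + hf' x y z
  zero_mem' := fun x y z => by simp
  smul_mem' := fun a f hf x y z => by
    simp only [LocallyConstant.coe_smul, Pi.smul_apply, smul_eq_mul]
    linear_combination a * hf x y z

/-- Continuous inhomogeneous `2`-coboundaries. -/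
def B2 : Submodule (ZMod p) (LocallyConstant (G × G) (ZMod p)) where
  carrier := {f | ∃ b : LocallyConstant G (ZMod p), ∀ x y, f (x, y) = b y - b (x * y) + b x}
  add_mem' := by
    rintro f f' ⟨b, hb⟩ ⟨b', hb'⟩
    refine ⟨b + b', fun x y => ?_⟩
    simp only [LocallyConstant.coe_add, Pi.add_apply, hb x y, hb' x y]; ring
  zero_mem' := ⟨0, fun x y => by simp⟩
  smul_mem' := by
    rintro a f ⟨b, hb⟩
    refine ⟨a • b, fun x y => ?_⟩
    simp only [LocallyConstant.coe_smul, Pi.smul_apply, smul_eq_mul, hb x y]; ring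

/-- `H²(G, 𝔽_p)`. -/
abbrev H2 : Type u := Z2 p G ⧸ (B2 p G).submoduleOf (Z2 p G)

/-- The generator rank `d(G)`. -/
def genRank : ℕ := Module.finrank (ZMod p) (H1 p G)

/-- The relation rank `r(G)`. -/
def relRank : ℕ := Module.finrank (ZMod p) (H2 p G)

variable {G}

/-- Pull-back of `2`-cocycles along an automorphism. -/
def Z2.map (σ : G ≃ₜ* G) : Z2 p G →ₗ[ZMod p] Z2 p G :=
  ((LocallyConstant.comapₗ (ZMod p)
    (⟨Prod.map σ σ, σ.continuous.prodMap σ.continuous⟩ : C(G × G, G × G))).restrict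
      (p := Z2 p G) (q := Z2 p G) fun f hf x y z => by
        simpa using hf (σ x) (σ y) (σ z))

/-- The map that an automorphism of `G` induces on `H²(G, 𝔽_p)`. -/
def H2.map (σ : G ≃ₜ* G) : H2 p G →ₗ[ZMod p] H2 p G :=
  Submodule.mapQ _ _ (Z2.map p σ) <| by
    rintro f ⟨b, hb⟩
    refine ⟨LocallyConstant.comap ⟨σ, σ.continuous⟩ b, fun x y => ?_⟩
    change f.1 (σ x, σ y) = b (σ y) - b (σ (x * y)) + b (σ x)
    rw [map_mul]
    exact hb (σ x) (σ y)

end Cohomology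

/-! ### GI-automorphisms and Schur+1 `σ`-groups -/

section Schur

variable {G : Type u} [Group G] [TopologicalSpace G]

/-- A generator-inverting automorphism: an automorphism of order `2` acting as inversion on the
(topological) abelianization. -/
structure IsGI [IsTopologicalGroup G] (σ : G ≃ₜ* G) : Prop where
  involutive : ∀ x, σ (σ x) = x
  ne_refl : ∃ x, σ x ≠ x
  inverts_ab : ∀ x, (QuotientGroup.mk (σ x) : TopologicalAbelianization G) = (QuotientGroup.mk x)⁻¹

/-- `y(G)`, the number of fixed points of the GI-automorphism `σ`. -/
def yCard (σ : G ≃ₜ* G) : ℕ := Nat.card {s : G // σ s = s}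

/-- `|Aut_σ(G)|`, the number of automorphisms of `G` that commute with `σ`. -/
def autCard (σ : G ≃ₜ* G) : ℕ := Nat.card {φ : G ≃ₜ* G // ∀ x, φ (σ x) = σ (φ x)}

variable (p g : ℕ) (G) [IsTopologicalGroup G]

/-- `G` is a Schur+1 `σ`-group of rank `g`. -/
structure IsSchurPlusOne : Prop where
  isProP : IsProP p G
  finitelyPresented : IsFinitelyPresentedProP p G
  finite_ab : Finite (TopologicalAbelianization G)
  genRank_eq : genRank p G = g
  relRank_eq : relRank p G = g ∨ relRank p G = g + 1
  exists_GI : ∃ σ : G ≃ₜ* G, IsGI σ ∧ ∀ z : H2 p G, H2.map p σ z = -z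

/-- `G` is a Schur+1 `σ`-ancestor group: it is one of the quotients `H / P_n(H)` of a Schur+1
`σ`-group `H`. -/
def IsSchurPlusOneAncestor : Prop :=
  ∃ (H : Type u) (_ : Group H) (_ : TopologicalSpace H) (_ : IsTopologicalGroup H) (d n : ℕ),
    IsSchurPlusOne H p d ∧ Nonempty (G ≃ₜ* H ⧸ lowerP p H n)

end Schur

/-! ### The invariant `h(G)` -/

section Multiplicator

variable (p : ℕ) {F : Type u} [Group F] [TopologicalSpace F] [IsTopologicalGroup F]
  (R : Subgroup F) [R.Normal] (c : ℕ)

/-- `R / R* P_c(F)`, where `R* = [F, R] R ^ p`: the quotient of the `p`-multiplicator `R / R*` by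
the nucleus `R* P_c(F) / R*`. -/
abbrev MultModNucleus : Type u := R ⧸ (pStar p R ⊔ lowerP p F c).subgroupOf R

instance : CommGroup (MultModNucleus p R c) where
  __ := (inferInstance : Group (R ⧸ (pStar p R ⊔ lowerP p F c).subgroupOf R))
  mul_comm := by
    intro x y
    induction x using QuotientGroup.induction_on with
    | H a =>
      induction y using QuotientGroup.induction_on with
      | H b =>
        rw [← QuotientGroup.mk_mul, ← QuotientGroup.mk_mul, QuotientGroup.eq,
          Subgroup.mem_subgroupOf]
        refine Subgroup.mem_sup_left ?_
        have h := commutator_mem_pStar p ((b : F)⁻¹) (inv_mem a.2)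
        simpa [mul_assoc] using h

instance : Module (ZMod p) (Additive (MultModNucleus p R c)) :=
  AddCommGroup.zmodModule <| by
    intro x
    induction x using Additive.rec with
    | ofMul x =>
      induction x using QuotientGroup.induction_on with
      | H a =>
        rw [← ofMul_pow, ← QuotientGroup.mk_pow, ofMul_eq_zero, QuotientGroup.eq_one_iff,
          Subgroup.mem_subgroupOf]
        exact Subgroup.mem_sup_left (pow_mem_pStar p a.2)

/-- For a group `G = F / R` of `p`-class `c` this is `h(G) = dim R / R* P_c(F)`, the dimension of
the `p`-multiplicator minus that of the nucleus. -/
def multRank : ℕ := Module.finrank (ZMod p) (Additive (MultModNucleus p R c))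

end Multiplicator

/-! ### Measures -/

section Measures

variable (p g : ℕ)

/-- `X_c`, the elements of the Frattini subgroup of `F_c` that are inverted by `σ`. -/
def X (c : ℕ) : Set (FreeQuot p g c) :=
  {s | s ∈ frattini (FreeQuot p g c) ∧ sigmaQuot p g c s = s⁻¹}

/-- `T_c(G)`, the `(g + 1)`-tuples in `X_c` that present `G`, i.e. the quotient of the finite group
`F_c` by the normal subgroup that they generate is isomorphic to `G`. -/
def T (G : Type u) [Group G] (c : ℕ) : Set (Fin (g + 1) → FreeQuot p g c) :=
  {v | (∀ i, v i ∈ X p g c) ∧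
    Nonempty (FreeQuot p g c ⧸ Subgroup.normalClosure (Set.range v) ≃* G)}

/-- The `p`-class `c`-measure `Meas_c(G)` of a group `G` of generator rank `g`. -/
def measAt (G : Type u) [Group G] (c : ℕ) : ℝ :=
  ((T p g G c).ncard : ℝ) / ((X p g c).ncard : ℝ) ^ (g + 1)

/-- `Meas(G) = m`: for a group `G` of `p`-class `c`, the number `m` is the constant value of
`Meas_{c'}(G)` for `c' ≥ c + 1`. -/
def HasMeas (G : Type u) [Group G] (c : ℕ) (m : ℝ) : Prop :=
  ∀ c' : ℕ, c + 1 ≤ c' → measAt p g G c' = m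

/-- `η_j(p) = ∏_{k = 1}^j (1 - p ^ (-k))`. -/
def eta (j : ℕ) : ℝ := ∏ k ∈ Finset.Icc 1 j, (1 - ((p : ℝ) ^ k)⁻¹)

end Measures

end SchurPlusOne

end

/-! Fix `n` and count pairs (l, v), where l : F_n → G is a surjection commuting with the involutions
and v is a (g+1)-tuple of inverted elements that normally generates ker l.

Seen from v: the relators are inverted, so G inherits an involution that inverts G/P₁(G). Two such
involutions are conjugate in Aut(G) (`exists_conj_of_inverts`), so the surjections belonging to v
form a torsor under Aut_σ(G), and there are |T_n(G)|·|Aut_σ(G)| pairs (`card_presPair_eq_card_T`).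

Seen from l: l is a g-tuple of inverted generators of G, and v is a tuple of inverted elements of N
= ker l spanning N/N*, where N* = [F_n, N]N^p. Square roots in groups of odd order make the inverted
elements equidistributed over a quotient on which σ is inversion (`exists_equiv_invIn`). Both counts
therefore reduce to spanning tuples over 𝔽_p (`card_generating_tuples`), which produce the η
factors. Writing Inv for the set of inverted elements, |Inv F_n| = |Inv G|·|Inv N| = p^g·|X_n| and
|Inv G|·y(G) = |G| turn the double count into the formula (`measAt_eq`).

What remains is that σ inverts N/N* and that its rank is at most g+1. The dual of N/N* consists of
the conjugation-invariant homomorphisms N → 𝔽_p, and a section of l turns each into a class in H².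
For an ancestor G = H/P_n(H) and N taken in F_c, inflation embeds this dual in H²(H)
(`infl_injective`), where σ is -1 and the rank is at most g+1. At levels n ≥ c+1 the map F_n → G
lifts to every central extension of G by 𝔽_p, so the dual is all of H²(G) (`infl_surjective`) and
the rank is r(G). Conversely, a tuple in T_n(G) with n ≥ c+1 forces σ = -1 on H²(G) and r(G) ≤ g+1,
while r(G) ≥ g by `pow_le_relIndex_ker`. So G is then a Schur+1 σ-group, and otherwise T_n(G) is
empty. -/

noncomputable section

namespace SchurPlusOne

/-! ### The lower `p`-central series of an abstract group -/

section AbstractSeries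

variable (p : ℕ) {G E : Type*} [Group G] [Group E]

/-- `[G, N] N ^ p`, as an abstract subgroup. -/
def absStar (N : Subgroup G) : Subgroup G :=
  ⁅(⊤ : Subgroup G), N⁆ ⊔ Subgroup.closure ((fun x : G => x ^ p) '' N)

variable {p}

theorem absStar_le_iff {N K : Subgroup G} :
    absStar p N ≤ K ↔ (∀ a, ∀ b ∈ N, a * b * a⁻¹ * b⁻¹ ∈ K) ∧ ∀ b ∈ N, b ^ p ∈ K := by
  rw [absStar, sup_le_iff, Subgroup.commutator_le, Subgroup.closure_le]
  refine and_congr ⟨fun h a b hb => h a (Subgroup.mem_top a) b hb, fun h a _ b hb => h a b hb⟩ ?_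
  simp [Set.subset_def]

theorem commutator_mem_absStar {N : Subgroup G} (a : G) {b : G} (hb : b ∈ N) :
    a * b * a⁻¹ * b⁻¹ ∈ absStar p N :=
  (absStar_le_iff.1 le_rfl).1 a b hb

theorem pow_mem_absStar {N : Subgroup G} {b : G} (hb : b ∈ N) : b ^ p ∈ absStar p N :=
  (absStar_le_iff.1 le_rfl).2 b hb

theorem absStar_mono {N M : Subgroup G} (h : N ≤ M) : absStar p N ≤ absStar p M :=
  absStar_le_iff.2 ⟨fun a _ hb => commutator_mem_absStar a (h hb),
    fun _ hb => pow_mem_absStar (h hb)⟩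

theorem absStar_le (N : Subgroup G) [hN : N.Normal] : absStar p N ≤ N :=
  absStar_le_iff.2 ⟨fun a b hb => mul_mem (hN.conj_mem b hb a) (inv_mem hb),
    fun _ hb => pow_mem hb p⟩

instance absStar_normal (N : Subgroup G) [hN : N.Normal] : (absStar p N).Normal := by
  refine ⟨fun n hn g => ?_⟩
  have h := mul_mem (commutator_mem_absStar (p := p) g (absStar_le N hn)) hn
  rwa [inv_mul_cancel_right] at h

theorem map_absStar {f : G →* E} (hf : Function.Surjective f) (N : Subgroup G) :
    (absStar p N).map f = absStar p (N.map f) := by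
  refine le_antisymm (Subgroup.map_le_iff_le_comap.2 (absStar_le_iff.2 ⟨?_, ?_⟩))
    (absStar_le_iff.2 ⟨?_, ?_⟩)
  · intro a b hb
    simpa using commutator_mem_absStar (p := p) (f a) (Subgroup.mem_map_of_mem f hb)
  · intro b hb
    simpa using pow_mem_absStar (p := p) (Subgroup.mem_map_of_mem f hb)
  · rintro a _ ⟨b, hb, rfl⟩
    obtain ⟨a, rfl⟩ := hf a
    exact ⟨_, commutator_mem_absStar a hb, by simp⟩
  · rintro _ ⟨b, hb, rfl⟩
    exact ⟨_, pow_mem_absStar hb, by simp⟩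

theorem absStar_le_comap (f : G →* E) {N : Subgroup G} {M : Subgroup E} (h : N ≤ M.comap f) :
    absStar p N ≤ (absStar p M).comap f := by
  refine absStar_le_iff.2 ⟨fun a b hb => ?_, fun b hb => ?_⟩
  · simpa using commutator_mem_absStar (p := p) (f a) (h hb)
  · rw [Subgroup.mem_comap, map_pow]
    exact pow_mem_absStar (h hb)

variable (p G) in
/-- The lower `p`-central series of an abstract group. -/
def absLower : ℕ → Subgroup G
  | 0 => ⊤
  | n + 1 => absStar p (absLower n)

instance absLower_normal : ∀ n : ℕ, (absLower p G n).Normal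
  | 0 => (inferInstance : (⊤ : Subgroup G).Normal)
  | n + 1 => by
    have := absLower_normal n
    exact absStar_normal (absLower p G n)

theorem absLower_antitone : Antitone (absLower p G) :=
  antitone_nat_of_succ_le fun n => absStar_le (absLower p G n)

theorem absLower_le_comap (f : G →* E) : ∀ n, absLower p G n ≤ (absLower p E n).comap f
  | 0 => fun _ _ => Subgroup.mem_top _
  | n + 1 => absStar_le_comap f (absLower_le_comap f n)

theorem map_absLower {f : G →* E} (hf : Function.Surjective f) :
    ∀ n, (absLower p G n).map f = absLower p E n
  | 0 => by
    change (⊤ : Subgroup G).map f = ⊤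
    rw [← MonoidHom.range_eq_map, MonoidHom.range_eq_top.2 hf]
  | n + 1 => by
    rw [absLower, map_absStar hf, map_absLower hf n, absLower]

theorem absLower_eq_bot_of_surjective {f : G →* E} (hf : Function.Surjective f) {n : ℕ}
    (h : absLower p G n = ⊥) : absLower p E n = ⊥ := by
  rw [← map_absLower hf, h, Subgroup.map_bot]

theorem absLower_eq_bot_of_le {n m : ℕ} (h : absLower p G n = ⊥) (hnm : n ≤ m) :
    absLower p G m = ⊥ :=
  le_bot_iff.1 ((absLower_antitone hnm).trans h.le)

theorem pow_pow_mem_absLower (x : G) : ∀ n, x ^ p ^ n ∈ absLower p G n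
  | 0 => Subgroup.mem_top _
  | n + 1 => by
    rw [pow_succ, pow_mul]
    exact pow_mem_absStar (pow_pow_mem_absLower x n)

theorem isPGroup_quotient_absLower (n : ℕ) : IsPGroup p (G ⧸ absLower p G n) := by
  rw [isPGroup_iff_pow_pow_eq_one]
  intro x
  induction x using QuotientGroup.induction_on with
  | H x =>
    refine ⟨n, ?_⟩
    rw [← QuotientGroup.mk_pow, QuotientGroup.eq_one_iff]
    exact pow_pow_mem_absLower x n

theorem isPGroup_of_absLower {n : ℕ} (h : absLower p G n = ⊥) : IsPGroup p G := by
  rw [isPGroup_iff_pow_pow_eq_one]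
  intro x
  have := pow_pow_mem_absLower (p := p) x n
  exact ⟨n, by rwa [h, Subgroup.mem_bot] at this⟩

theorem le_absLower_of_le_absStar {M : Subgroup G} (h : M ≤ absStar p M) :
    ∀ n, M ≤ absLower p G n
  | 0 => le_top
  | n + 1 => h.trans (absStar_mono (le_absLower_of_le_absStar h n))

/-- A Nakayama lemma: in G/M the image of N lies in its own star, hence in every term of a series
that reaches 1. -/
theorem le_of_le_sup_absStar {n : ℕ} (hG : absLower p G n = ⊥) {M N : Subgroup G} [M.Normal]
    (h : N ≤ M ⊔ absStar p N) : N ≤ M := by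
  have hs := QuotientGroup.mk'_surjective M
  have h1 : N.map (QuotientGroup.mk' M) ≤ absStar p (N.map (QuotientGroup.mk' M)) := by
    rw [← map_absStar hs]
    refine (Subgroup.map_mono h).trans ?_
    rw [Subgroup.map_sup]
    refine sup_le ?_ le_rfl
    rw [Subgroup.map_le_iff_le_comap]
    intro x hx
    have : QuotientGroup.mk' M x = 1 := (QuotientGroup.eq_one_iff x).2 hx
    rw [Subgroup.mem_comap, this]
    exact one_mem _
  have h2 := le_absLower_of_le_absStar h1 n
  rw [absLower_eq_bot_of_surjective hs hG, Subgroup.map_le_iff_le_comap] at h2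
  intro x hx
  exact (QuotientGroup.eq_one_iff x).1 (h2 hx)

theorem absLower_one_le_of_isCoatom [Finite G] [Fact p.Prime] {n : ℕ} (hG : absLower p G n = ⊥)
    {K : Subgroup G} (hK : IsCoatom K) : absLower p G 1 ≤ K := by
  have : Group.IsNilpotent G := (isPGroup_of_absLower hG).isNilpotent
  have hn : K.Normal :=
    Subgroup.NormalizerCondition.normal_of_coatom K Group.normalizerCondition_of_isNilpotent hK
  by_contra hle
  have h1 : K ⊔ absLower p G 1 = ⊤ :=
    hK.2 _ (lt_of_le_of_ne le_sup_left fun h => hle (h ▸ le_sup_right))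
  exact hK.1 (top_le_iff.1 (le_of_le_sup_absStar hG (N := ⊤) h1.ge))

theorem absLower_one_le_frattini [Finite G] [Fact p.Prime] {n : ℕ} (hG : absLower p G n = ⊥) :
    absLower p G 1 ≤ frattini G := by
  rw [frattini, Order.radical]
  exact le_iInf₂ fun K hK => absLower_one_le_of_isCoatom hG hK

theorem eq_top_of_sup_absLower_one [Finite G] [Fact p.Prime] {n : ℕ} (hG : absLower p G n = ⊥)
    {K : Subgroup G} (h : K ⊔ absLower p G 1 = ⊤) : K = ⊤ :=
  frattini_nongenerating (top_le_iff.1 (h.ge.trans (sup_le_sup_left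
    (absLower_one_le_frattini hG) K)))

/-- Modulo P₁(G) the group is abelian, so conjugates add nothing there, and P₁(G) consists of
nongenerators. -/
theorem closure_eq_top_of_normalClosure [Finite G] [Fact p.Prime] {n : ℕ}
    (hG : absLower p G n = ⊥) {s : Set G} (h : Subgroup.normalClosure s = ⊤) :
    Subgroup.closure s = ⊤ := by
  refine eq_top_of_sup_absLower_one hG (top_le_iff.1 (h.ge.trans ?_))
  have : (Subgroup.closure s ⊔ absLower p G 1).Normal := by
    refine ⟨fun x hx a => ?_⟩
    have h1 : a * x * a⁻¹ * x⁻¹ ∈ absLower p G 1 :=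
      commutator_mem_absStar (N := ⊤) a (Subgroup.mem_top x)
    have h2 := mul_mem (Subgroup.mem_sup_right (S := Subgroup.closure s) h1) hx
    rwa [inv_mul_cancel_right] at h2
  exact Subgroup.normalClosure_le_normal (Subgroup.subset_closure.trans
    (SetLike.coe_subset_coe.2 le_sup_left))

variable [TopologicalSpace G] [IsTopologicalGroup G]

theorem absStar_le_pStar (N : Subgroup G) : absStar p N ≤ pStar p N :=
  Subgroup.le_topologicalClosure _

theorem isClosed_lowerP : ∀ n, IsClosed (lowerP p G n : Set G)
  | 0 => isClosed_univ
  | _ + 1 => Subgroup.isClosed_topologicalClosure _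

theorem pStar_le_of_isClosed {N K : Subgroup G} (hK : IsClosed (K : Set G))
    (h : absStar p N ≤ K) : pStar p N ≤ K :=
  Subgroup.topologicalClosure_minimal _ h hK

theorem lowerP_antitone : Antitone (lowerP p G) :=
  antitone_nat_of_succ_le fun n => pStar_le_of_isClosed (isClosed_lowerP n) (absStar_le _)

theorem absLower_le_lowerP : ∀ n, absLower p G n ≤ lowerP p G n
  | 0 => le_rfl
  | n + 1 => (absStar_mono (absLower_le_lowerP n)).trans (absStar_le_pStar _)

theorem lowerP_eq_absLower [DiscreteTopology G] (n : ℕ) : lowerP p G n = absLower p G n := by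
  induction n with
  | zero => rfl
  | succ n ih =>
    refine le_antisymm ?_ (absLower_le_lowerP _)
    rw [lowerP, ih]
    exact pStar_le_of_isClosed (isClosed_discrete _) le_rfl

theorem lowerP_le_comap_absLower [TopologicalSpace E] [DiscreteTopology E] {f : G →* E}
    (hf : Continuous f) (n : ℕ) : lowerP p G n ≤ (absLower p E n).comap f := by
  induction n with
  | zero => exact fun _ _ => Subgroup.mem_top _
  | succ n ih =>
    have h : IsClosed (f ⁻¹' (absLower p E (n + 1) : Set E)) := (isClosed_discrete _).preimage hf
    exact pStar_le_of_isClosed h (absStar_le_comap f ih)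

end AbstractSeries

/-! ### Fibrewise counting -/

section Fibres

/-- The common form of the counts below: constant fibres give |A| = |B|·|C|. Keeping `f` as first
coordinate lets `card_tuples` count conditions that depend only on images. -/
theorem exists_equiv_prod {A B C : Type*} (f : A → B) (h : ∀ b, Nonempty ({a // f a = b} ≃ C)) :
    ∃ e : A ≃ B × C, ∀ a, (e a).1 = f a :=
  ⟨(Equiv.sigmaFiberEquiv f).symm.trans
    ((Equiv.sigmaCongrRight fun b => (h b).some).trans (Equiv.sigmaEquivProd B C)), fun _ => rfl⟩

theorem card_tuples {A B C : Type*} (f : A → B) (e : A ≃ B × C) (he : ∀ a, (e a).1 = f a)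
    (m : ℕ) (P : (Fin m → B) → Prop) :
    Nat.card {v : Fin m → A // P fun i => f (v i)} =
      Nat.card {w : Fin m → B // P w} * Nat.card C ^ m := by
  have e1 : {v : Fin m → A // P fun i => f (v i)} ≃ {w : Fin m → B // P w} × (Fin m → C) :=
    { toFun v := (⟨fun i => f (v.1 i), v.2⟩, fun i => (e (v.1 i)).2)
      invFun w := ⟨fun i => e.symm (w.1.1 i, w.2 i), by
        simpa [← he] using w.1.2⟩
      left_inv v := by
        ext i
        simp [← he]
      right_inv w := by
        ext i <;> simp [← he] }
  rw [Nat.card_congr e1, Nat.card_prod, Nat.card_fun, Nat.card_fin]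

end Fibres

/-! ### Involutions of groups of odd order -/

section Involution

variable {K : Type*} [Group K]

/-- The square root of an element of a finite group of odd order. -/
def oddRoot (x : K) : K := x ^ ((Nat.card K + 1) / 2)

theorem oddRoot_mul_self (hK : Odd (Nat.card K)) (x : K) : oddRoot x * oddRoot x = x := by
  obtain ⟨k, hk⟩ := hK
  have h : (Nat.card K + 1) / 2 + (Nat.card K + 1) / 2 = Nat.card K + 1 := by omega
  rw [oddRoot, ← pow_add, h, pow_succ, pow_card_eq_one', one_mul]

theorem oddRoot_mem {x : K} {N : Subgroup K} (h : x ∈ N) : oddRoot x ∈ N := pow_mem h _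

theorem map_oddRoot {σ : K →* K} {x : K} (h : σ x = x⁻¹) : σ (oddRoot x) = (oddRoot x)⁻¹ := by
  rw [oddRoot, map_pow, h, inv_pow]

theorem map_oddRoot_mul_mem {σ : K →* K} {x : K} {N : Subgroup K} [N.Normal]
    (h : σ x * x ∈ N) : σ (oddRoot x) * oddRoot x ∈ N := by
  rw [← QuotientGroup.eq_one_iff, QuotientGroup.mk_mul, mul_eq_one_iff_eq_inv] at h ⊢
  rw [oddRoot, map_pow, QuotientGroup.mk_pow, h, QuotientGroup.mk_pow, inv_pow]

/-- The elements of `N` inverted by `σ`. -/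
abbrev InvIn (σ : K →* K) (N : Subgroup K) : Type _ := {x : K // σ x = x⁻¹ ∧ x ∈ N}

variable (hK : Odd (Nat.card K)) {σ : K →* K} (hσ : ∀ x, σ (σ x) = x)

-- With u the root of y, the element x = u σ(u)⁻¹ is inverted by σ, and σ(u) ≡ u⁻¹ modulo N gives x
-- ≡ u² = y.
include hK hσ in
theorem exists_inverted {M N : Subgroup K} [N.Normal] (hM : ∀ x ∈ M, σ x ∈ M) {y : K}
    (hyM : y ∈ M) (hy : σ y * y ∈ N) : ∃ x, σ x = x⁻¹ ∧ x ∈ M ∧ y⁻¹ * x ∈ N := by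
  refine ⟨oddRoot y * (σ (oddRoot y))⁻¹, ?_, ?_, ?_⟩
  · rw [map_mul, map_inv, hσ, mul_inv_rev, inv_inv]
  · exact mul_mem (oddRoot_mem hyM) (inv_mem (hM _ (oddRoot_mem hyM)))
  · have h := inv_mem (map_oddRoot_mul_mem hy)
    have e : y⁻¹ * (oddRoot y * (σ (oddRoot y))⁻¹) = (σ (oddRoot y) * oddRoot y)⁻¹ := by
      conv_lhs => enter [1]; rw [← oddRoot_mul_self hK y]
      group
    rwa [e]

-- Translation by x₀ does not respect inverted elements. Writing x₀ = u² with u inverted, the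
-- two-sided map w ↦ u w u does, and it carries N onto the coset x₀N.
include hK in
theorem nonempty_coset_equiv {M N : Subgroup K} [N.Normal] (hNM : N ≤ M) {x₀ : K}
    (h₀ : σ x₀ = x₀⁻¹) (h₀M : x₀ ∈ M) :
    Nonempty ({x : InvIn σ M // x₀⁻¹ * x.1 ∈ N} ≃ InvIn σ N) := by
  have hu := map_oddRoot h₀
  have huu := oddRoot_mul_self hK x₀
  have huM := oddRoot_mem h₀M
  set u := oddRoot x₀
  have e : ∀ w, u⁻¹ * w * u⁻¹ = u * (x₀⁻¹ * w) * u⁻¹ := fun w => by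
    rw [← huu]
    group
  refine ⟨⟨fun x => ⟨u⁻¹ * x.1.1 * u⁻¹, ?_, ?_⟩, fun y => ⟨⟨u * y.1 * u, ?_, ?_⟩, ?_⟩, ?_, ?_⟩⟩
  · simp [hu, x.1.2.1, mul_assoc]
  · rw [e]
    exact ‹N.Normal›.conj_mem _ x.2 u
  · simp [hu, y.2.1, mul_assoc]
  · exact mul_mem (mul_mem huM (hNM y.2.2)) huM
  · have h := ‹N.Normal›.conj_mem _ y.2.2 u⁻¹
    rw [← huu]
    convert h using 1
    group
  · intro x
    ext
    simp [mul_assoc]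
  · intro y
    ext
    simp [mul_assoc]

include hK hσ in
/-- If `σ` inverts `M / N`, then the elements of `M` inverted by `σ` are equidistributed over the
cosets of `N`. -/
theorem exists_equiv_invIn {M N : Subgroup K} [N.Normal] (hNM : N ≤ M)
    (hinv : ∀ x ∈ M, σ x * x ∈ N) {V : Type*} (q : M → V) (hq : Function.Surjective q)
    (hqN : ∀ x y : M, q x = q y ↔ (x : K)⁻¹ * y ∈ N) :
    ∃ e : InvIn σ M ≃ V × InvIn σ N, ∀ x, (e x).1 = q ⟨x.1, x.2.2⟩ := by
  have hM : ∀ x ∈ M, σ x ∈ M := fun x hx => by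
    simpa using mul_mem (hNM (hinv x hx)) (inv_mem hx)
  refine exists_equiv_prod (fun x : InvIn σ M => q ⟨x.1, x.2.2⟩) fun b => ?_
  obtain ⟨y, rfl⟩ := hq b
  obtain ⟨x, hx, hxM, hyx⟩ := exists_inverted hK hσ hM y.2 (hinv y y.2)
  have hyx' : q y = q ⟨x, hxM⟩ := (hqN y ⟨x, hxM⟩).2 hyx
  obtain ⟨e⟩ := nonempty_coset_equiv hK hNM hx hxM
  refine ⟨(Equiv.subtypeEquivRight fun z => ?_).trans e⟩
  rw [hyx', eq_comm, hqN]

include hK hσ in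
theorem card_invIn {M N : Subgroup K} [N.Normal] (hNM : N ≤ M)
    (hinv : ∀ x ∈ M, σ x * x ∈ N) :
    Nat.card (InvIn σ M) = N.relIndex M * Nat.card (InvIn σ N) := by
  obtain ⟨e, -⟩ := exists_equiv_invIn hK hσ hNM hinv (V := M ⧸ N.subgroupOf M)
    (fun x => (x : M ⧸ N.subgroupOf M)) Quotient.mk_surjective
    (fun x y => by rw [QuotientGroup.eq, Subgroup.mem_subgroupOf]; rfl)
  rw [Nat.card_congr e, Nat.card_prod]
  rfl

-- The map x ↦ x σ(x)⁻¹ identifies the left cosets of the fixed subgroup with the inverted elements;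
-- it hits an inverted x at the root of x.
include hK hσ in
theorem card_inverted_mul_card_fixed :
    Nat.card {x : K // σ x = x⁻¹} * Nat.card {x : K // σ x = x} = Nat.card K := by
  rw [Subgroup.card_eq_card_quotient_mul_card_subgroup (MonoidHom.eqLocus σ (MonoidHom.id K))]
  congr 1
  symm
  let f : K → {x : K // σ x = x⁻¹} := fun x => ⟨x * (σ x)⁻¹, by
    rw [map_mul, map_inv, hσ, mul_inv_rev, inv_inv]⟩
  have hf : ∀ x y, f x = f y ↔ σ (x⁻¹ * y) = x⁻¹ * y := fun x y => by
    rw [Subtype.ext_iff, map_mul, map_inv]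
    change x * (σ x)⁻¹ = y * (σ y)⁻¹ ↔ _
    constructor
    · intro h
      rw [eq_inv_mul_iff_mul_eq, ← mul_assoc, h, inv_mul_cancel_right]
    · intro h
      rw [eq_inv_mul_iff_mul_eq, ← mul_assoc] at h
      rw [eq_mul_inv_iff_mul_eq, h]
  refine Nat.card_congr (Equiv.ofBijective (fun z => Quotient.liftOn' z f fun x y h => ?_) ⟨?_, ?_⟩)
  · rw [QuotientGroup.leftRel_apply] at h
    exact (hf x y).2 h
  · intro x y h
    induction x using QuotientGroup.induction_on with
    | H x =>
      induction y using QuotientGroup.induction_on with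
      | H y => exact QuotientGroup.eq.2 ((hf x y).1 h)
  · rintro ⟨x, hx⟩
    refine ⟨QuotientGroup.mk (oddRoot x), Subtype.ext ?_⟩
    change oddRoot x * (σ (oddRoot x))⁻¹ = x
    rw [map_oddRoot hx, inv_inv, oddRoot_mul_self hK]

end Involution

/-! ### Conjugacy of the involutions that invert the Frattini quotient -/

section Conjugacy

variable {p : ℕ} [Fact p.Prime] {G : Type*} [Group G] [Finite G] {n : ℕ}
  (hG : absLower p G n = ⊥) (hK : Odd (Nat.card G))

-- If the order were 2k, then t^k would be an involution trivial on G/P₁(G). Every coset of P₁(G)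
-- contains a fixed point of it, and these generate G, so t^k = 1, a contradiction.
include hG hK in
theorem odd_orderOf_of_mulAut {t : MulAut G} (ht : ∀ x, x⁻¹ * t x ∈ absLower p G 1) :
    Odd (orderOf t) := by
  rw [← Nat.not_even_iff_odd]
  intro he
  have hpos : 0 < orderOf t := orderOf_pos t
  obtain ⟨k, hk⟩ := he
  have hs : ∀ j : ℕ, ∀ x, x⁻¹ * (t ^ j) x ∈ absLower p G 1 := fun j => by
    induction j with
    | zero => simp
    | succ j ih =>
      intro x
      rw [pow_succ, MulAut.mul_apply]
      have := mul_mem (ht x) (ih (t x))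
      rwa [mul_assoc, mul_inv_cancel_left] at this
  have hinv : ∀ x, (t ^ k) ((t ^ k) x) = x := fun x => by
    rw [← MulAut.mul_apply, ← pow_add, ← hk, pow_orderOf_eq_one, MulAut.one_apply]
  have htop : MonoidHom.eqLocus (t ^ k : MulAut G).toMonoidHom (MonoidHom.id G) = ⊤ := by
    refine eq_top_of_sup_absLower_one hG (top_le_iff.1 fun x _ => ?_)
    have h1 : (t ^ k : MulAut G).toMonoidHom (x⁻¹ * (t ^ k) x) = (x⁻¹ * (t ^ k) x)⁻¹ := by
      change (t ^ k) (x⁻¹ * (t ^ k) x) = _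
      rw [map_mul, hinv, map_inv, mul_inv_rev, inv_inv]
    have hv := map_oddRoot h1
    have hvv := oddRoot_mul_self hK (x⁻¹ * (t ^ k) x)
    have hvm := oddRoot_mem (hs k x)
    set v := oddRoot (x⁻¹ * (t ^ k) x)
    have h2 : x * v ∈ MonoidHom.eqLocus (t ^ k : MulAut G).toMonoidHom (MonoidHom.id G) := by
      change (t ^ k : MulAut G).toMonoidHom (x * v) = x * v
      rw [map_mul, hv, mul_inv_eq_iff_eq_mul, mul_assoc, hvv, mul_inv_cancel_left]
      rfl
    have h3 := mul_mem (Subgroup.mem_sup_left (T := absLower p G 1) h2)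
      (Subgroup.mem_sup_right (inv_mem hvm))
    rwa [mul_inv_cancel_right] at h3
  have h1 : t ^ k = 1 := by
    ext x
    have : x ∈ MonoidHom.eqLocus (t ^ k : MulAut G).toMonoidHom (MonoidHom.id G) :=
      htop ▸ Subgroup.mem_top x
    exact this
  have := orderOf_dvd_of_pow_eq_one h1
  have := Nat.le_of_dvd (by omega) this
  omega

include hG hK in
/-- Two involutions inverting the Frattini quotient of a finite `p`-group, `p` odd, are
conjugate. -/
theorem exists_conj_of_inverts {σ τ : MulAut G} (hσ : ∀ x, σ (σ x) = x) (hτ : ∀ x, τ (τ x) = x)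
    (hσ' : ∀ x, σ x * x ∈ absLower p G 1) (hτ' : ∀ x, τ x * x ∈ absLower p G 1) :
    ∃ u : MulAut G, ∀ x, u (τ x) = σ (u x) := by
  have hs : σ * σ = 1 := MulEquiv.ext hσ
  have ht : τ * τ = 1 := MulEquiv.ext hτ
  have hodd : Odd (orderOf (σ * τ)) := by
    refine odd_orderOf_of_mulAut hG hK fun x => ?_
    have h1 := hσ' (τ x)
    rw [MulAut.mul_apply]
    have h4 : x⁻¹ * (τ x)⁻¹ ∈ absLower p G 1 := by
      rw [← mul_inv_rev]; exact inv_mem (hτ' x)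
    have h5 := mul_mem h4 (((absLower_normal (p := p) (G := G) 1).mem_comm h1))
    rwa [mul_assoc, inv_mul_cancel_left] at h5
  obtain ⟨k, hk⟩ := hodd
  set t := σ * τ with htdef
  have hti : t⁻¹ = τ * σ := by
    rw [htdef, mul_inv_rev, inv_eq_of_mul_eq_one_right hs, inv_eq_of_mul_eq_one_right ht]
  have huu : t ^ (k + 1) * t ^ (k + 1) = t := by
    rw [← pow_add, show k + 1 + (k + 1) = orderOf t + 1 by omega, pow_succ, pow_orderOf_eq_one,
      one_mul]
  have hconj : SemiconjBy σ t t⁻¹ := by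
    rw [SemiconjBy, hti, htdef, ← mul_assoc, hs, mul_assoc, hs, one_mul, mul_one]
  -- The conjugator u = t^(k+1) is a square root of t = στ, whose order is 2k+1. As σ inverts t, σu
  -- = u⁻¹σ = u⁻¹tτ = uτ.
  refine ⟨t ^ (k + 1), fun x => ?_⟩
  have key : t ^ (k + 1) * τ = σ * t ^ (k + 1) := by
    rw [(hconj.pow_right (k + 1)).eq, inv_pow, eq_inv_mul_iff_mul_eq, ← mul_assoc, huu, htdef, mul_assoc, ht, mul_one]
  exact DFunLike.congr_fun key x

end Conjugacy

/-! ### Counting spanning tuples -/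

/-- Row rank equals column rank: m vectors span a space of dimension d exactly when their d
coordinate functions are independent in F^m, and independent families have a known count. -/
theorem card_spanning {F V : Type*} [Field F] [Fintype F] [AddCommGroup V] [Module F V]
    [Module.Finite F V] {m : ℕ} (hm : Module.finrank F V ≤ m) :
    Nat.card {w : Fin m → V // Submodule.span F (Set.range w) = ⊤} =
      ∏ i : Fin (Module.finrank F V), (Fintype.card F ^ m - Fintype.card F ^ (i : ℕ)) := by
  have h1 := card_linearIndependent (K := F) (V := Fin m → F) (k := Module.finrank F V)
    (by rwa [Module.finrank_fin_fun])
  rw [Module.finrank_fin_fun] at h1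
  rw [← h1]
  let b := (Module.finBasis F V).equivFun
  have key : ∀ A : Matrix (Fin m) (Fin (Module.finrank F V)) F,
      Submodule.span F (Set.range A.row) = ⊤ ↔ LinearIndependent F A.transpose.row := fun A => by
    rw [linearIndependent_iff_card_eq_finrank_span, Set.finrank, ← Matrix.rank_eq_finrank_span_row,
      Matrix.rank_transpose, Matrix.rank_eq_finrank_span_row, Fintype.card_fin]
    constructor
    · intro h
      rw [h, finrank_top, Module.finrank_fin_fun]
    · intro h
      apply Submodule.eq_top_of_finrank_eq
      rw [← h, Module.finrank_fin_fun]
  let e : (Fin m → V) ≃ (Fin (Module.finrank F V) → Fin m → F) :=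
    (Equiv.piCongrRight fun _ => b.toEquiv).trans
      (Equiv.piComm fun (_ : Fin m) (_ : Fin (Module.finrank F V)) => F)
  refine Nat.card_congr (e.subtypeEquiv fun w => ?_)
  have h2 := key (fun i => b (w i))
  have h3 : Submodule.span F (Set.range (Matrix.row fun i => b (w i))) =
      (Submodule.span F (Set.range w)).map b.toLinearMap := by
    rw [Submodule.map_span, ← Set.range_comp]
    rfl
  rw [h3, ← LinearEquiv.range b, LinearMap.range_eq_map] at h2
  refine Iff.trans ?_ h2
  exact (Submodule.map_injective_of_injective b.injective).eq_iff.symm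

theorem eta_pos {p : ℕ} (hp : 1 < p) (j : ℕ) : 0 < eta p j := by
  refine Finset.prod_pos fun k hk => sub_pos.2 (inv_lt_one_of_one_lt₀ ?_)
  exact one_lt_pow₀ (by exact_mod_cast hp) (by have := (Finset.mem_Icc.1 hk).1; omega)

theorem eta_succ (p j : ℕ) : eta p (j + 1) = eta p j * (1 - ((p : ℝ) ^ (j + 1))⁻¹) :=
  Finset.prod_Icc_succ_top (Nat.le_add_left 1 j) _

/-- Converts the number of spanning tuples into η_m / η_{m-h}, kept free of division for the
induction on h. -/
theorem prod_pow_sub_pow {p : ℕ} (hp : 1 < p) {m : ℕ} : ∀ {h : ℕ}, h ≤ m →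
    ((∏ i : Fin h, (p ^ m - p ^ (i : ℕ)) : ℕ) : ℝ) * eta p (m - h) = p ^ (m * h) * eta p m
  | 0, _ => by simp
  | h + 1, hm => by
    have ih := prod_pow_sub_pow hp (m := m) (h := h) (by omega)
    have hp0 : (p : ℝ) ≠ 0 := by positivity
    rw [show m - h = m - (h + 1) + 1 by omega, eta_succ] at ih
    rw [Fin.prod_univ_castSucc]
    simp only [Fin.val_castSucc, Fin.val_last, Nat.cast_mul]
    rw [Nat.cast_sub (Nat.pow_le_pow_right (by omega : 0 < p) (by omega : h ≤ m)), Nat.cast_pow, Nat.cast_pow,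
      mul_add, pow_add, mul_one, mul_right_comm (_ ^ _), ← ih]
    rw [show m - (h + 1) + 1 = m - h by omega]
    have e : (p : ℝ) ^ m = p ^ h * p ^ (m - h) := by rw [← pow_add]; congr 1; omega
    have : (p : ℝ) ^ (m - h) ≠ 0 := by positivity
    rw [e]
    field_simp

/-! ### The quotient `N / [G, N] N ^ p` and its dual -/

section StarQuot

variable (p : ℕ) {G : Type*} [Group G] (N : Subgroup G) [N.Normal]

/-- `N / [G, N] N ^ p`. -/
abbrev StarQuot : Type _ := N ⧸ (absStar p N).subgroupOf N

instance : CommGroup (StarQuot p N) where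
  __ := (inferInstance : Group (N ⧸ (absStar p N).subgroupOf N))
  mul_comm := by
    intro x y
    induction x using QuotientGroup.induction_on with
    | H a =>
      induction y using QuotientGroup.induction_on with
      | H b =>
        rw [← QuotientGroup.mk_mul, ← QuotientGroup.mk_mul, QuotientGroup.eq,
          Subgroup.mem_subgroupOf]
        have h := commutator_mem_absStar (p := p) ((b : G)⁻¹) (inv_mem a.2)
        simpa [mul_assoc] using h

instance : Module (ZMod p) (Additive (StarQuot p N)) :=
  AddCommGroup.zmodModule <| by
    intro x
    induction x using Additive.rec with
    | ofMul x =>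
      induction x using QuotientGroup.induction_on with
      | H a =>
        rw [← ofMul_pow, ← QuotientGroup.mk_pow, ofMul_eq_zero, QuotientGroup.eq_one_iff,
          Subgroup.mem_subgroupOf]
        exact pow_mem_absStar a.2

/-- The projection of `N` onto `N / [G, N] N ^ p`, written additively. -/
def starMk (x : N) : Additive (StarQuot p N) := Additive.ofMul (QuotientGroup.mk x)

variable {p N}

omit [N.Normal] in
theorem starMk_surjective : Function.Surjective (starMk p N) := fun x => by
  induction x using Additive.rec with
  | ofMul x =>
    induction x using QuotientGroup.induction_on with
    | H a => exact ⟨a, rfl⟩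

theorem starMk_mul (x y : N) : starMk p N (x * y) = starMk p N x + starMk p N y := rfl

theorem starMk_one : starMk p N 1 = 0 := rfl

theorem starMk_inv (x : N) : starMk p N x⁻¹ = -starMk p N x := rfl

omit [N.Normal] in
theorem starMk_eq_iff (x y : N) : starMk p N x = starMk p N y ↔ (x : G)⁻¹ * y ∈ absStar p N := by
  rw [starMk, starMk, EmbeddingLike.apply_eq_iff_eq, QuotientGroup.eq, Subgroup.mem_subgroupOf]
  rfl

theorem starMk_eq_zero_iff (x : N) : starMk p N x = 0 ↔ (x : G) ∈ absStar p N := by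
  rw [← starMk_one, eq_comm, starMk_eq_iff, Subgroup.coe_one, inv_one, one_mul]

theorem starMk_conj (a : G) {x : G} (hx : x ∈ N) (hx' : a * x * a⁻¹ ∈ N) :
    starMk p N ⟨a * x * a⁻¹, hx'⟩ = starMk p N ⟨x, hx⟩ := by
  rw [eq_comm, starMk_eq_iff]
  exact (absStar_normal (p := p) N).mem_comm (commutator_mem_absStar a hx)

omit [N.Normal] in
theorem card_starQuot : Nat.card (Additive (StarQuot p N)) = (absStar p N).relIndex N := rfl

theorem relIndex_absStar [Finite G] [Fact p.Prime] :
    (absStar p N).relIndex N = p ^ Module.finrank (ZMod p) (Additive (StarQuot p N)) := by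
  have : Finite (Additive (StarQuot p N)) := (inferInstance : Finite (StarQuot p N))
  rw [← card_starQuot, Module.natCard_eq_pow_finrank (K := ZMod p), Nat.card_zmod]

/-- Burnside's basis theorem for relators. Conjugation is trivial on N/N*, so the preimage of a
subspace is normal; conversely, spanning gives N ≤ ⟨v⟩N*, and `le_of_le_sup_absStar` removes N*. -/
theorem normalClosure_eq_iff {n : ℕ} (hG : absLower p G n = ⊥) {ι : Type*} (v : ι → N) :
    Subgroup.normalClosure (Set.range fun i => (v i : G)) = N ↔
      Submodule.span (ZMod p) (Set.range fun i => starMk p N (v i)) = ⊤ := by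
  have hle : Subgroup.normalClosure (Set.range fun i => (v i : G)) ≤ N :=
    Subgroup.normalClosure_le_normal (by rintro _ ⟨i, rfl⟩; exact (v i).2)
  constructor
  · intro h
    let S := Submodule.span (ZMod p) (Set.range fun i => starMk p N (v i))
    let L : Subgroup G :=
      { carrier := {x | ∃ hx : x ∈ N, starMk p N ⟨x, hx⟩ ∈ S}
        mul_mem' := by
          rintro x y ⟨hx, hx'⟩ ⟨hy, hy'⟩
          exact ⟨mul_mem hx hy, add_mem hx' hy'⟩
        one_mem' := ⟨one_mem _, zero_mem _⟩
        inv_mem' := by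
          rintro x ⟨hx, hx'⟩
          exact ⟨inv_mem hx, neg_mem hx'⟩ }
    have hL : L.Normal := ⟨by
      rintro x ⟨hx, hx'⟩ a
      refine ⟨‹N.Normal›.conj_mem x hx a, ?_⟩
      rwa [starMk_conj a hx]⟩
    have hNL : N ≤ L := by
      conv_lhs => rw [← h]
      refine Subgroup.normalClosure_le_normal ?_
      rintro _ ⟨i, rfl⟩
      exact ⟨(v i).2, Submodule.subset_span ⟨i, rfl⟩⟩
    refine top_le_iff.1 fun y _ => ?_
    obtain ⟨x, rfl⟩ := starMk_surjective y
    exact (hNL x.2).2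
  · intro h
    refine le_antisymm hle (le_of_le_sup_absStar hG fun x hx => ?_)
    have key : ∀ y : Additive (StarQuot p N), ∃ m : N,
        (m : G) ∈ Subgroup.normalClosure (Set.range fun i => (v i : G)) ∧ starMk p N m = y := by
      intro y
      have hy : y ∈ Submodule.span (ZMod p) (Set.range fun i => starMk p N (v i)) :=
        h ▸ Submodule.mem_top
      induction hy using Submodule.span_induction with
      | mem y hy =>
        obtain ⟨i, rfl⟩ := hy
        exact ⟨v i, Subgroup.subset_normalClosure ⟨i, rfl⟩, rfl⟩
      | zero => exact ⟨1, one_mem _, rfl⟩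
      | add y z _ _ hy hz =>
        obtain ⟨a, ha, rfl⟩ := hy
        obtain ⟨b, hb, rfl⟩ := hz
        exact ⟨a * b, mul_mem ha hb, rfl⟩
      | smul t y _ hy =>
        obtain ⟨a, ha, rfl⟩ := hy
        obtain ⟨k, rfl⟩ := ZMod.intCast_surjective t
        refine ⟨a ^ k, zpow_mem ha k, ?_⟩
        rw [Int.cast_smul_eq_zsmul]
        rfl
    obtain ⟨m, hm, hmx⟩ := key (starMk p N ⟨x, hx⟩)
    have h1 := mul_mem (Subgroup.mem_sup_left (T := absStar p N) hm)
      (Subgroup.mem_sup_right ((starMk_eq_iff _ _).1 hmx))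
    rwa [mul_inv_cancel_left] at h1

variable (p N)

/-- The homomorphisms `N → 𝔽_p` that are invariant under conjugation, extended by zero. -/
def InvHom : Submodule (ZMod p) (G → ZMod p) where
  carrier := {f | (∀ x, x ∉ N → f x = 0) ∧ (∀ x ∈ N, ∀ y ∈ N, f (x * y) = f x + f y) ∧
    ∀ a, ∀ x ∈ N, f (a * x * a⁻¹) = f x}
  add_mem' := fun {f f'} hf hf' => by
    refine ⟨fun x hx => ?_, fun x hx y hy => ?_, fun a x hx => ?_⟩
    · simp [hf.1 x hx, hf'.1 x hx]
    · simp only [Pi.add_apply, hf.2.1 x hx y hy, hf'.2.1 x hx y hy]; ring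
    · simp only [Pi.add_apply, hf.2.2 a x hx, hf'.2.2 a x hx]
  zero_mem' := by simp
  smul_mem' := fun t f hf => by
    refine ⟨fun x hx => ?_, fun x hx y hy => ?_, fun a x hx => ?_⟩
    · simp [hf.1 x hx]
    · simp only [Pi.smul_apply, hf.2.1 x hx y hy, smul_add]
    · simp only [Pi.smul_apply, hf.2.2 a x hx]

variable {p N}

namespace InvHom

variable {f : G → ZMod p} (hf : f ∈ InvHom p N)

include hf

omit [N.Normal] in
theorem map_mul {x y : G} (hx : x ∈ N) (hy : y ∈ N) : f (x * y) = f x + f y := hf.2.1 x hx y hy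

omit [N.Normal] in
theorem map_conj (a : G) {x : G} (hx : x ∈ N) : f (a * x * a⁻¹) = f x := hf.2.2 a x hx

omit [N.Normal] in
theorem map_one : f 1 = 0 := by
  have := map_mul hf (one_mem N) (one_mem N)
  rwa [mul_one, left_eq_add] at this

omit [N.Normal] in
theorem map_inv {x : G} (hx : x ∈ N) : f x⁻¹ = -f x := by
  have := map_mul hf (inv_mem hx) hx
  rw [inv_mul_cancel, map_one hf] at this
  exact eq_neg_of_add_eq_zero_left this.symm

omit [N.Normal] in
theorem map_pow {x : G} (hx : x ∈ N) (k : ℕ) : f (x ^ k) = k * f x := by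
  induction k with
  | zero => simp [map_one hf]
  | succ k ih =>
    rw [pow_succ, map_mul hf (pow_mem hx k) hx, ih]
    push_cast
    ring

/-- The kernel of a homomorphism on `N`. -/
def ker : Subgroup G where
  carrier := {x | x ∈ N ∧ f x = 0}
  mul_mem' := fun hx hy => ⟨mul_mem hx.1 hy.1, by rw [map_mul hf hx.1 hy.1, hx.2, hy.2, add_zero]⟩
  one_mem' := ⟨one_mem _, map_one hf⟩
  inv_mem' := fun hx => ⟨inv_mem hx.1, by rw [map_inv hf hx.1, hx.2, neg_zero]⟩

theorem absStar_le_ker : absStar p N ≤ ker hf := by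
  have hN := ‹N.Normal›
  refine absStar_le_iff.2 ⟨fun a b hb => ⟨?_, ?_⟩, fun b hb => ⟨pow_mem hb p, ?_⟩⟩
  · exact mul_mem (hN.conj_mem b hb a) (inv_mem hb)
  · rw [map_mul hf (hN.conj_mem b hb a) (inv_mem hb), map_conj hf a hb, map_inv hf hb,
      add_neg_cancel]
  · rw [map_pow hf hb, CharP.cast_eq_zero, zero_mul]

theorem eq_zero_of_mem_absStar {x : G} (hx : x ∈ absStar p N) : f x = 0 :=
  (absStar_le_ker hf hx).2

end InvHom

open Classical in
/-- A functional on `N / [G, N] N ^ p` is an invariant homomorphism on `N`. -/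
def dualToInvHom : Module.Dual (ZMod p) (Additive (StarQuot p N)) →ₗ[ZMod p] InvHom p N where
  toFun φ := ⟨fun x => if hx : x ∈ N then φ (starMk p N ⟨x, hx⟩) else 0, by
    have hN := ‹N.Normal›
    refine ⟨fun x hx => by simp [hx], fun x hx y hy => ?_, fun a x hx => ?_⟩
    · beta_reduce
      rw [dif_pos hx, dif_pos hy, dif_pos (mul_mem hx hy), ← _root_.map_add, ← starMk_mul]
      rfl
    · beta_reduce
      rw [dif_pos hx, dif_pos (hN.conj_mem x hx a)]
      rw [starMk_conj a hx]⟩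
  map_add' φ ψ := by
    ext x
    by_cases hx : x ∈ N <;> simp [hx]
  map_smul' t φ := by
    ext x
    by_cases hx : x ∈ N <;> simp [hx]

theorem dualToInvHom_apply (φ : Module.Dual (ZMod p) (Additive (StarQuot p N))) (x : N) :
    (dualToInvHom φ).1 x = φ (starMk p N x) := by
  simp [dualToInvHom]

theorem dualToInvHom_bijective : Function.Bijective (dualToInvHom (p := p) (N := N)) := by
  constructor
  · intro φ ψ h
    ext y
    obtain ⟨x, rfl⟩ := starMk_surjective y
    rw [← dualToInvHom_apply, h, dualToInvHom_apply]
  · rintro ⟨f, hf⟩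
    let F : N →* Multiplicative (ZMod p) :=
      { toFun x := Multiplicative.ofAdd (f x)
        map_one' := by
          rw [Subgroup.coe_one, InvHom.map_one hf]
          rfl
        map_mul' x y := by
          rw [Subgroup.coe_mul, InvHom.map_mul hf x.2 y.2]
          rfl }
    let Φ : StarQuot p N →* Multiplicative (ZMod p) := QuotientGroup.lift _ F fun x hx => by
      change Multiplicative.ofAdd (f x) = _
      rw [InvHom.eq_zero_of_mem_absStar hf (Subgroup.mem_subgroupOf.1 hx)]
      rfl
    let φ : Additive (StarQuot p N) →+ ZMod p := MonoidHom.toAdditiveLeft Φ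
    refine ⟨AddMonoidHom.toZModLinearMap p φ, ?_⟩
    ext x
    by_cases hx : x ∈ N
    · exact dualToInvHom_apply (AddMonoidHom.toZModLinearMap p φ) ⟨x, hx⟩
    · rw [(dualToInvHom _).2.1 x hx]
      exact (hf.1 x hx).symm

variable [Fact p.Prime]

/-- Linear functionals separate the points of N/N*, and each of them is an invariant homomorphism.
-/
theorem mem_absStar_of_forall_invHom {x : G} (hx : x ∈ N) (h : ∀ f ∈ InvHom p N, f x = 0) :
    x ∈ absStar p N := by
  have : starMk p N ⟨x, hx⟩ = 0 := by
    rw [← Module.forall_dual_apply_eq_zero_iff (ZMod p)]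
    intro φ
    rw [← dualToInvHom_apply]
    exact h _ (dualToInvHom φ).2
  exact (starMk_eq_zero_iff _).1 this

theorem finrank_invHom [Finite G] :
    Module.finrank (ZMod p) (InvHom p N) =
      Module.finrank (ZMod p) (Additive (StarQuot p N)) := by
  rw [← (LinearEquiv.ofBijective dualToInvHom dualToInvHom_bijective).finrank_eq,
    Subspace.dual_finrank_eq]

end StarQuot

/-! ### Inflation of the classes attached to invariant homomorphisms -/

section Inflation

universe u

variable {p : ℕ} {Q : Type*} {G : Type*} {H : Type u} [Group Q] [Group G] [Group H]
  [TopologicalSpace G] [DiscreteTopology G] [TopologicalSpace H]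
  {π : Q →* G} {s s' : G → Q} (hs : ∀ x, π (s x) = x) (hs' : ∀ x, π (s' x) = x)

section Sections

variable {f : Q → ZMod p} (hf : f ∈ InvHom p π.ker)

omit [TopologicalSpace G] [DiscreteTopology G]

include hs in
theorem section_mem_ker (x y : G) : s x * s y * (s (x * y))⁻¹ ∈ π.ker := by
  simp [MonoidHom.mem_ker, hs]

-- The identity `e` evaluates s(x)s(y)s(z)s(xyz)⁻¹ with two bracketings; invariance of `f` discards
-- the conjugation by s(x).
include hs hf in
theorem section_cocycle (x y z : G) :
    f (s y * s z * (s (y * z))⁻¹) - f (s (x * y) * s z * (s (x * y * z))⁻¹) +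
      f (s x * s (y * z) * (s (x * (y * z)))⁻¹) - f (s x * s y * (s (x * y))⁻¹) = 0 := by
  have h := section_mem_ker hs
  have e : s x * (s y * s z * (s (y * z))⁻¹) * (s x)⁻¹ *
      (s x * s (y * z) * (s (x * (y * z)))⁻¹) =
      s x * s y * (s (x * y))⁻¹ * (s (x * y) * s z * (s (x * y * z))⁻¹) := by
    rw [mul_assoc x y z]
    group
  have e' := congrArg f e
  rw [InvHom.map_mul hf (Subgroup.Normal.conj_mem inferInstance _ (h y z) _) (h x (y * z)),
    InvHom.map_conj hf _ (h y z), InvHom.map_mul hf (h x y) (h (x * y) z)] at e'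
  linear_combination e'

-- Changing the section alters the cocycle by the coboundary of x ↦ f(s(x)s'(x)⁻¹).
include hs hs' hf in
theorem section_sub_section (x y : G) :
    f (s x * s y * (s (x * y))⁻¹) - f (s' x * s' y * (s' (x * y))⁻¹) =
      f (s y * (s' y)⁻¹) - f (s (x * y) * (s' (x * y))⁻¹) + f (s x * (s' x)⁻¹) := by
  have hβ : ∀ x, s x * (s' x)⁻¹ ∈ π.ker := fun x => by simp [MonoidHom.mem_ker, hs, hs']
  have h := section_mem_ker hs'
  have hc : s' x * (s y * (s' y)⁻¹) * (s' x)⁻¹ ∈ π.ker :=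
    Subgroup.Normal.conj_mem inferInstance _ (hβ y) _
  have e : s x * s y * (s (x * y))⁻¹ =
      s x * (s' x)⁻¹ * (s' x * (s y * (s' y)⁻¹) * (s' x)⁻¹) *
        (s' x * s' y * (s' (x * y))⁻¹) * (s (x * y) * (s' (x * y))⁻¹)⁻¹ := by
    group
  rw [e, InvHom.map_mul hf (mul_mem (mul_mem (hβ x) hc) (h x y)) (inv_mem (hβ _)),
    InvHom.map_mul hf (mul_mem (hβ x) hc) (h x y), InvHom.map_mul hf (hβ x) hc, InvHom.map_conj hf _ (hβ y),
    InvHom.map_inv hf (hβ _)]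
  ring

end Sections

variable (ρ : H →* G) (hρ : Continuous ρ)

include hρ in
theorem isLocallyConstant_section (f : Q → ZMod p) :
    IsLocallyConstant fun z : H × H => f (s (ρ z.1) * s (ρ z.2) * (s (ρ z.1 * ρ z.2))⁻¹) :=
  IsLocallyConstant.comp_continuous (f := fun z : H × H => (ρ z.1, ρ z.2))
    (g := fun z : G × G => f (s z.1 * s z.2 * (s (z.1 * z.2))⁻¹))
    (IsLocallyConstant.of_discrete _)
    ((hρ.comp continuous_fst).prodMk (hρ.comp continuous_snd))

/-- The inflation to `H` of the cocycle on `G` attached to an invariant homomorphism on the kernel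
of `π : Q → G` and a section `s` of `π`. -/
def inflCocycle : InvHom p π.ker →ₗ[ZMod p] Z2 p H where
  toFun f := ⟨⟨fun z => f.1 (s (ρ z.1) * s (ρ z.2) * (s (ρ z.1 * ρ z.2))⁻¹),
    isLocallyConstant_section ρ hρ f.1⟩, fun x y z => by
      simpa using section_cocycle hs f.2 (ρ x) (ρ y) (ρ z)⟩
  map_add' _ _ := rfl
  map_smul' _ _ := rfl

/-- The class of `inflCocycle`. -/
def infl : InvHom p π.ker →ₗ[ZMod p] H2 p H :=
  (Submodule.mkQ _).comp (inflCocycle hs ρ hρ)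

theorem H2.mk_eq_mk_iff (z z' : Z2 p H) :
    (Submodule.Quotient.mk z : H2 p H) = Submodule.Quotient.mk z' ↔
      ∃ b : LocallyConstant H (ZMod p), ∀ x y, z.1 (x, y) - z'.1 (x, y) =
        b y - b (x * y) + b x := by
  rw [Submodule.Quotient.eq]
  rfl

theorem infl_eq_zero_iff (f : InvHom p π.ker) :
    infl hs ρ hρ f = 0 ↔ ∃ b : LocallyConstant H (ZMod p), ∀ x y,
      f.1 (s (ρ x) * s (ρ y) * (s (ρ x * ρ y))⁻¹) = b y - b (x * y) + b x := by
  rw [← Submodule.Quotient.mk_zero]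
  refine (H2.mk_eq_mk_iff _ _).trans ?_
  refine exists_congr fun b => forall₂_congr fun x y => ?_
  change _ - 0 = _ ↔ _
  rw [sub_zero]
  rfl

section Injective

variable {f : Q → ZMod p} (hf : f ∈ InvHom p π.ker) {b : H → ZMod p}
  (hb : ∀ x y, f (s (ρ x) * s (ρ y) * (s (ρ x * ρ y))⁻¹) = b y - b (x * y) + b x)

omit [TopologicalSpace G] [DiscreteTopology G] [TopologicalSpace H]

-- When `b` trivialises the inflated cocycle, (x, q) ↦ f(q s(ρx)⁻¹) + b(x) is a homomorphism on the
-- fibre product of H and Q over G that extends `f`. `splittingGraph` is its kernel.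
include hs hf hb in
theorem splitting_mul {x y : H} {q r : Q} (hq : π q = ρ x) (hr : π r = ρ y)
    (hqx : f (q * (s (ρ x))⁻¹) = -b x) (hry : f (r * (s (ρ y))⁻¹) = -b y) :
    f (q * r * (s (ρ (x * y)))⁻¹) = -b (x * y) := by
  have h1 : q * (s (ρ x))⁻¹ ∈ π.ker := by simp [MonoidHom.mem_ker, hs, hq]
  have h2 : r * (s (ρ y))⁻¹ ∈ π.ker := by simp [MonoidHom.mem_ker, hs, hr]
  have h3 : s (ρ x) * (r * (s (ρ y))⁻¹) * (s (ρ x))⁻¹ ∈ π.ker :=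
    Subgroup.Normal.conj_mem inferInstance _ h2 _
  have e : q * r * (s (ρ (x * y)))⁻¹ = q * (s (ρ x))⁻¹ *
      (s (ρ x) * (r * (s (ρ y))⁻¹) * (s (ρ x))⁻¹) * (s (ρ x) * s (ρ y) * (s (ρ x * ρ y))⁻¹) := by
    rw [map_mul]
    group
  rw [e, InvHom.map_mul hf (mul_mem h1 h3) (section_mem_ker hs _ _), InvHom.map_mul hf h1 h3,
    InvHom.map_conj hf _ h2, hqx, hry, hb]
  ring

include hb in
theorem apply_section_one : f (s 1) = b 1 := by
  have h := hb 1 1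
  simp only [map_one, mul_one, mul_inv_cancel_right, sub_self, zero_add] at h
  exact h

include hs hf hb in
theorem splitting_one : f (1 * (s (ρ 1))⁻¹) = -b 1 := by
  have h1 : s 1 ∈ π.ker := by simp [MonoidHom.mem_ker, hs]
  rw [one_mul, map_one, InvHom.map_inv hf h1, apply_section_one ρ hb]

/-- The graph of the splitting of the pulled-back extension defined by `b`. -/
def splittingGraph : Subgroup (H × Q) where
  carrier := {z | π z.2 = ρ z.1 ∧ f (z.2 * (s (ρ z.1))⁻¹) = -b z.1}
  mul_mem' := fun {y z} hy hz => ⟨by simp [hy.1, hz.1],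
    splitting_mul hs ρ hf hb hy.1 hz.1 hy.2 hz.2⟩
  one_mem' := ⟨by simp, splitting_one hs ρ hf hb⟩
  inv_mem' := fun {z} hz => by
    have h1 : s (ρ z.1⁻¹) * z.2 ∈ π.ker := by simp [MonoidHom.mem_ker, hs, hz.1]
    have h3 : f (s (ρ z.1⁻¹) * z.2) = b z.1⁻¹ := by
      have h5 := hb z.1⁻¹ z.1
      have h6 : z.2 * (s (ρ z.1))⁻¹ ∈ π.ker := by simp [MonoidHom.mem_ker, hs, hz.1]
      have h7 : s 1 ∈ π.ker := by simp [MonoidHom.mem_ker, hs]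
      have e : s (ρ z.1⁻¹) * z.2 = s (ρ z.1⁻¹) * (z.2 * (s (ρ z.1))⁻¹) * (s (ρ z.1⁻¹))⁻¹ *
          (s (ρ z.1⁻¹) * s (ρ z.1) * (s (ρ z.1⁻¹ * ρ z.1))⁻¹) * s 1 := by
        rw [← map_mul, inv_mul_cancel, map_one]
        group
      have h8 : s (ρ z.1⁻¹) * (z.2 * (s (ρ z.1))⁻¹) * (s (ρ z.1⁻¹))⁻¹ ∈ π.ker :=
        Subgroup.Normal.conj_mem inferInstance _ h6 _
      rw [e, InvHom.map_mul hf (mul_mem h8 (section_mem_ker hs _ _)) h7,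
        InvHom.map_mul hf h8 (section_mem_ker hs _ _), InvHom.map_conj hf _ h6, h5, hz.2,
        apply_section_one ρ hb, inv_mul_cancel]
      ring
    refine ⟨by simp [hz.1], ?_⟩
    change f (z.2⁻¹ * (s (ρ z.1⁻¹))⁻¹) = -b z.1⁻¹
    rw [← mul_inv_rev, InvHom.map_inv hf h1, h3]

-- A nonzero `f` takes every value on powers of one element of the kernel, so s(ρx) can be corrected
-- to lie in the graph.
include hs hf hb in
theorem exists_mem_splittingGraph [Fact p.Prime] (hne : f ≠ 0) (x : H) :
    ∃ q, (x, q) ∈ splittingGraph hs ρ hf hb := by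
  obtain ⟨z, hz⟩ := Function.ne_iff.1 hne
  have hzm : z ∈ π.ker := by
    by_contra h
    exact hz (hf.1 z h)
  have hk := pow_mem hzm (-b x / f z).val
  refine ⟨z ^ (-b x / f z).val * s (ρ x), ?_, ?_⟩
  · have h1 : π (z ^ (-b x / f z).val) = 1 := hk
    rw [map_mul, h1, one_mul, hs]
  · change f (z ^ (-b x / f z).val * s (ρ x) * (s (ρ x))⁻¹) = -b x
    rw [mul_inv_cancel_right, InvHom.map_pow hf hzm, ZMod.natCast_zmod_val]
    exact div_mul_cancel₀ _ hz

end Injective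

section InjectiveTop

variable [Fact p.Prime] {n : ℕ} [IsTopologicalGroup H]

-- The graph surjects onto H, so commutators and p-th powers in H lift to commutators and p-th
-- powers in the graph, whose Q-coordinates descend the series of Q in step.
include hρ in
theorem lowerP_le_map_splittingGraph {f : Q → ZMod p} (hf : f ∈ InvHom p π.ker)
    (hne : f ≠ 0) {b : LocallyConstant H (ZMod p)}
    (hb : ∀ x y, f (s (ρ x) * s (ρ y) * (s (ρ x * ρ y))⁻¹) = b y - b (x * y) + b x) (j : ℕ) :
    lowerP p H j ≤ (splittingGraph hs ρ hf hb ⊓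
      (absLower p Q j).comap (MonoidHom.snd H Q)).map (MonoidHom.fst H Q) := by
  induction j with
  | zero =>
    intro x _
    obtain ⟨q, hq⟩ := exists_mem_splittingGraph hs ρ hf hb hne x
    exact ⟨(x, q), ⟨hq, Subgroup.mem_top _⟩, rfl⟩
  | succ j ih =>
    refine pStar_le_of_isClosed ?_ (absStar_le_iff.2 ⟨fun x y hy => ?_, fun y hy => ?_⟩)
    -- Membership in the image depends only on (ρx, b x), a point of a discrete space, so the image
    -- is closed.
    · have hc : Continuous fun x : H => (ρ x, b x) := hρ.prodMk b.continuous
      convert (isClosed_discrete {z : G × ZMod p | ∃ q ∈ absLower p Q (j + 1),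
        π q = z.1 ∧ f (q * (s z.1)⁻¹) = -z.2}).preimage hc using 1
      ext x
      constructor
      · rintro ⟨⟨_, q⟩, ⟨hq, hq'⟩, rfl⟩
        exact ⟨q, hq', hq⟩
      · rintro ⟨q, hq', hq⟩
        exact ⟨(x, q), ⟨hq, hq'⟩, rfl⟩
    · obtain ⟨⟨y, q⟩, ⟨hq, hq'⟩, rfl⟩ := ih hy
      change (y, q) ∈ splittingGraph hs ρ hf hb at hq
      obtain ⟨r, hr⟩ := exists_mem_splittingGraph hs ρ hf hb hne x
      have h := mul_mem (mul_mem (mul_mem hr hq) (inv_mem hr)) (inv_mem hq)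
      exact ⟨_, ⟨h, commutator_mem_absStar r hq'⟩, rfl⟩
    · obtain ⟨⟨_, q⟩, ⟨hq, hq'⟩, rfl⟩ := ih hy
      exact ⟨_, ⟨pow_mem hq p, pow_mem_absStar hq'⟩, rfl⟩

include hs in
/-- If `Q` has `p`-class at most `n`, and `G` is a quotient of `H` by a subgroup of `P_n(H)`, then
inflation is injective on the classes of the invariant homomorphisms. -/
theorem infl_injective (hQ : absLower p Q n = ⊥) (hπ : π.ker ≤ absLower p Q 1)
    (hρs : Function.Surjective ρ) (hρk : ρ.ker ≤ lowerP p H n) :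
    Function.Injective (infl (p := p) hs ρ hρ) := by
  rw [injective_iff_map_eq_zero]
  rintro ⟨f, hf⟩ h0
  obtain ⟨b, hb⟩ := (infl_eq_zero_iff hs ρ hρ _).1 h0
  change ∀ x y, f _ = _ at hb
  by_contra hne
  replace hne : f ≠ 0 := fun h => hne (Subtype.ext h)
  -- An element of ker ρ ≤ P_n(H) lifts to the graph with Q-coordinate in P_n(Q) = 1, which
  -- determines b there.
  have hb1 : ∀ k ∈ ρ.ker, b k = b 1 := fun k hk => by
    obtain ⟨⟨k, q⟩, ⟨hq, hq'⟩, rfl⟩ := lowerP_le_map_splittingGraph hs ρ hρ hf hne hb n (hρk hk)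
    change q ∈ absLower p Q n at hq'
    rw [hQ, Subgroup.mem_bot] at hq'
    have h1 := hq.2
    change ρ k = 1 at hk
    change f (q * (s (ρ k))⁻¹) = -b k at h1
    have h2 := splitting_one hs ρ hf hb
    rw [hk, hq', ← map_one ρ, h2] at h1
    exact (neg_injective h1).symm
  have hbρ : ∀ x y, ρ x = ρ y → b x = b y := fun x y hxy => by
    have h1 : x⁻¹ * y ∈ ρ.ker := by simp [MonoidHom.mem_ker, hxy]
    have h2 := hb x (x⁻¹ * y)
    have h3 := hb x 1
    rw [mul_inv_cancel_left, hb1 _ h1, MonoidHom.mem_ker.1 h1] at h2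
    rw [map_one, h2, mul_one] at h3
    linear_combination h3
  -- Since b is constant on the fibres of ρ, the homomorphism on the fibre product descends to Q. It
  -- extends `f`, yet every homomorphism Q → 𝔽_p kills P₁(Q), which contains ker π; hence f = 0.
  let χ : Q → ZMod p := fun q => f (q * (s (π q))⁻¹) + b (Function.surjInv hρs (π q))
  have hχ : ∀ q (x : H), π q = ρ x → χ q = f (q * (s (ρ x))⁻¹) + b x := fun q x hqx => by
    rw [← hbρ _ x ((Function.surjInv_eq hρs (π q)).trans hqx), ← hqx]
  have hχm : ∀ q r, χ (q * r) = χ q + χ r := fun q r => by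
    obtain ⟨x, hx⟩ := hρs (π q)
    obtain ⟨y, hy⟩ := hρs (π r)
    rw [hχ q x hx.symm, hχ r y hy.symm, hχ (q * r) (x * y) (by simp [hx, hy])]
    have h1 : q * (s (ρ x))⁻¹ ∈ π.ker := by simp [MonoidHom.mem_ker, hs, hx]
    have h2 : r * (s (ρ y))⁻¹ ∈ π.ker := by simp [MonoidHom.mem_ker, hs, hy]
    have h3 : s (ρ x) * (r * (s (ρ y))⁻¹) * (s (ρ x))⁻¹ ∈ π.ker :=
      Subgroup.Normal.conj_mem inferInstance _ h2 _
    have e : q * r * (s (ρ (x * y)))⁻¹ = q * (s (ρ x))⁻¹ *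
        (s (ρ x) * (r * (s (ρ y))⁻¹) * (s (ρ x))⁻¹) *
          (s (ρ x) * s (ρ y) * (s (ρ x * ρ y))⁻¹) := by
      rw [map_mul]
      group
    rw [e, InvHom.map_mul hf (mul_mem h1 h3) (section_mem_ker hs _ _), InvHom.map_mul hf h1 h3,
      InvHom.map_conj hf _ h2, hb]
    ring
  have hχ1 : χ 1 = 0 := by
    have := hχm 1 1
    rwa [mul_one, left_eq_add] at this
  have hχI : χ ∈ InvHom p (⊤ : Subgroup Q) := by
    refine ⟨fun x hx => (hx (Subgroup.mem_top x)).elim, fun x _ y _ => hχm x y, fun a x _ => ?_⟩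
    have h1 := hχm a a⁻¹
    rw [mul_inv_cancel, hχ1] at h1
    rw [hχm, hχm]
    linear_combination -h1
  refine hne (funext fun q => ?_)
  by_cases hq : q ∈ π.ker
  · have h1 := InvHom.eq_zero_of_mem_absStar hχI (hπ hq)
    have h7 : s 1 ∈ π.ker := by simp [MonoidHom.mem_ker, hs]
    rw [hχ q 1 (by rw [map_one]; exact hq), map_one, InvHom.map_mul hf hq (inv_mem h7),
      InvHom.map_inv hf h7, apply_section_one ρ hb] at h1
    rw [Pi.zero_apply]
    linear_combination h1
  · exact hf.1 q hq

end InjectiveTop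

section Equivariance

variable {σQ : Q →* Q} {τ : G ≃* G} (hστ : ∀ q, π (σQ q) = τ (π q)) {σH : H ≃ₜ* H}
  (hσρ : ∀ x, ρ (σH x) = τ (ρ x))

include hστ in
omit [TopologicalSpace G] [DiscreteTopology G] in
theorem InvHom.comp_mem {f : Q → ZMod p} (hf : f ∈ InvHom p π.ker) :
    (fun q => f (σQ q)) ∈ InvHom p π.ker := by
  have h : ∀ q, σQ q ∈ π.ker ↔ q ∈ π.ker := fun q => by simp [MonoidHom.mem_ker, hστ]
  refine ⟨fun x hx => hf.1 _ ((h x).not.2 hx), fun x hx y hy => ?_, fun a x hx => ?_⟩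
  · beta_reduce
    rw [_root_.map_mul, InvHom.map_mul hf ((h x).2 hx) ((h y).2 hy)]
  · beta_reduce
    rw [_root_.map_mul, _root_.map_mul, _root_.map_inv, InvHom.map_conj hf _ ((h x).2 hx)]

-- Applying σ to the section `s` gives another section σ s τ⁻¹, so the two classes differ by a
-- change of section.
include hστ hσρ in
theorem H2.map_infl (f : InvHom p π.ker) :
    H2.map p σH (infl hs ρ hρ f) =
      infl hs ρ hρ ⟨fun q => f.1 (σQ q), InvHom.comp_mem hστ f.2⟩ := by
  have hs' : ∀ x, π (σQ (s (τ.symm x))) = x := fun x => by simp [hστ, hs]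
  refine (H2.mk_eq_mk_iff _ _).2 ⟨⟨fun x => f.1 (s (ρ (σH x)) * (σQ (s (ρ x)))⁻¹), ?_⟩,
    fun x y => ?_⟩
  · simp only [hσρ]
    exact IsLocallyConstant.comp_continuous
      (g := fun z : G => f.1 (s (τ z) * (σQ (s z))⁻¹)) (f := ρ)
      (IsLocallyConstant.of_discrete _) hρ
  · have h := section_sub_section hs hs' f.2 (ρ (σH x)) (ρ (σH y))
    change f.1 (s (ρ (σH x)) * s (ρ (σH y)) * (s (ρ (σH x) * ρ (σH y)))⁻¹) -
      f.1 (σQ (s (ρ x) * s (ρ y) * (s (ρ x * ρ y))⁻¹)) =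
      f.1 (s (ρ (σH y)) * (σQ (s (ρ y)))⁻¹) - f.1 (s (ρ (σH (x * y))) * (σQ (s (ρ (x * y))))⁻¹) +
        f.1 (s (ρ (σH x)) * (σQ (s (ρ x)))⁻¹)
    simp only [hσρ, map_mul, map_inv, MulEquiv.symm_apply_apply] at h ⊢
    exact h

-- Injectivity pulls the sign -1 back from H² to each invariant homomorphism, and these detect N*.
include hστ hσρ in
theorem inverts_of_H2 [Fact p.Prime] (hinj : Function.Injective (infl (p := p) hs ρ hρ))
    (hσ : ∀ z : H2 p H, H2.map p σH z = -z) {x : Q} (hx : x ∈ π.ker) :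
    σQ x * x ∈ absStar p π.ker := by
  have hx' : σQ x ∈ π.ker := by
    rw [MonoidHom.mem_ker, hστ, MonoidHom.mem_ker.1 hx, map_one]
  refine mem_absStar_of_forall_invHom (mul_mem hx' hx) fun f hf => ?_
  have h := hσ (infl hs ρ hρ ⟨f, hf⟩)
  rw [H2.map_infl hs ρ hρ hστ hσρ, ← map_neg] at h
  have h1 := congrFun (congrArg Subtype.val (hinj h)) x
  change f (σQ x) = -f x at h1
  rw [InvHom.map_mul hf hx' hx, h1, neg_add_cancel]

include hστ hσρ in
theorem H2.map_eq_neg [Fact p.Prime] (hsurj : Function.Surjective (infl (p := p) hs ρ hρ))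
    (hσ : ∀ x ∈ π.ker, σQ x * x ∈ absStar p π.ker) (z : H2 p H) : H2.map p σH z = -z := by
  obtain ⟨⟨f, hf⟩, rfl⟩ := hsurj z
  rw [H2.map_infl hs ρ hρ hστ hσρ, ← map_neg]
  congr 1
  refine Subtype.ext (funext fun x => ?_)
  change f (σQ x) = -f x
  by_cases hx : x ∈ π.ker
  · have hx' : σQ x ∈ π.ker := by
      rw [MonoidHom.mem_ker, hστ, MonoidHom.mem_ker.1 hx, map_one]
    have h := InvHom.eq_zero_of_mem_absStar hf (hσ x hx)
    rw [InvHom.map_mul hf hx' hx] at h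
    exact eq_neg_of_add_eq_zero_left h
  · have hx' : σQ x ∉ π.ker := by
      rw [MonoidHom.mem_ker, hστ, EmbeddingLike.map_eq_one_iff]
      exact hx
    rw [hf.1 x hx, hf.1 _ hx', neg_zero]

end Equivariance

end Inflation

/-! ### The central extension defined by a cocycle -/

section CocycleExt

universe u

variable {p : ℕ} {G : Type u} [Group G] [TopologicalSpace G]

/-- The central extension of `G` by `𝔽_p` defined by a `2`-cocycle. -/
@[ext]
structure CocycleExt (z : Z2 p G) where
  /-- the image in `G` -/
  fst : G
  /-- the coordinate in `𝔽_p` -/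
  snd : ZMod p

variable {z : Z2 p G}

theorem cocycle_one_left (z : Z2 p G) (x : G) : z.1 (1, x) = z.1 (1, 1) := by
  have := z.2 1 1 x
  simp only [one_mul] at this
  linear_combination this

theorem cocycle_one_right (z : Z2 p G) (x : G) : z.1 (x, 1) = z.1 (1, 1) := by
  have := z.2 x 1 1
  simp only [mul_one] at this
  linear_combination -this

namespace CocycleExt

instance : Mul (CocycleExt z) := ⟨fun a b => ⟨a.fst * b.fst, a.snd + b.snd + z.1 (a.fst, b.fst)⟩⟩

/-- Cocycles are not normalised, hence the correction by z(1, 1) in the unit and in the inverse. -/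
instance : One (CocycleExt z) := ⟨⟨1, -z.1 (1, 1)⟩⟩

instance : Inv (CocycleExt z) := ⟨fun a => ⟨a.fst⁻¹, -a.snd - z.1 (a.fst⁻¹, a.fst) - z.1 (1, 1)⟩⟩

@[simp] theorem fst_mul (a b : CocycleExt z) : (a * b).fst = a.fst * b.fst := rfl

@[simp] theorem snd_mul (a b : CocycleExt z) :
    (a * b).snd = a.snd + b.snd + z.1 (a.fst, b.fst) := rfl

@[simp] theorem fst_one : (1 : CocycleExt z).fst = 1 := rfl

@[simp] theorem snd_one : (1 : CocycleExt z).snd = -z.1 (1, 1) := rfl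

instance : Group (CocycleExt z) :=
  Group.ofLeftAxioms
    (fun a b c => by
      ext
      · exact mul_assoc _ _ _
      · have := z.2 a.fst b.fst c.fst
        simp only [snd_mul, fst_mul]
        linear_combination -this)
    (fun a => by
      ext
      · exact one_mul _
      · simp only [snd_mul, snd_one, fst_one, cocycle_one_left]
        ring)
    (fun a => by
      ext
      · exact inv_mul_cancel a.fst
      · change -a.snd - z.1 (a.fst⁻¹, a.fst) - z.1 (1, 1) + a.snd + z.1 (a.fst⁻¹, a.fst) =
          -z.1 (1, 1)
        ring)

/-- The projection of the extension onto `G`. -/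
def proj (z : Z2 p G) : CocycleExt z →* G where
  toFun := fst
  map_one' := rfl
  map_mul' _ _ := rfl

theorem comm_of_mem_ker {a : CocycleExt z} (ha : a ∈ (proj z).ker) (b : CocycleExt z) :
    b * a = a * b := by
  have ha : a.fst = 1 := ha
  ext
  · rw [fst_mul, fst_mul, ha, mul_one, one_mul]
  · rw [snd_mul, snd_mul, ha, cocycle_one_left, cocycle_one_right, add_comm a.snd]

theorem snd_mul_of_mem_ker {a : CocycleExt z} (ha : a ∈ (proj z).ker) (b : CocycleExt z) :
    (a * b).snd = (a.snd + z.1 (1, 1)) + b.snd := by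
  have ha : a.fst = 1 := ha
  rw [snd_mul, ha, cocycle_one_left]
  ring

theorem pow_of_mem_ker {a : CocycleExt z} (ha : a ∈ (proj z).ker) : a ^ p = 1 := by
  have h : ∀ k : ℕ, (a ^ k).snd = k * (a.snd + z.1 (1, 1)) - z.1 (1, 1) := fun k => by
    induction k with
    | zero => simp
    | succ k ih =>
      rw [pow_succ', snd_mul_of_mem_ker ha, ih]
      push_cast
      ring
  ext
  · exact pow_mem ha p
  · rw [h, CharP.cast_eq_zero, zero_mul, zero_sub, snd_one]

/-- The kernel is central of exponent p, so the class grows by at most one. This is the source of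
the bound n ≥ c+1. -/
theorem absLower_eq_bot {c : ℕ} (hG : absLower p G c = ⊥) :
    absLower p (CocycleExt z) (c + 1) = ⊥ := by
  have h : absLower p (CocycleExt z) c ≤ (proj z).ker := by
    have := absLower_le_comap (p := p) (proj z) c
    rwa [hG, MonoidHom.comap_bot] at this
  refine le_bot_iff.1 (absStar_le_iff.2 ⟨fun a b hb => ?_, fun b hb => ?_⟩)
  · rw [Subgroup.mem_bot, comm_of_mem_ker (h hb) a, mul_inv_cancel_right, mul_inv_cancel]
  · exact pow_of_mem_ker (h hb)

end CocycleExt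

variable [DiscreteTopology G] {Q : Type*} [Group Q] {π : Q →* G} {s : G → Q}
  (hs : ∀ x, π (s x) = x)

/-- If `π : Q → G` lifts to all central extensions of `G` by `𝔽_p`, then every class in
`H²(G, 𝔽_p)` comes from an invariant homomorphism on the kernel of `π`. -/
theorem infl_surjective
    (hlift : ∀ z : Z2 p G, ∃ l : Q →* CocycleExt z, (CocycleExt.proj z).comp l = π) :
    Function.Surjective (infl (p := p) hs (MonoidHom.id G) continuous_id) := by
  intro y
  obtain ⟨z, rfl⟩ := Submodule.Quotient.mk_surjective _ y
  obtain ⟨l, hl⟩ := hlift z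
  have hlπ : ∀ q, (l q).fst = π q := fun q => DFunLike.congr_fun hl q
  have hker : ∀ q ∈ π.ker, l q ∈ (CocycleExt.proj z).ker := fun q hq => (hlπ q).trans hq
  classical
  -- The restriction of the lift to ker π, with its values shifted so that the unit goes to 0.
  let f : Q → ZMod p := fun q => if q ∈ π.ker then (l q).snd + z.1 (1, 1) else 0
  have hf1 : ∀ q ∈ π.ker, f q = (l q).snd + z.1 (1, 1) := fun q hq => if_pos hq
  have hf : f ∈ InvHom p π.ker := by
    refine ⟨fun q hq => if_neg hq, fun q hq r hr => ?_, fun a q hq => ?_⟩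
    · rw [hf1 _ (mul_mem hq hr), hf1 q hq, hf1 r hr, map_mul,
        CocycleExt.snd_mul_of_mem_ker (hker q hq)]
      ring
    · rw [hf1 _ (Subgroup.Normal.conj_mem inferInstance q hq a), hf1 q hq, map_mul, map_mul,
        CocycleExt.comm_of_mem_ker (hker q hq), map_inv, mul_inv_cancel_right]
  refine ⟨⟨f, hf⟩, (H2.mk_eq_mk_iff _ _).2
    ⟨⟨fun x => (l (s x)).snd, IsLocallyConstant.of_discrete _⟩, fun x y => ?_⟩⟩
  change f (s x * s y * (s (x * y))⁻¹) - z.1 (x, y) =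
    (l (s y)).snd - (l (s (x * y))).snd + (l (s x)).snd
  have hm := section_mem_ker hs x y
  have h1 := CocycleExt.snd_mul_of_mem_ker (hker _ hm) (l (s (x * y)))
  rw [← map_mul, inv_mul_cancel_right, map_mul, CocycleExt.snd_mul, hlπ, hlπ, hs, hs] at h1
  rw [hf1 _ hm]
  linear_combination -h1

end CocycleExt

/-! ### Relation rank of a finite discrete group -/

section Rank

universe u

variable {p : ℕ} [Fact p.Prime] {G : Type u} [Group G] [TopologicalSpace G] [DiscreteTopology G]

theorem H1_equiv_invHom_top : Nonempty (H1 p G ≃ₗ[ZMod p] InvHom p (⊤ : Subgroup G)) := by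
  refine ⟨⟨⟨⟨fun f => ⟨f.1, ?_⟩, fun f f' => rfl⟩, fun t f => rfl⟩,
    fun f => ⟨⟨f.1, IsLocallyConstant.of_discrete _⟩, ?_⟩, fun f => rfl, fun f => rfl⟩⟩
  · refine ⟨fun x hx => (hx (Subgroup.mem_top x)).elim, fun x _ y _ => f.2 x y, fun a x _ => ?_⟩
    have h1 := f.2 a a⁻¹
    have h2 := f.2 1 1
    rw [mul_one, left_eq_add] at h2
    rw [mul_inv_cancel, h2] at h1
    rw [f.2, f.2]
    linear_combination -h1
  · exact fun x y => InvHom.map_mul f.2 (Subgroup.mem_top x) (Subgroup.mem_top y)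

theorem index_absLower_one [Finite G] : (absLower p G 1).index = p ^ genRank p G := by
  obtain ⟨e⟩ := H1_equiv_invHom_top (p := p) (G := G)
  rw [genRank, e.finrank_eq, finrank_invHom, ← relIndex_absStar, Subgroup.relIndex_top_right]
  rfl

variable {Q : Type*} [Group Q] [Finite Q] {π : Q →* G} {s : G → Q} (hs : ∀ x, π (s x) = x) {n : ℕ}

-- With H = G, inflation is injective because π is a minimal presentation and surjective because π
-- lifts to all extensions; so H²(G) is dual to N/N*.
include hs in
theorem relIndex_ker_eq_pow_relRank [IsTopologicalGroup G] (hQ : absLower p Q n = ⊥)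
    (hπ : π.ker ≤ absLower p Q 1)
    (hlift : ∀ z : Z2 p G, ∃ l : Q →* CocycleExt z, (CocycleExt.proj z).comp l = π) :
    (absStar p π.ker).relIndex π.ker = p ^ relRank p G := by
  have h1 := infl_injective (p := p) hs (MonoidHom.id G) continuous_id hQ hπ
    Function.surjective_id (by rw [MonoidHom.ker_id]; exact bot_le)
  have h2 := infl_surjective hs hlift
  rw [relIndex_absStar, ← finrank_invHom,
    (LinearEquiv.ofBijective _ ⟨h1, h2⟩).finrank_eq, relRank]

end Rank

/-! ### Finite levels of the free pro-`p` group -/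

section FiniteIndex

variable {p : ℕ} [Fact p.Prime] {Γ : Type*} [Group Γ]

theorem finite_starQuot (N : Subgroup Γ) [N.Normal] [Group.FG N] : Finite (StarQuot p N) := by
  refine @CommGroup.finite_of_fg_isMulTorsion _ _ (inferInstance : Group.FG (N ⧸ _)) fun x => ?_
  induction x using QuotientGroup.induction_on with
  | H a =>
    rw [isOfFinOrder_iff_pow_eq_one]
    refine ⟨p, Nat.pos_of_neZero p, ?_⟩
    change (QuotientGroup.mk (a ^ p) : N ⧸ _) = 1
    rw [QuotientGroup.eq_one_iff, Subgroup.mem_subgroupOf]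
    exact pow_mem_absStar a.2

/-- Finite-index subgroups of a finitely generated group are finitely generated, so each successive
quotient is a finitely generated torsion abelian group, hence finite. -/
theorem finiteIndex_absLower [Group.FG Γ] (n : ℕ) : (absLower p Γ n).FiniteIndex := by
  induction n with
  | zero => exact (inferInstance : (⊤ : Subgroup Γ).FiniteIndex)
  | succ n ih =>
    have : Finite (StarQuot p (absLower p Γ n)) := finite_starQuot _
    refine ⟨?_⟩
    rw [← Subgroup.relIndex_mul_index (absLower_antitone (p := p) (G := Γ) n.le_succ)]
    exact mul_ne_zero (Nat.card_pos (α := StarQuot p (absLower p Γ n))).ne' ih.index_ne_zero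

end FiniteIndex

/-! ### The quotients F/P_n(F) as finite, relatively free groups -/

section FreeProP

variable {p g : ℕ}

variable (p g) in
/-- The canonical map from the free group to its pro-`p` completion. -/
def toFreeProP : FreeGroup (Fin g) →* FreeProP p g where
  toFun w := ⟨fun N => QuotientGroup.mk' N.1 w, fun _ _ _ => rfl⟩
  map_one' := rfl
  map_mul' _ _ := rfl

/-- The projection of the free pro-`p` group to a level. -/
def projLevel (N : PIndex p g) : FreeProP p g →* Level N :=
  (Pi.evalMonoidHom _ N).comp (freeProPSubgroup p g).subtype

theorem continuous_projLevel (N : PIndex p g) : Continuous (projLevel N) :=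
  (continuous_apply N).comp continuous_subtype_val

theorem projLevel_toFreeProP (N : PIndex p g) (w : FreeGroup (Fin g)) :
    projLevel N (toFreeProP p g w) = QuotientGroup.mk' N.1 w := rfl

theorem isOpen_ker_projLevel (N : PIndex p g) : IsOpen ((projLevel N).ker : Set (FreeProP p g)) :=
  (isOpen_discrete ({1} : Set (Level N))).preimage (continuous_projLevel N)

variable [Fact p.Prime]

theorem PIndex.exists_inf (N M : PIndex p g) : ∃ L : PIndex p g, L.1 ≤ N.1 ∧ L.1 ≤ M.1 := by
  obtain ⟨a, ha⟩ := N.2.2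
  obtain ⟨b, hb⟩ := M.2.2
  have hp := (Fact.out : p.Prime).ne_zero
  have hi : (N.1 ⊓ M.1).index ≠ 0 :=
    Subgroup.index_inf_ne_zero (by simp [ha, hp]) (by simp [hb, hp])
  have : (N.1 ⊓ M.1).FiniteIndex := ⟨hi⟩
  have : Finite (FreeGroup (Fin g) ⧸ N.1 ⊓ M.1) := inferInstance
  have hP : IsPGroup p (FreeGroup (Fin g) ⧸ N.1 ⊓ M.1) := by
    rw [isPGroup_iff_pow_pow_eq_one]
    intro x
    induction x using QuotientGroup.induction_on with
    | H x =>
      refine ⟨a + b, ?_⟩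
      rw [← QuotientGroup.mk_pow, QuotientGroup.eq_one_iff]
      constructor
      · have := N.1.pow_index_mem x
        rw [ha] at this
        rw [pow_add, pow_mul]
        exact pow_mem this _
      · have := M.1.pow_index_mem x
        rw [hb] at this
        rw [add_comm, pow_add, pow_mul]
        exact pow_mem this _
  obtain ⟨k, hk⟩ := IsPGroup.iff_card.1 hP
  exact ⟨⟨N.1 ⊓ M.1, inferInstance, k, hk⟩, inf_le_left, inf_le_right⟩

theorem PIndex.exists_le (I : Finset (PIndex p g)) : ∃ L : PIndex p g, ∀ N ∈ I, L.1 ≤ N.1 := by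
  classical
  induction I using Finset.induction_on with
  | empty => exact ⟨⟨⊤, inferInstance, 0, by simp⟩, by simp⟩
  | insert N I _ ih =>
    obtain ⟨L, hL⟩ := ih
    obtain ⟨L', h1, h2⟩ := PIndex.exists_inf N L
    refine ⟨L', fun M hM => ?_⟩
    rcases Finset.mem_insert.1 hM with rfl | hM
    · exact h1
    · exact h2.trans (hL M hM)

theorem denseRange_toFreeProP : DenseRange (toFreeProP p g) := by
  intro x
  rw [mem_closure_iff]
  rintro _ ⟨V, hV, rfl⟩ hx
  obtain ⟨I, u, hu, hIV⟩ := isOpen_pi_iff.1 hV x.1 hx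
  obtain ⟨L, hL⟩ := PIndex.exists_le I
  obtain ⟨w, hw⟩ := QuotientGroup.mk'_surjective L.1 (x.1 L)
  refine ⟨toFreeProP p g w, hIV fun N hN => ?_, w, rfl⟩
  have h1 : (toFreeProP p g w).1 N = x.1 N := by
    rw [← x.2 L N (hL N hN), ← (toFreeProP p g w).2 L N (hL N hN)]
    exact congrArg _ hw
  rw [h1]
  exact (hu N hN).2

theorem mem_closure_of_isOpen {K : Subgroup (FreeProP p g)} (hK : IsOpen (K : Set (FreeProP p g)))
    {x : FreeProP p g} (hx : x ∈ K) :
    x ∈ closure (toFreeProP p g '' (K.comap (toFreeProP p g) : Set (FreeGroup (Fin g)))) := by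
  have h := hK.inter_closure (t := Set.range (toFreeProP p g)) ⟨hx, denseRange_toFreeProP x⟩
  refine closure_mono ?_ h
  rintro _ ⟨hy, w, rfl⟩
  exact ⟨w, hy, rfl⟩

variable (p g) in
/-- The level of the free pro-`p` group given by the lower `p`-central series. -/
def lowerPIndex (n : ℕ) : PIndex p g :=
  ⟨absLower p (FreeGroup (Fin g)) n, inferInstance, by
    have : (absLower p (FreeGroup (Fin g)) n).FiniteIndex := finiteIndex_absLower n
    have : Finite (FreeGroup (Fin g) ⧸ absLower p (FreeGroup (Fin g)) n) := inferInstance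
    exact IsPGroup.iff_card.1 (isPGroup_quotient_absLower n)⟩

/-- The level has p-class at most n, which gives one inclusion. For the other, the open kernel lies
in the closure of its trace on the dense free group, and that trace maps into the closed subgroup
P_n(F). -/
theorem lowerP_eq_ker (n : ℕ) :
    lowerP p (FreeProP p g) n = (projLevel (lowerPIndex p g n)).ker := by
  apply le_antisymm
  · refine (lowerP_le_comap_absLower (continuous_projLevel (lowerPIndex p g n)) n).trans ?_
    have h : absLower p (Level (lowerPIndex p g n)) n = ⊥ := by
      have hs : Function.Surjective (QuotientGroup.mk' (lowerPIndex p g n).1) :=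
        QuotientGroup.mk'_surjective _
      refine (map_absLower hs n).symm.trans ?_
      exact QuotientGroup.map_mk'_self _
    rw [h]
    exact le_rfl
  · intro x hx
    refine closure_minimal ?_ (isClosed_lowerP n) (mem_closure_of_isOpen
      (isOpen_ker_projLevel _) hx)
    rintro _ ⟨w, hw, rfl⟩
    have hw' : w ∈ absLower p (FreeGroup (Fin g)) n := (QuotientGroup.eq_one_iff w).1 hw
    exact absLower_le_lowerP n (absLower_le_comap _ n hw')

theorem isOpen_lowerP (n : ℕ) :
    IsOpen (lowerP p (FreeProP p g) n : Set (FreeProP p g)) := by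
  rw [lowerP_eq_ker]
  exact isOpen_ker_projLevel _

variable (p g) in
/-- The canonical map from the free group to `F / Pₙ(F)`. -/
def toFreeQuot (n : ℕ) : FreeGroup (Fin g) →* FreeQuot p g n :=
  (QuotientGroup.mk' _).comp (toFreeProP p g)

theorem toFreeQuot_surjective (n : ℕ) : Function.Surjective (toFreeQuot p g n) := by
  intro y
  obtain ⟨x, rfl⟩ := QuotientGroup.mk'_surjective _ y
  obtain ⟨w, hw⟩ := QuotientGroup.mk'_surjective (lowerPIndex p g n).1 (x.1 (lowerPIndex p g n))
  refine ⟨w, QuotientGroup.eq.2 ?_⟩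
  rw [lowerP_eq_ker, MonoidHom.mem_ker, map_mul, map_inv, projLevel_toFreeProP]
  exact inv_mul_eq_one.2 hw

theorem ker_toFreeQuot (n : ℕ) : (toFreeQuot p g n).ker = absLower p (FreeGroup (Fin g)) n := by
  ext w
  rw [MonoidHom.mem_ker]
  refine (QuotientGroup.eq_one_iff _).trans ?_
  rw [lowerP_eq_ker, MonoidHom.mem_ker, projLevel_toFreeProP]
  exact QuotientGroup.eq_one_iff w

theorem absLower_freeQuot (n : ℕ) : absLower p (FreeQuot p g n) n = ⊥ := by
  rw [← map_absLower (toFreeQuot_surjective n), ← ker_toFreeQuot, Subgroup.map_eq_bot_iff]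

instance finite_freeQuot (n : ℕ) : Finite (FreeQuot p g n) := by
  have : (absLower p (FreeGroup (Fin g)) n).FiniteIndex := finiteIndex_absLower n
  have : (toFreeQuot p g n).ker.FiniteIndex := by rwa [ker_toFreeQuot]
  exact Finite.of_equiv _
    (QuotientGroup.quotientKerEquivOfSurjective _ (toFreeQuot_surjective (p := p) n)).toEquiv

variable (p) in
/-- The canonical generators of `F / Pₙ(F)`. -/
def freeQuotGen (n : ℕ) (i : Fin g) : FreeQuot p g n := toFreeQuot p g n (FreeGroup.of i)

theorem freeQuot_hom_ext {n : ℕ} {E : Type*} [Group E] {l l' : FreeQuot p g n →* E}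
    (h : ∀ i, l (freeQuotGen p n i) = l' (freeQuotGen p n i)) : l = l' := by
  rw [← MonoidHom.cancel_right (toFreeQuot_surjective n)]
  exact FreeGroup.ext_hom _ _ h

theorem closure_freeQuotGen (n : ℕ) :
    Subgroup.closure (Set.range (freeQuotGen (g := g) p n)) = ⊤ := by
  have h : Set.range (freeQuotGen (g := g) p n) =
      toFreeQuot p g n '' Set.range FreeGroup.of := by
    rw [← Set.range_comp]
    rfl
  rw [h, ← MonoidHom.map_closure, FreeGroup.closure_range_of, ← MonoidHom.range_eq_map,
    MonoidHom.range_eq_top.2 (toFreeQuot_surjective n)]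

/-- `F / Pₙ(F)` is free among the groups of `p`-class at most `n`. -/
theorem exists_freeQuot_lift {n : ℕ} {E : Type*} [Group E] (hE : absLower p E n = ⊥)
    (y : Fin g → E) : ∃ l : FreeQuot p g n →* E, ∀ i, l (freeQuotGen p n i) = y i := by
  have hk : (toFreeQuot p g n).ker ≤ (FreeGroup.lift y).ker := by
    have := absLower_le_comap (p := p) (FreeGroup.lift y) n
    rwa [hE, MonoidHom.comap_bot, ← ker_toFreeQuot] at this
  refine ⟨(toFreeQuot p g n).liftOfSurjective (toFreeQuot_surjective n) ⟨FreeGroup.lift y, hk⟩,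
    fun i => ?_⟩
  rw [freeQuotGen, MonoidHom.liftOfRightInverse_comp_apply]
  simp

omit [Fact p.Prime] in
theorem sigmaQuot_gen (n : ℕ) (i : Fin g) :
    sigmaQuot p g n (freeQuotGen p n i) = (freeQuotGen p n i)⁻¹ :=
  congrArg (QuotientGroup.mk' (lowerP p (FreeProP p g) n)) (sigma_of p g i)

theorem sigmaQuot_sigmaQuot (n : ℕ) (x : FreeQuot p g n) :
    sigmaQuot p g n (sigmaQuot p g n x) = x := by
  have h : (sigmaQuot p g n).comp (sigmaQuot p g n) = MonoidHom.id _ :=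
    freeQuot_hom_ext fun i => by simp [sigmaQuot_gen]
  exact DFunLike.congr_fun h x

theorem range_eq_closure {n : ℕ} {E : Type*} [Group E] (l : FreeQuot p g n →* E) :
    l.range = Subgroup.closure (Set.range fun i => l (freeQuotGen p n i)) := by
  rw [MonoidHom.range_eq_map, ← closure_freeQuotGen, MonoidHom.map_closure, ← Set.range_comp]
  rfl

/-! ### Presentations of finite groups by the free pro-p group -/

section Presentation

universe u

variable {G : Type u} [Group G] [TopologicalSpace G] [DiscreteTopology G] {c : ℕ}
  (hG : absLower p G c = ⊥) {π : FreeProP p g →* G} (hπ : Continuous π)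

omit [Fact p.Prime] in
include hG hπ in
theorem lowerP_le_ker : lowerP p (FreeProP p g) c ≤ π.ker := by
  have := lowerP_le_comap_absLower (p := p) hπ c
  rwa [hG, MonoidHom.comap_bot] at this

omit [Fact p.Prime] in
include hG hπ in
theorem exists_descent :
    ∃ l : FreeQuot p g c →* G, ∀ x : FreeProP p g, l x = π x :=
  ⟨QuotientGroup.lift _ π (lowerP_le_ker hG hπ), fun _ => rfl⟩

-- The preimage in F of N*, for N the kernel in F_c, is R*P_c(F); thus h can be computed at the
-- finite level c.
omit [TopologicalSpace G] [DiscreteTopology G] in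
theorem pow_multRank {l : FreeQuot p g c →* G} (hl : ∀ x : FreeProP p g, l x = π x) :
    p ^ multRank p π.ker c = (absStar p l.ker).relIndex l.ker := by
  have hs := QuotientGroup.mk'_surjective (lowerP p (FreeProP p g) c)
  have hker : l.ker = π.ker.map (QuotientGroup.mk' (lowerP p (FreeProP p g) c)) := by
    ext y
    constructor
    · intro hy
      obtain ⟨x, rfl⟩ := hs y
      exact ⟨x, (hl x).symm.trans hy, rfl⟩
    · rintro ⟨x, hx, rfl⟩
      exact (hl x).trans hx
  have hcomap : (absStar p l.ker).comap (QuotientGroup.mk' (lowerP p (FreeProP p g) c)) =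
      pStar p π.ker ⊔ lowerP p (FreeProP p g) c := by
    rw [hker, ← map_absStar hs, QuotientGroup.comap_map_mk', sup_comm]
    refine le_antisymm (sup_le_sup_right (absStar_le_pStar _) _) (sup_le ?_ le_sup_right)
    -- The join contains the open subgroup P_c(F), so it is already closed and the closure in R*
    -- adds nothing.
    refine pStar_le_of_isClosed (Subgroup.isClosed_of_isOpen _
      (Subgroup.isOpen_mono le_sup_right (isOpen_lowerP c))) le_sup_left
  have hcard : (absStar p l.ker).relIndex l.ker = Nat.card (MultModNucleus p π.ker c) := by
    conv_lhs => rw [hker, ← Subgroup.relIndex_comap, ← hker, hcomap]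
    rfl
  have hpos : (absStar p l.ker).relIndex l.ker ≠ 0 :=
    (Nat.card_pos (α := StarQuot p l.ker)).ne'
  have : Finite (MultModNucleus p π.ker c) := Nat.finite_of_card_ne_zero (hcard ▸ hpos)
  have : Finite (Additive (MultModNucleus p π.ker c)) := this
  rw [hcard]
  refine Eq.trans ?_
    (Module.natCard_eq_pow_finrank (K := ZMod p) (V := Additive (MultModNucleus p π.ker c))).symm
  rw [Nat.card_zmod]
  rfl

-- The trace of the open kernel on the dense free group has finite index, so it is finitely
-- generated; its generators topologically generate the kernel.
include hπ in
theorem isFinitelyPresented_of_surjective [Finite G] (hs : Function.Surjective π) :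
    IsFinitelyPresentedProP p G := by
  have hopen : IsOpen (π.ker : Set (FreeProP p g)) :=
    (isOpen_discrete ({1} : Set G)).preimage hπ
  have : (π.ker.comap (toFreeProP p g)).FiniteIndex := by
    rw [MonoidHom.comap_ker]
    infer_instance
  obtain ⟨S, hS⟩ := (Group.fg_iff_subgroup_fg _).1
    (inferInstance : Group.FG (π.ker.comap (toFreeProP p g)))
  have hSL : ∀ w ∈ S, toFreeProP p g w ∈ π.ker := fun w hw => by
    have : w ∈ Subgroup.closure (S : Set (FreeGroup (Fin g))) := Subgroup.subset_closure hw
    rwa [hS] at this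
  refine ⟨g, π, hπ, hs, toFreeProP p g '' S, S.finite_toSet.image _, le_antisymm ?_ ?_⟩
  · intro x hx
    refine closure_mono ?_ (mem_closure_of_isOpen hopen hx)
    rw [← hS]
    refine (Subgroup.coe_map _ _).symm.subset.trans (SetLike.coe_subset_coe.2 ?_)
    rw [MonoidHom.map_closure]
    exact Subgroup.closure_le_normalClosure
  · refine Subgroup.topologicalClosure_minimal _ (Subgroup.normalClosure_le_normal ?_)
      (Subgroup.isClosed_of_isOpen _ hopen)
    rintro _ ⟨w, hw, rfl⟩
    exact hSL w hw

end Presentation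

end FreeProP

/-! ### Counting inverted generating tuples -/

section Tuples

variable {p : ℕ} [Fact p.Prime] {K : Type*} [Group K]

theorem finrank_starQuot_le_of_span {N : Subgroup K} [N.Normal] {m : ℕ}
    {w : Fin m → Additive (StarQuot p N)} (h : Submodule.span (ZMod p) (Set.range w) = ⊤) :
    Module.finrank (ZMod p) (Additive (StarQuot p N)) ≤ m := by
  have h1 := finrank_range_le_card (R := ZMod p) w
  rwa [Set.finrank, h, finrank_top, Fintype.card_fin] at h1

/-- Kernels of nonzero homomorphisms to 𝔽_p are maximal subgroups, and they intersect in P₁. -/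
theorem frattini_eq_absLower_one [Finite K] {n : ℕ} (hK : absLower p K n = ⊥) :
    frattini K = absLower p K 1 := by
  refine le_antisymm (fun x hx => ?_) (absLower_one_le_frattini hK)
  refine mem_absStar_of_forall_invHom (N := ⊤) (Subgroup.mem_top x) fun f hf => ?_
  by_contra hfx
  have hco : IsCoatom (InvHom.ker hf) := by
    refine ⟨fun h => ?_, fun L hL => top_le_iff.1 fun z _ => ?_⟩
    · have hx' : x ∈ InvHom.ker hf := by rw [h]; exact Subgroup.mem_top x
      exact hfx hx'.2
    · obtain ⟨y, hyL, hy⟩ := SetLike.exists_of_lt hL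
      have hfy : f y ≠ 0 := fun h => hy ⟨Subgroup.mem_top y, h⟩
      have h1 : z * (y ^ (f z / f y).val)⁻¹ ∈ InvHom.ker hf := by
        refine ⟨Subgroup.mem_top _, ?_⟩
        rw [InvHom.map_mul hf (Subgroup.mem_top _) (Subgroup.mem_top _),
          InvHom.map_inv hf (Subgroup.mem_top _), InvHom.map_pow hf (Subgroup.mem_top _),
          ZMod.natCast_zmod_val, div_mul_cancel₀ _ hfy, add_neg_cancel]
      have h2 := mul_mem (hL.le h1) (pow_mem hyL (f z / f y).val)
      rwa [inv_mul_cancel_right] at h2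
  exact hfx (frattini_le_coatom hco hx).2

variable (hodd : Odd (Nat.card K)) {σ : K →* K} (hσ : ∀ x, σ (σ x) = x)

-- Inverted elements are equidistributed over N/N*, so the count is the number of spanning tuples
-- times |Inv N*|^m, and |Inv N| = p^h |Inv N*|.
include hodd hσ in
theorem card_generating_tuples [Finite K] {n : ℕ} (hK : absLower p K n = ⊥) {N : Subgroup K} [N.Normal]
    (hinv : ∀ x ∈ N, σ x * x ∈ absStar p N) {m h : ℕ} (hN : (absStar p N).relIndex N = p ^ h)
    (hm : h ≤ m) :
    (Nat.card {v : Fin m → InvIn σ N //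
        Subgroup.normalClosure (Set.range fun i => (v i).1) = N} : ℝ) * eta p (m - h) =
      (Nat.card (InvIn σ N) : ℝ) ^ m * eta p m := by
  have hp := (Fact.out : p.Prime).one_lt
  obtain ⟨e, he⟩ := exists_equiv_invIn hodd hσ (absStar_le N) hinv (starMk p N) starMk_surjective
    starMk_eq_iff
  have hfin : Module.finrank (ZMod p) (Additive (StarQuot p N)) = h := by
    rw [relIndex_absStar] at hN
    exact Nat.pow_right_injective hp hN
  have : Finite (Additive (StarQuot p N)) := (inferInstance : Finite (StarQuot p N))
  have h1 := card_tuples _ e he m fun w => Submodule.span (ZMod p) (Set.range w) = ⊤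
  have h2 : Nat.card {v : Fin m → InvIn σ N //
      Subgroup.normalClosure (Set.range fun i => (v i).1) = N} =
      Nat.card {v : Fin m → InvIn σ N // Submodule.span (ZMod p)
        (Set.range fun i => starMk p N ⟨(v i).1, (v i).2.2⟩) = ⊤} :=
    Nat.card_congr (Equiv.subtypeEquivRight fun v =>
      normalClosure_eq_iff hK fun i => (⟨(v i).1, (v i).2.2⟩ : N))
  have h3 : Nat.card (InvIn σ N) = p ^ h * Nat.card (InvIn σ (absStar p N)) := by
    rw [Nat.card_congr e, Nat.card_prod, card_starQuot, hN]
  rw [h2, h1, card_spanning (hfin.trans_le hm), h3, ZMod.card, hfin, Nat.cast_mul,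
    mul_right_comm, prod_pow_sub_pow hp hm]
  push_cast
  ring

variable {L : Type*} [Group L] {τ : L →* L} {l : K →* L} (hl : Function.Surjective l)
  (hτ : ∀ x, l (σ x) = τ (l x))

include hodd hσ hl hτ

theorem exists_inverted_preimage {y : L} (hy : τ y = y⁻¹) : ∃ x, σ x = x⁻¹ ∧ l x = y := by
  obtain ⟨z, rfl⟩ := hl y
  obtain ⟨x, hx, -, hzx⟩ := exists_inverted hodd hσ (M := ⊤) (N := l.ker)
    (fun _ _ => Subgroup.mem_top _) (Subgroup.mem_top z) (by
      rw [MonoidHom.mem_ker, map_mul, hτ, hy, inv_mul_cancel])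
  refine ⟨x, hx, ?_⟩
  rw [MonoidHom.mem_ker, map_mul, map_inv, inv_mul_eq_one] at hzx
  exact hzx.symm

theorem card_invIn_top_of_surjective :
    Nat.card (InvIn σ (⊤ : Subgroup K)) =
      Nat.card (InvIn τ (⊤ : Subgroup L)) * Nat.card (InvIn σ l.ker) := by
  obtain ⟨e, -⟩ := exists_equiv_prod (C := InvIn σ l.ker)
    (fun x : InvIn σ (⊤ : Subgroup K) => (⟨l x.1, by
      rw [← hτ, x.2.1, map_inv], Subgroup.mem_top _⟩ : InvIn τ (⊤ : Subgroup L))) (by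
      rintro ⟨y, hy, -⟩
      obtain ⟨x, hx, rfl⟩ := exists_inverted_preimage hodd hσ hl hτ hy
      obtain ⟨e⟩ := nonempty_coset_equiv hodd (le_top : l.ker ≤ ⊤) hx (Subgroup.mem_top x)
      refine ⟨(Equiv.subtypeEquivRight fun z => ?_).trans e⟩
      refine Subtype.ext_iff.trans ?_
      change l z.1 = l x ↔ x⁻¹ * z.1 ∈ l.ker
      rw [MonoidHom.mem_ker, map_mul, map_inv, inv_mul_eq_one]
      exact eq_comm)
  rw [Nat.card_congr e, Nat.card_prod]

end Tuples

/-! ### Inversion propagated from generators -/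

section Generators

variable {p : ℕ} {K : Type*} [Group K]

theorem mul_self_mem_of_inverts {σ : K →* K} {S : Set K} (hS : Subgroup.closure S = ⊤)
    (hσ : ∀ x ∈ S, σ x = x⁻¹) {N : Subgroup K} [N.Normal]
    (hN : ∀ a b : K, a * b * a⁻¹ * b⁻¹ ∈ N) (x : K) : σ x * x ∈ N := by
  have hx : x ∈ Subgroup.closure S := hS ▸ Subgroup.mem_top x
  have hcomm : ∀ a b : K, (a * b : K ⧸ N) = b * a := fun a b => by
    rw [← QuotientGroup.mk_mul, ← QuotientGroup.mk_mul, QuotientGroup.eq, mul_inv_rev]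
    have h := hN b⁻¹ a⁻¹
    rwa [inv_inv, inv_inv, mul_assoc _ b a] at h
  rw [← QuotientGroup.eq_one_iff, QuotientGroup.mk_mul, mul_eq_one_iff_eq_inv]
  induction hx using Subgroup.closure_induction with
  | mem x hx => rw [hσ x hx, QuotientGroup.mk_inv]
  | one => rw [map_one, QuotientGroup.mk_one, inv_one]
  | mul x y _ _ hx hy =>
    rw [map_mul, QuotientGroup.mk_mul, hx, hy, QuotientGroup.mk_mul, mul_inv_rev,
      ← QuotientGroup.mk_inv, ← QuotientGroup.mk_inv, hcomm]
  | inv x _ hx => rw [map_inv, QuotientGroup.mk_inv, hx, QuotientGroup.mk_inv]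

/-- As N/N* is abelian with trivial conjugation, the elements that σ inverts modulo N* form a normal
subgroup, and it contains `S`. -/
theorem inverts_absStar_of_normalClosure {σ : K →* K} {N : Subgroup K} [N.Normal] {S : Set K}
    (hS : Subgroup.normalClosure S = N) (hσ : ∀ x ∈ S, σ x = x⁻¹) {x : K} (hx : x ∈ N) :
    σ x * x ∈ absStar p N := by
  let L : Subgroup K :=
    { carrier := {x | ∃ (hx : x ∈ N) (hσx : σ x ∈ N),
        starMk p N ⟨σ x, hσx⟩ + starMk p N ⟨x, hx⟩ = 0}
      mul_mem' := by
        rintro x y ⟨hx, hσx, h⟩ ⟨hy, hσy, h'⟩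
        have hxy : σ (x * y) ∈ N := by rw [map_mul]; exact mul_mem hσx hσy
        refine ⟨mul_mem hx hy, hxy, ?_⟩
        have e1 : (⟨σ (x * y), hxy⟩ : N) = ⟨σ x, hσx⟩ * ⟨σ y, hσy⟩ :=
          Subtype.ext (map_mul σ x y)
        have e2 : (⟨x * y, mul_mem hx hy⟩ : N) = ⟨x, hx⟩ * ⟨y, hy⟩ := rfl
        rw [e1, e2, starMk_mul, starMk_mul, add_add_add_comm, h, h', add_zero]
      one_mem' := by
        have h1 : σ 1 ∈ N := by rw [map_one]; exact one_mem N
        refine ⟨one_mem N, h1, ?_⟩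
        have e1 : (⟨σ 1, h1⟩ : N) = 1 := Subtype.ext (map_one σ)
        have e2 : (⟨1, one_mem N⟩ : N) = 1 := rfl
        rw [e1, e2, starMk_one, add_zero]
      inv_mem' := by
        rintro x ⟨hx, hσx, h⟩
        have hx' : σ x⁻¹ ∈ N := by rw [map_inv]; exact inv_mem hσx
        refine ⟨inv_mem hx, hx', ?_⟩
        have e1 : (⟨σ x⁻¹, hx'⟩ : N) = ⟨σ x, hσx⟩⁻¹ := Subtype.ext (map_inv σ x)
        have e2 : (⟨x⁻¹, inv_mem hx⟩ : N) = ⟨x, hx⟩⁻¹ := rfl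
        rw [e1, e2, starMk_inv, starMk_inv, ← neg_add, h, neg_zero] }
  have hL : L.Normal := ⟨by
    rintro x ⟨hx, hσx, h⟩ a
    have hx' : σ (a * x * a⁻¹) ∈ N := by
      rw [map_mul, map_mul, map_inv]
      exact ‹N.Normal›.conj_mem _ hσx _
    refine ⟨‹N.Normal›.conj_mem _ hx _, hx', ?_⟩
    have e1 : (⟨σ (a * x * a⁻¹), hx'⟩ : N) =
        ⟨σ a * σ x * (σ a)⁻¹, ‹N.Normal›.conj_mem _ hσx _⟩ := Subtype.ext (by simp)
    rw [e1, starMk_conj _ hσx, starMk_conj _ hx, h]⟩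
  have hNL : N ≤ L := by
    conv_lhs => rw [← hS]
    refine Subgroup.normalClosure_le_normal fun x hx => ?_
    have hxN : x ∈ N := hS ▸ Subgroup.subset_normalClosure hx
    have hσx : σ x ∈ N := by rw [hσ x hx]; exact inv_mem hxN
    refine ⟨hxN, hσx, ?_⟩
    have e1 : (⟨σ x, hσx⟩ : N) = ⟨x, hxN⟩⁻¹ := Subtype.ext (hσ x hx)
    rw [e1, starMk_inv, neg_add_cancel]
  obtain ⟨hxN, hσx, h⟩ := hNL hx
  rw [← starMk_mul, starMk_eq_zero_iff] at h
  exact h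

end Generators

/-! ### Surjections from `F / Pₙ(F)` -/

section Surjections

variable {p g n : ℕ} [Fact p.Prime] {G : Type*} [Group G]

theorem sigmaQuot_mul_self_mem (x : FreeQuot p g n) :
    sigmaQuot p g n x * x ∈ absLower p (FreeQuot p g n) 1 :=
  mul_self_mem_of_inverts (closure_freeQuotGen n)
    (by rintro _ ⟨i, rfl⟩; exact sigmaQuot_gen n i)
    (fun a b => commutator_mem_absStar (N := ⊤) a (Subgroup.mem_top b)) x

theorem index_absLower_one_freeQuot_le :
    (absLower p (FreeQuot p g n) 1).index ≤ p ^ g := by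
  have h1 : Subgroup.normalClosure (Set.range (freeQuotGen (g := g) p n)) = ⊤ :=
    top_le_iff.1 ((closure_freeQuotGen n).symm.trans_le Subgroup.closure_le_normalClosure)
  have h2 := (normalClosure_eq_iff (absLower_freeQuot n)
    fun i => (⟨freeQuotGen (g := g) p n i, Subgroup.mem_top _⟩ :
      (⊤ : Subgroup (FreeQuot p g n)))).1 h1
  have h3 := finrank_starQuot_le_of_span h2
  have h4 := relIndex_absStar (p := p) (N := (⊤ : Subgroup (FreeQuot p g n)))
  rw [Subgroup.relIndex_top_right] at h4
  exact h4.trans_le (Nat.pow_le_pow_right (Fact.out : p.Prime).pos h3)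

variable (hd : (absLower p G 1).index = p ^ g) {l : FreeQuot p g n →* G}
  (hl : Function.Surjective l)

-- Both sides have index p^g: P₁(F_n) has index at most p^g because F_n has g generators. Hence ker
-- l ≤ P₁(F_n), a minimal presentation.
include hd hl in
theorem comap_absLower_one : (absLower p G 1).comap l = absLower p (FreeQuot p g n) 1 := by
  have h1 : absLower p (FreeQuot p g n) 1 ≤ (absLower p G 1).comap l := absLower_le_comap l 1
  have h2 := Subgroup.relIndex_mul_index h1
  rw [Subgroup.index_comap_of_surjective _ hl, hd] at h2
  refine le_antisymm (Subgroup.relIndex_eq_one.1 ?_) h1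
  have h3 : 0 < p ^ g := pow_pos (Fact.out : p.Prime).pos g
  have h4 := h2.trans_le index_absLower_one_freeQuot_le
  have h5 : (absLower p (FreeQuot p g n) 1).index ≠ 0 := Subgroup.index_ne_zero_of_finite
  have h6 : (absLower p (FreeQuot p g n) 1).relIndex ((absLower p G 1).comap l) ≠ 0 := by
    intro h
    rw [h, zero_mul] at h2
    exact h5 h2.symm
  nlinarith [Nat.pos_of_ne_zero h6]

include hd hl in
theorem index_absLower_one_freeQuot : (absLower p (FreeQuot p g n) 1).index = p ^ g := by
  rw [← comap_absLower_one hd hl, Subgroup.index_comap_of_surjective _ hl, hd]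

include hd hl in
theorem ker_le_absLower_one : l.ker ≤ absLower p (FreeQuot p g n) 1 := by
  rw [← comap_absLower_one hd hl]
  exact Subgroup.comap_mono bot_le

theorem odd_card_of_absLower (hp : Odd p) {K : Type*} [Group K] [Finite K]
    (hK : absLower p K n = ⊥) : Odd (Nat.card K) := by
  obtain ⟨k, hk⟩ := IsPGroup.iff_card.1 (isPGroup_of_absLower hK)
  rw [hk]
  exact hp.pow

theorem surjective_iff_normalClosure [Finite G] (hG : absLower p G n = ⊥) (l : FreeQuot p g n →* G) :
    Function.Surjective l ↔
      Subgroup.normalClosure (Set.range fun i => l (freeQuotGen p n i)) = ⊤ := by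
  rw [← MonoidHom.range_eq_top, range_eq_closure]
  exact ⟨fun h => top_le_iff.1 (h.symm.trans_le Subgroup.closure_le_normalClosure),
    closure_eq_top_of_normalClosure hG⟩

section Comparison

variable {l₁ l₂ : FreeQuot p g n →* G} (hl₁ : Function.Surjective l₁)
  (hl₂ : Function.Surjective l₂) {α : FreeQuot p g n →* FreeQuot p g n}
  (hα : l₁.comp α = l₂)

include hd hl₁ hl₂ hα

/-- The image of α covers F_n modulo ker l₁ ≤ P₁(F_n), so α is onto. Two presentations thus differ
by an automorphism of F_n, and invariants of the relation module do not depend on the choice. -/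
theorem bijective_of_comp : Function.Bijective α := by
  have h : α.range = ⊤ := by
    refine eq_top_of_sup_absLower_one (absLower_freeQuot n) (top_le_iff.1 fun x _ => ?_)
    obtain ⟨y, hy⟩ := hl₂ (l₁ x)
    rw [← hα] at hy
    have h1 : (α y)⁻¹ * x ∈ l₁.ker := by
      rw [MonoidHom.mem_ker, map_mul, map_inv, inv_mul_eq_one]
      exact hy
    have h2 := mul_mem (Subgroup.mem_sup_left (T := absLower p (FreeQuot p g n) 1)
      (MonoidHom.mem_range (f := α).2 ⟨y, rfl⟩))
      (Subgroup.mem_sup_right (ker_le_absLower_one hd hl₁ h1))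
    rwa [mul_inv_cancel_left] at h2
  exact Finite.surjective_iff_bijective.1 (MonoidHom.range_eq_top.1 h)

theorem map_ker_of_comp : l₂.ker.map α = l₁.ker := by
  have hb := bijective_of_comp hd hl₁ hl₂ hα
  subst hα
  rw [← MonoidHom.comap_ker, Subgroup.map_comap_eq_self_of_surjective hb.2]

theorem relIndex_ker_of_comp :
    (absStar p l₂.ker).relIndex l₂.ker = (absStar p l₁.ker).relIndex l₁.ker := by
  have hb := bijective_of_comp hd hl₁ hl₂ hα
  rw [← map_ker_of_comp hd hl₁ hl₂ hα, ← map_absStar hb.2,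
    Subgroup.relIndex_map_map_of_injective _ _ hb.1]

theorem inverts_ker_of_comp (hασ : ∀ x, α (sigmaQuot p g n x) = sigmaQuot p g n (α x))
    (h : ∀ x ∈ l₂.ker, sigmaQuot p g n x * x ∈ absStar p l₂.ker) :
    ∀ x ∈ l₁.ker, sigmaQuot p g n x * x ∈ absStar p l₁.ker := by
  have hb := bijective_of_comp hd hl₁ hl₂ hα
  intro x hx
  rw [← map_ker_of_comp hd hl₁ hl₂ hα] at hx ⊢
  obtain ⟨y, hy, rfl⟩ := hx
  rw [← hασ, ← map_mul, ← map_absStar hb.2]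
  exact Subgroup.mem_map_of_mem α (h y hy)

end Comparison

theorem exists_comp (l₁ l₂ : FreeQuot p g n →* G) (hl₁ : Function.Surjective l₁) :
    ∃ α : FreeQuot p g n →* FreeQuot p g n, l₁.comp α = l₂ := by
  choose y hy using fun i => hl₁ (l₂ (freeQuotGen p n i))
  obtain ⟨α, hα⟩ := exists_freeQuot_lift (absLower_freeQuot (p := p) (g := g) n) y
  exact ⟨α, freeQuot_hom_ext fun i => by rw [MonoidHom.comp_apply, hα, hy]⟩

/-- Each l₂(x_i) is inverted, so it has an inverted preimage under l₁; sending x_i there commutes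
with σ. -/
theorem exists_equivariant_comp (hp : Odd p) {σ : G →* G} (l₁ l₂ : FreeQuot p g n →* G)
    (hl₁ : Function.Surjective l₁) (hσ₁ : ∀ x, l₁ (sigmaQuot p g n x) = σ (l₁ x))
    (hσ₂ : ∀ x, l₂ (sigmaQuot p g n x) = σ (l₂ x)) :
    ∃ α : FreeQuot p g n →* FreeQuot p g n, l₁.comp α = l₂ ∧
      ∀ x, α (sigmaQuot p g n x) = sigmaQuot p g n (α x) := by
  have hodd := odd_card_of_absLower hp (absLower_freeQuot (p := p) (g := g) n)
  choose y hy hy' using fun i => exists_inverted_preimage hodd (sigmaQuot_sigmaQuot n) hl₁ hσ₁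
    (y := l₂ (freeQuotGen p n i)) (by rw [← hσ₂, sigmaQuot_gen, map_inv])
  obtain ⟨α, hα⟩ := exists_freeQuot_lift (absLower_freeQuot (p := p) (g := g) n) y
  refine ⟨α, freeQuot_hom_ext fun i => by rw [MonoidHom.comp_apply, hα, hy'], fun x => ?_⟩
  have h : α.comp (sigmaQuot p g n) = (sigmaQuot p g n).comp α :=
    freeQuot_hom_ext fun i => by
      rw [MonoidHom.comp_apply, MonoidHom.comp_apply, sigmaQuot_gen, map_inv, hα, hy]
  exact DFunLike.congr_fun h x

theorem equivariant_of_gen {σ : G →* G} {l : FreeQuot p g n →* G}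
    (h : ∀ i, σ (l (freeQuotGen p n i)) = (l (freeQuotGen p n i))⁻¹) (x : FreeQuot p g n) :
    l (sigmaQuot p g n x) = σ (l x) := by
  have h : l.comp (sigmaQuot p g n) = σ.comp l :=
    freeQuot_hom_ext fun i => by
      rw [MonoidHom.comp_apply, MonoidHom.comp_apply, sigmaQuot_gen, map_inv, h]
  exact DFunLike.congr_fun h x

-- A basis of G/P₁(G) lifts to inverted elements, and these are the images of the free generators.
include hd in
theorem exists_equivariant_surjection [Finite G] (hp : Odd p) (hG : absLower p G n = ⊥) {σ : G →* G}
    (hσ : ∀ x, σ (σ x) = x) (hσ' : ∀ x, σ x * x ∈ absLower p G 1) :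
    ∃ l : FreeQuot p g n →* G, Function.Surjective l ∧
      ∀ x, l (sigmaQuot p g n x) = σ (l x) := by
  have hodd := odd_card_of_absLower hp hG
  have hfin : Module.finrank (ZMod p) (Additive (StarQuot p (⊤ : Subgroup G))) = g := by
    have h4 := relIndex_absStar (p := p) (N := (⊤ : Subgroup G))
    rw [Subgroup.relIndex_top_right] at h4
    exact (Nat.pow_right_injective (Fact.out : p.Prime).two_le (hd.symm.trans h4)).symm
  have : Finite (Additive (StarQuot p (⊤ : Subgroup G))) :=
    (inferInstance : Finite (StarQuot p (⊤ : Subgroup G)))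
  let b := Module.finBasisOfFinrankEq (ZMod p) (Additive (StarQuot p (⊤ : Subgroup G))) hfin
  choose a ha using fun i => starMk_surjective (p := p) (N := (⊤ : Subgroup G)) (b i)
  choose y hy _ hay using fun i => exists_inverted hodd hσ (M := ⊤) (N := absLower p G 1)
    (fun _ _ => Subgroup.mem_top _) (Subgroup.mem_top (a i : G)) (hσ' (a i))
  obtain ⟨l, hl⟩ := exists_freeQuot_lift hG y
  refine ⟨l, (surjective_iff_normalClosure hG l).2 ?_,
    equivariant_of_gen fun i => by rw [hl, hy]⟩
  simp only [hl]
  refine (normalClosure_eq_iff hG fun i => (⟨y i, Subgroup.mem_top _⟩ : (⊤ : Subgroup G))).2 ?_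
  have : (fun i => starMk p ⊤ (⟨y i, Subgroup.mem_top _⟩ : (⊤ : Subgroup G))) = b := by
    funext i
    rw [← ha, eq_comm, starMk_eq_iff]
    exact hay i
  rw [this, b.span_eq]

end Surjections

/-! ### The measure of a group -/

section Measure

variable {p g n : ℕ} [Fact p.Prime] {G : Type*} [Group G]

variable (p g n) in
/-- The surjections `F / Pₙ(F) → G` that commute with the involutions. -/
abbrev EquivSurj (σ : G →* G) : Type _ :=
  {l : FreeQuot p g n →* G // Function.Surjective l ∧ ∀ x, l (sigmaQuot p g n x) = σ (l x)}

instance [Finite G] (σ : G →* G) : Finite (EquivSurj p g n σ) := by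
  have : Finite (FreeQuot p g n →* G) := DFunLike.finite _
  infer_instance

/-- Equivariant surjections are the generating g-tuples of inverted elements: the case N = G, m = h
= g, where η₀ = 1. -/
theorem card_equivSurj [Finite G] (hp : Odd p) (hG : absLower p G n = ⊥)
    (hd : (absLower p G 1).index = p ^ g) {σ : G →* G} (hσ : ∀ x, σ (σ x) = x)
    (hσ' : ∀ x, σ x * x ∈ absLower p G 1) :
    (Nat.card (EquivSurj p g n σ) : ℝ) =
      (Nat.card (InvIn σ (⊤ : Subgroup G)) : ℝ) ^ g * eta p g := by
  have h1 := card_generating_tuples (odd_card_of_absLower hp hG) hσ hG (N := ⊤)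
    (fun x _ => hσ' x) (m := g) (h := g) (by rw [Subgroup.relIndex_top_right]; exact hd) le_rfl
  rw [← h1, Nat.sub_self, eta, Finset.Icc_eq_empty (by norm_num), Finset.prod_empty, mul_one]
  congr 1
  refine Nat.card_congr (Equiv.ofBijective (fun l => ⟨fun i => ⟨l.1 (freeQuotGen p n i), by
    rw [← l.2.2, sigmaQuot_gen, map_inv], Subgroup.mem_top _⟩,
      (surjective_iff_normalClosure hG l.1).1 l.2.1⟩) ⟨fun l l' h => ?_, ?_⟩)
  · refine Subtype.ext (freeQuot_hom_ext fun i => ?_)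
    exact congrArg Subtype.val (congrFun (congrArg Subtype.val h) i)
  · rintro ⟨v, hv⟩
    obtain ⟨l, hl⟩ := exists_freeQuot_lift hG fun i => (v i).1
    refine ⟨⟨l, (surjective_iff_normalClosure hG l).2 ?_, equivariant_of_gen fun i => ?_⟩, ?_⟩
    · simpa only [hl] using hv
    · rw [hl]
      exact (v i).2.1
    · exact Subtype.ext (funext fun i => Subtype.ext (hl i))

theorem exists_mulEquiv_of_ker_eq {A : Type*} [Group A] {l l' : A →* G}
    (hl : Function.Surjective l) (hl' : Function.Surjective l') (h : l.ker = l'.ker) :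
    ∃ φ : G ≃* G, ∀ x, φ (l x) = l' x := by
  let φ := (QuotientGroup.quotientKerEquivOfSurjective l hl).symm.trans
    ((QuotientGroup.quotientMulEquivOfEq h).trans
      (QuotientGroup.quotientKerEquivOfSurjective l' hl'))
  refine ⟨φ, fun x => ?_⟩
  have e : (QuotientGroup.quotientKerEquivOfSurjective l hl).symm (l x) = x :=
    (MulEquiv.symm_apply_eq _).2 rfl
  change QuotientGroup.quotientKerEquivOfSurjective l' hl'
    (QuotientGroup.quotientMulEquivOfEq h
      ((QuotientGroup.quotientKerEquivOfSurjective l hl).symm (l x))) = _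
  rw [e]
  rfl

/-- The quotient of `F / Pₙ(F)` by relators inverted by `σ` inherits an involution. -/
theorem exists_mulAut_of_mem_T {v : Fin (g + 1) → FreeQuot p g n} (hv : v ∈ T p g G n) :
    ∃ (l : FreeQuot p g n →* G) (τ : MulAut G), Function.Surjective l ∧
      l.ker = Subgroup.normalClosure (Set.range v) ∧ (∀ x, l (sigmaQuot p g n x) = τ (l x)) ∧
      (∀ x, τ (τ x) = x) ∧ ∀ x, τ x * x ∈ absLower p G 1 := by
  obtain ⟨hX, ⟨e⟩⟩ := hv
  let N := Subgroup.normalClosure (Set.range v)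
  let l : FreeQuot p g n →* G := e.toMonoidHom.comp (QuotientGroup.mk' N)
  have hl : Function.Surjective l := e.surjective.comp (QuotientGroup.mk'_surjective N)
  have hker : l.ker = N := by
    ext x
    rw [MonoidHom.mem_ker, MonoidHom.comp_apply]
    exact (map_eq_one_iff e e.injective).trans (QuotientGroup.eq_one_iff x)
  have hN : N ≤ N.comap (sigmaQuot p g n) := by
    refine Subgroup.normalClosure_le_normal ?_
    rintro _ ⟨i, rfl⟩
    change sigmaQuot p g n (v i) ∈ N
    rw [(hX i).2]
    exact inv_mem (Subgroup.subset_normalClosure ⟨i, rfl⟩)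
  let t : G →* G := (e.toMonoidHom.comp (QuotientGroup.map N N _ hN)).comp e.symm.toMonoidHom
  have ht : ∀ x, l (sigmaQuot p g n x) = t (l x) := fun x => by
    change _ = e (QuotientGroup.map N N _ hN (e.symm (e (QuotientGroup.mk' N x))))
    rw [e.symm_apply_apply]
    rfl
  have htt : ∀ x, t (t x) = x := fun x => by
    obtain ⟨y, rfl⟩ := hl x
    rw [← ht, ← ht, sigmaQuot_sigmaQuot]
  refine ⟨l, MulEquiv.mk' ⟨t, t, htt, htt⟩ (map_mul t), hl, hker, ht, htt, fun x => ?_⟩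
  obtain ⟨y, rfl⟩ := hl x
  change t (l y) * l y ∈ _
  rw [← ht, ← map_mul]
  exact absLower_le_comap l 1 (sigmaQuot_mul_self_mem y)

variable [Finite G] (hp : Odd p) (hG : absLower p G n = ⊥)
    (hd : (absLower p G 1).index = p ^ g) {σ : MulAut G} (hσ : ∀ x, σ (σ x) = x)
    (hσ' : ∀ x, σ x * x ∈ absLower p G 1)

-- The involution induced on the quotient need not be σ, but it is conjugate to σ, and the
-- conjugating automorphism corrects l without changing its kernel.
include hp hG hσ hσ' in
theorem exists_equivSurj_of_mem_T {v : Fin (g + 1) → FreeQuot p g n} (hv : v ∈ T p g G n) :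
    ∃ l : EquivSurj p g n σ.toMonoidHom,
      Subgroup.normalClosure (Set.range v) = l.1.ker := by
  obtain ⟨l, τ, hl, hker, hlτ, hτ, hτ'⟩ := exists_mulAut_of_mem_T hv
  obtain ⟨u, hu⟩ := exists_conj_of_inverts hG (odd_card_of_absLower hp hG) hσ hτ hσ' hτ'
  refine ⟨⟨u.toMonoidHom.comp l, u.surjective.comp hl, fun x => ?_⟩, ?_⟩
  · change u (l _) = σ (u (l x))
    rw [hlτ, hu]
  · rw [← hker]
    ext x
    exact (map_eq_one_iff u u.injective).symm

/-- Pairs of an equivariant surjection and a tuple of inverted normal generators of its kernel. -/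
abbrev PresPair (p g n : ℕ) (σ : MulAut G) : Type _ :=
  {z : EquivSurj p g n σ.toMonoidHom × (Fin (g + 1) → FreeQuot p g n) //
    (∀ i, sigmaQuot p g n (z.2 i) = (z.2 i)⁻¹) ∧
      Subgroup.normalClosure (Set.range z.2) = z.1.1.ker}

-- Two equivariant surjections with the same kernel differ by a unique automorphism of G, which
-- commutes with σ. Relators lie in the Frattini subgroup automatically, the presentation being
-- minimal.
include hp hG hd hσ hσ' in
theorem card_presPair_eq_card_T :
    Nat.card (PresPair p g n σ) =
      Nat.card (T p g G n) * Nat.card {φ : G ≃* G // ∀ x, φ (σ x) = σ (φ x)} := by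
  have hT : ∀ z : PresPair p g n σ, z.1.2 ∈ T p g G n := fun z => by
    refine ⟨fun i => ⟨?_, z.2.1 i⟩, ⟨?_⟩⟩
    · rw [frattini_eq_absLower_one (absLower_freeQuot (p := p) n)]
      refine ker_le_absLower_one hd z.1.1.2.1 ?_
      rw [← z.2.2]
      exact Subgroup.subset_normalClosure ⟨i, rfl⟩
    · exact (QuotientGroup.quotientMulEquivOfEq z.2.2).trans
        (QuotientGroup.quotientKerEquivOfSurjective _ z.1.1.2.1)
  obtain ⟨e, -⟩ := exists_equiv_prod (C := {φ : G ≃* G // ∀ x, φ (σ x) = σ (φ x)})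
    (fun z : PresPair p g n σ => (⟨z.1.2, hT z⟩ : T p g G n)) (by
      rintro ⟨v, hv⟩
      obtain ⟨l, hl⟩ := exists_equivSurj_of_mem_T hp hG hσ hσ' hv
      let F : {φ : G ≃* G // ∀ x, φ (σ x) = σ (φ x)} → EquivSurj p g n σ.toMonoidHom :=
        fun φ => ⟨φ.1.toMonoidHom.comp l.1, φ.1.surjective.comp l.2.1, fun x => by
          change φ.1 (l.1 _) = σ (φ.1 (l.1 x))
          rw [l.2.2, ← φ.2]
          rfl⟩
      have hF : ∀ φ, (F φ).1.ker = l.1.ker := fun φ => by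
        ext x
        exact map_eq_one_iff φ.1 φ.1.injective
      refine ⟨(Equiv.ofBijective (fun φ => ⟨⟨(F φ, v), ⟨fun i => (hv.1 i).2,
        hl.trans (hF φ).symm⟩⟩, rfl⟩) ⟨fun φ ψ h => ?_, ?_⟩).symm⟩
      · have h1 : F φ = F ψ := congrArg (fun z => z.1.1.1) h
        refine Subtype.ext (MulEquiv.ext fun x => ?_)
        obtain ⟨y, rfl⟩ := l.2.1 x
        exact DFunLike.congr_fun (congrArg Subtype.val h1) y
      · rintro ⟨⟨⟨l', v'⟩, hz⟩, hv'⟩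
        obtain rfl : v' = v := congrArg Subtype.val hv'
        obtain ⟨φ, hφ⟩ := exists_mulEquiv_of_ker_eq l.2.1 l'.2.1 (hl.symm.trans hz.2)
        refine ⟨⟨φ, fun x => ?_⟩, ?_⟩
        · obtain ⟨y, rfl⟩ := l.2.1 x
          have h1 := l.2.2 y
          have h2 := l'.2.2 y
          change l.1 _ = σ (l.1 y) at h1
          change l'.1 _ = σ (l'.1 y) at h2
          rw [← h1, hφ, hφ, h2]
        · refine Subtype.ext (Subtype.ext (Prod.ext (Subtype.ext (MonoidHom.ext hφ)) rfl)))
  rw [Nat.card_congr e, Nat.card_prod]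

omit [Finite G] in
theorem card_presPair {C : ℕ} (hC : ∀ l : EquivSurj p g n σ.toMonoidHom,
      Nat.card {v : Fin (g + 1) → InvIn (sigmaQuot p g n) l.1.ker //
        Subgroup.normalClosure (Set.range fun i => (v i).1) = l.1.ker} = C) :
    Nat.card (PresPair p g n σ) = Nat.card (EquivSurj p g n σ.toMonoidHom) * C := by
  obtain ⟨e, -⟩ := exists_equiv_prod (C := Fin C)
    (fun z : PresPair p g n σ => z.1.1) (fun l => by
      have hl : ∀ z : {z : PresPair p g n σ // z.1.1 = l},
          Subgroup.normalClosure (Set.range z.1.1.2) = l.1.ker := by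
        rintro ⟨z, rfl⟩
        exact z.2.2
      let e : {z : PresPair p g n σ // z.1.1 = l} ≃
          {v : Fin (g + 1) → InvIn (sigmaQuot p g n) l.1.ker //
            Subgroup.normalClosure (Set.range fun i => (v i).1) = l.1.ker} :=
        { toFun z := ⟨fun i => ⟨z.1.1.2 i, z.1.2.1 i,
            (hl z).le (Subgroup.subset_normalClosure ⟨i, rfl⟩)⟩, hl z⟩
          invFun v := ⟨⟨(l, fun i => (v.1 i).1), fun i => (v.1 i).2.1, v.2⟩, rfl⟩
          left_inv := by
            rintro ⟨⟨⟨l', v⟩, hz⟩, rfl⟩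
            rfl
          right_inv v := rfl }
      exact ⟨e.trans (Finite.equivFinOfCardEq (hC l))⟩)
  rw [Nat.card_congr e, Nat.card_prod, Nat.card_fin]

include hp hG hd hσ hσ' in
/-- The measure of `G`, in terms of a presentation on whose relation module the involution acts as
inversion. -/
theorem measAt_eq {l : FreeQuot p g n →* G} (hl : Function.Surjective l)
    (hlσ : ∀ x, l (sigmaQuot p g n x) = σ (l x))
    (hinv : ∀ x ∈ l.ker, sigmaQuot p g n x * x ∈ absStar p l.ker) {h : ℕ}
    (hh : (absStar p l.ker).relIndex l.ker = p ^ h) (hhg : h ≤ g + 1) :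
    measAt p g G n =
      (Nat.card {x : G // σ x = x} : ℝ) /
          ((Nat.card {φ : G ≃* G // ∀ x, φ (σ x) = σ (φ x)} : ℝ) * (Nat.card G : ℝ)) *
        (p : ℝ) ^ (g * (g + 1)) * (eta p g * eta p (g + 1) / eta p (g + 1 - h)) := by
  have hp1 := (Fact.out : p.Prime).one_lt
  have hoddG := odd_card_of_absLower hp hG
  have hodd := odd_card_of_absLower hp (absLower_freeQuot (p := p) (g := g) n)
  have hsσ := sigmaQuot_sigmaQuot (p := p) (g := g) n
  have hη := eta_pos hp1 (g + 1 - h)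
  have hYQ : ∀ l' : EquivSurj p g n σ.toMonoidHom,
      Nat.card (InvIn (sigmaQuot p g n) ⊤) = Nat.card (InvIn σ.toMonoidHom (⊤ : Subgroup G)) *
        Nat.card (InvIn (sigmaQuot p g n) l'.1.ker) := fun l' =>
    card_invIn_top_of_surjective hodd hsσ l'.2.1 l'.2.2
  have hYGpos : 0 < Nat.card (InvIn σ.toMonoidHom (⊤ : Subgroup G)) :=
    Nat.card_pos_iff.2 ⟨⟨⟨1, by simp⟩⟩, inferInstance⟩
  -- The given presentation serves as reference: |Inv(ker l')| and the number of relator tuples are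
  -- the same for every l'.
  let l₀ : EquivSurj p g n σ.toMonoidHom := ⟨l, hl, hlσ⟩
  have hYR : ∀ l' : EquivSurj p g n σ.toMonoidHom,
      Nat.card (InvIn (sigmaQuot p g n) l'.1.ker) =
        Nat.card (InvIn (sigmaQuot p g n) l.ker) := fun l' =>
    Nat.eq_of_mul_eq_mul_left hYGpos ((hYQ l').symm.trans (hYQ l₀))
  have hYRpos : 0 < Nat.card (InvIn (sigmaQuot p g n) l.ker) :=
    Nat.card_pos_iff.2 ⟨⟨⟨1, by simp [one_mem]⟩⟩, inferInstance⟩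
  have htup : ∀ l' : EquivSurj p g n σ.toMonoidHom,
      (Nat.card {v : Fin (g + 1) → InvIn (sigmaQuot p g n) l'.1.ker //
        Subgroup.normalClosure (Set.range fun i => (v i).1) = l'.1.ker} : ℝ) *
          eta p (g + 1 - h) =
        (Nat.card (InvIn (sigmaQuot p g n) l.ker) : ℝ) ^ (g + 1) * eta p (g + 1) := fun l' => by
    -- The rank h and the inversion hypothesis pass from l to l' along an automorphism of F_n
    -- commuting with σ.
    obtain ⟨α, hα, hασ⟩ := exists_equivariant_comp hp l'.1 l l'.2.1 l'.2.2 hlσ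
    rw [← hYR l']
    refine card_generating_tuples hodd hsσ (absLower_freeQuot n)
      (inverts_ker_of_comp hd l'.2.1 hl hα hασ hinv) ?_ hhg
    rw [← relIndex_ker_of_comp hd l'.2.1 hl hα, hh]
  have hC := card_presPair (σ := σ) (C := Nat.card {v : Fin (g + 1) →
      InvIn (sigmaQuot p g n) l.ker // Subgroup.normalClosure (Set.range fun i => (v i).1) =
        l.ker}) fun l' => by
    have h1 := (htup l').trans (htup l₀).symm
    exact_mod_cast mul_right_cancel₀ hη.ne' h1
  rw [card_presPair_eq_card_T hp hG hd hσ hσ'] at hC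
  -- σ is inversion on F_n/P₁(F_n), of order p^g, and X_n consists of the inverted elements of
  -- P₁(F_n).
  have hX : Nat.card (InvIn (sigmaQuot p g n) ⊤) = p ^ g * (X p g n).ncard := by
    rw [card_invIn hodd hsσ (N := absLower p (FreeQuot p g n) 1) le_top
      fun x _ => sigmaQuot_mul_self_mem x, Subgroup.relIndex_top_right,
      index_absLower_one_freeQuot hd hl]
    congr 1
    refine Nat.card_congr (Equiv.subtypeEquivRight fun x => ?_)
    rw [← frattini_eq_absLower_one (absLower_freeQuot (p := p) n)]
    exact and_comm
  have hfix : Nat.card (InvIn σ.toMonoidHom (⊤ : Subgroup G)) * Nat.card {x : G // σ x = x} =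
      Nat.card G := by
    have h1 := card_inverted_mul_card_fixed hoddG (σ := σ.toMonoidHom) hσ
    refine Eq.trans ?_ h1
    congr 1
    exact Nat.card_congr (Equiv.subtypeEquivRight fun x => by simp)
  have hA : 0 < Nat.card {φ : G ≃* G // ∀ x, φ (σ x) = σ (φ x)} := by
    have : Finite (G ≃* G) := DFunLike.finite _
    exact Nat.card_pos_iff.2 ⟨⟨⟨MulEquiv.refl G, fun _ => rfl⟩⟩, inferInstance⟩
  have hS := card_equivSurj hp hG hd (σ := σ.toMonoidHom) hσ hσ'
  have ht := htup l₀
  have hQ := hYQ l₀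
  have hpp : (0 : ℝ) < p := by exact_mod_cast hp1.le
  have hTc : (T p g G n).ncard = Nat.card (T p g G n) := rfl
  have hy : 0 < Nat.card {x : G // σ x = x} :=
    Nat.card_pos_iff.2 ⟨⟨⟨1, map_one σ⟩⟩, inferInstance⟩
  rw [measAt, hTc, ← hfix]
  rw [hX] at hQ
  change _ = _ * Nat.card (InvIn (sigmaQuot p g n) l.ker) at hQ
  change (Nat.card {v : Fin (g + 1) → InvIn (sigmaQuot p g n) l.ker //
    Subgroup.normalClosure (Set.range fun i => (v i).1) = l.ker} : ℝ) * _ = _ at ht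
  generalize Nat.card (InvIn σ.toMonoidHom (⊤ : Subgroup G)) = yG at *
  generalize Nat.card (InvIn (sigmaQuot p g n) l.ker) = yR at *
  generalize Nat.card {φ : G ≃* G // ∀ x, φ (σ x) = σ (φ x)} = A at *
  generalize Nat.card {x : G // σ x = x} = y at *
  generalize Nat.card {v : Fin (g + 1) → InvIn (sigmaQuot p g n) l.ker //
    Subgroup.normalClosure (Set.range fun i => (v i).1) = l.ker} = C at *
  generalize (X p g n).ncard = x at *
  generalize Nat.card (T p g G n) = t at *
  generalize Nat.card (EquivSurj p g n σ.toMonoidHom) = E at *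
  have hx : 0 < x := by
    rcases Nat.eq_zero_or_pos x with rfl | h
    · rw [mul_zero] at hQ
      exact absurd hQ (mul_pos hYGpos hYRpos).ne
    · exact h
  have hC' : (t : ℝ) * A = E * C := by exact_mod_cast hC
  have hQ' : (p : ℝ) ^ g * x = yG * yR := by exact_mod_cast hQ
  have hyG : (0 : ℝ) < yG := by exact_mod_cast hYGpos
  have hyR : (0 : ℝ) < yR := by exact_mod_cast hYRpos
  have hx' : (0 : ℝ) < x := by exact_mod_cast hx
  have hA' : (0 : ℝ) < A := by exact_mod_cast hA
  have hy' : (0 : ℝ) < y := by exact_mod_cast hy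
  have hQ'' : (p : ℝ) ^ (g * (g + 1)) * x ^ (g + 1) = yG ^ (g + 1) * yR ^ (g + 1) := by
    rw [pow_mul, ← mul_pow, hQ', mul_pow]
  have key : (t : ℝ) * A * eta p (g + 1 - h) * yG =
      p ^ (g * (g + 1)) * eta p g * eta p (g + 1) * x ^ (g + 1) := by
    have : (t : ℝ) * A * eta p (g + 1 - h) * yG = E * (C * eta p (g + 1 - h)) * yG := by
      rw [hC']
      ring
    rw [this, ht, hS]
    linear_combination -(eta p g * eta p (g + 1)) * hQ''
  push_cast
  field_simp
  linear_combination key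

end Measure

/-! ### A lower bound for the relation rank -/

section RankBound

theorem absLower_le_range_pow {p : ℕ} {M : Type*} [CommGroup M] (k : ℕ) :
    absLower p M k ≤ (powMonoidHom (p ^ k) : M →* M).range := by
  induction k with
  | zero => exact fun x _ => ⟨x, by simp⟩
  | succ k ih =>
    refine absStar_le_iff.2 ⟨fun a b _ => ?_, fun b hb => ?_⟩
    · rw [mul_comm a b, mul_inv_cancel_right, mul_inv_cancel]
      exact one_mem _
    · obtain ⟨y, rfl⟩ := ih hb
      exact ⟨y, by simp [pow_succ, pow_mul]⟩

/-- For finite abelian A, |A[p]| = |A/A^p|, and the star of A consists of p-th powers because M is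
abelian. -/
theorem card_ker_pow_le_relIndex {p : ℕ} {M : Type*} [CommGroup M] [Finite M] (A : Subgroup M) :
    Nat.card (powMonoidHom p : A →* A).ker ≤ (absStar p A).relIndex A := by
  rw [← Subgroup.index_range]
  refine Nat.le_of_dvd (Nat.pos_of_ne_zero Subgroup.index_ne_zero_of_finite)
    (Subgroup.index_dvd_of_le ?_)
  intro x hx
  have h : absStar p A ≤ (powMonoidHom p : A →* A).range.map A.subtype := by
    refine absStar_le_iff.2 ⟨fun a b _ => ?_, fun b hb => ?_⟩
    · rw [mul_comm a b, mul_inv_cancel_right, mul_inv_cancel]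
      exact one_mem _
    · exact ⟨⟨b, hb⟩ ^ p, ⟨⟨b, hb⟩, rfl⟩, rfl⟩
  obtain ⟨y, hy, hyx⟩ := h (Subgroup.mem_subgroupOf.1 hx)
  rwa [← Subtype.ext hyx]

variable {p g c : ℕ} [Fact p.Prime] {G : Type*} [Group G]

/-- The relation module of a group of `p`-class at most `c` on `g` generators has rank at least
`g`. -/
theorem pow_le_relIndex_ker (hG : absLower p G c = ⊥) (l : FreeQuot p g (c + 1) →* G) :
    p ^ g ≤ (absStar p l.ker).relIndex l.ker := by
  have hp := (Fact.out : p.Prime).one_lt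
  have : NeZero (p ^ (c + 1)) := ⟨pow_ne_zero _ (by omega)⟩
  -- F_{c+1} maps onto this group. G has exponent dividing p^c, so the image A of ker l contains all
  -- p^c-th powers, which form an elementary abelian group of order p^g; hence p^g ≤ |A[p]| ≤
  -- |A/A*|.
  let M := Fin g → Multiplicative (ZMod (p ^ (c + 1)))
  have hexp : ∀ x : M, x ^ p ^ (c + 1) = 1 := fun x => by
    ext i
    change Multiplicative.ofAdd (p ^ (c + 1) • (x i).toAdd) = 1
    rw [nsmul_eq_mul, CharP.cast_eq_zero, zero_mul]
    rfl
  have hM : absLower p M (c + 1) = ⊥ := by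
    refine le_bot_iff.1 ((absLower_le_range_pow (c + 1)).trans ?_)
    rintro _ ⟨x, rfl⟩
    exact hexp x
  obtain ⟨m, hm⟩ := exists_freeQuot_lift hM
    fun i : Fin g => (Pi.mulSingle i (Multiplicative.ofAdd 1) : M)
  have hms : Function.Surjective m := by
    rw [← MonoidHom.range_eq_top, eq_top_iff]
    intro x _
    rw [← Finset.univ_prod_mulSingle x]
    refine Subgroup.prod_mem _ fun i _ => ?_
    refine ⟨freeQuotGen p (c + 1) i ^ (x i).toAdd.val, ?_⟩
    rw [map_pow, hm, ← Pi.mulSingle_pow]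
    congr 1
    change Multiplicative.ofAdd ((x i).toAdd.val • (1 : ZMod (p ^ (c + 1)))) = x i
    rw [nsmul_eq_mul, ZMod.natCast_zmod_val, mul_one]
    rfl
  have hA : ∀ u : M, u ^ p ^ c ∈ l.ker.map m := fun u => by
    obtain ⟨q, rfl⟩ := hms u
    refine ⟨q ^ p ^ c, ?_, map_pow m q _⟩
    have h1 := pow_pow_mem_absLower (p := p) (l q) c
    rw [hG, Subgroup.mem_bot] at h1
    exact (map_pow l q _).trans h1
  -- Vectors with entries below p remain distinct after multiplication by p^c modulo p^(c+1).
  let F : (Fin g → Fin p) → (powMonoidHom p : l.ker.map m →* l.ker.map m).ker := fun a =>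
    ⟨⟨(fun i => Multiplicative.ofAdd ((a i : ℕ) : ZMod (p ^ (c + 1)))) ^ p ^ c, hA _⟩, by
      refine Subtype.ext ?_
      change (_ ^ p ^ c) ^ p = (1 : M)
      rw [← pow_mul, ← pow_succ, hexp]⟩
  have hF : Function.Injective F := fun a b h => by
    have h1 : ((fun i => Multiplicative.ofAdd ((a i : ℕ) : ZMod (p ^ (c + 1)))) ^ p ^ c : M) =
        (fun i => Multiplicative.ofAdd ((b i : ℕ) : ZMod (p ^ (c + 1)))) ^ p ^ c :=
      congrArg (fun x => x.1.1) h
    ext i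
    have h2 : p ^ c • ((a i : ℕ) : ZMod (p ^ (c + 1))) = p ^ c • ((b i : ℕ) : ZMod (p ^ (c + 1))) :=
      congrFun h1 i
    rw [nsmul_eq_mul, nsmul_eq_mul, ← Nat.cast_mul, ← Nat.cast_mul, ZMod.natCast_eq_natCast_iff,
      pow_succ] at h2
    have h3 := Nat.ModEq.mul_left_cancel' (pow_ne_zero c (by omega)) h2
    exact Nat.ModEq.eq_of_lt_of_lt h3 (a i).2 (b i).2
  have h1 := Nat.card_le_card_of_injective F hF
  rw [Nat.card_fun, Nat.card_fin, Nat.card_fin] at h1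
  refine h1.trans ((card_ker_pow_le_relIndex _).trans ?_)
  rw [← Subgroup.relIndex_comap]
  exact Subgroup.relIndex_le_of_le_left (absStar_le_comap m (Subgroup.le_comap_map _ _))
    (Nat.card_pos (α := StarQuot p l.ker)).ne'

end RankBound

/-! ### GI-automorphisms -/

section GI

universe u

variable {p : ℕ} {G : Type u} [Group G] [TopologicalSpace G] [IsTopologicalGroup G]

theorem IsGI.mul_self_mem {σ : G ≃ₜ* G} (hσ : IsGI σ) (x : G) : σ x * x ∈ lowerP p G 1 := by
  have h := hσ.inverts_ab x
  rw [← mul_eq_one_iff_eq_inv, ← QuotientGroup.mk_mul, QuotientGroup.eq_one_iff] at h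
  refine Subgroup.topologicalClosure_minimal _ ?_ (isClosed_lowerP (p := p) 1) h
  rw [commutator_def, Subgroup.commutator_le]
  exact fun a _ b hb => commutator_mem_pStar p (N := ⊤) a hb

omit [IsTopologicalGroup G] in
theorem autCard_eq [DiscreteTopology G] (σ : G ≃ₜ* G) :
    autCard σ = Nat.card {φ : G ≃* G // ∀ x, φ (σ x) = σ (φ x)} :=
  Nat.card_congr
    { toFun φ := ⟨φ.1.toMulEquiv, φ.2⟩
      invFun φ := ⟨⟨φ.1, continuous_of_discreteTopology, continuous_of_discreteTopology⟩, φ.2⟩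
      left_inv _ := rfl
      right_inv _ := rfl }

variable [Fact p.Prime] [Finite G] [DiscreteTopology G] {g n : ℕ}

/-- The formula for the measure holds for every GI-automorphism as soon as one involution of `G`
lifts to act as inversion on the relation module. -/
theorem measAt_eq_of_isGI (hp : Odd p) (hG : absLower p G n = ⊥)
    (hd : (absLower p G 1).index = p ^ g) {σ : G ≃ₜ* G} (hσ : IsGI σ) {τ : MulAut G}
    (hτ : ∀ x, τ (τ x) = x) {l : FreeQuot p g n →* G} (hl : Function.Surjective l)
    (hlτ : ∀ x, l (sigmaQuot p g n x) = τ (l x))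
    (hinv : ∀ x ∈ l.ker, sigmaQuot p g n x * x ∈ absStar p l.ker) {h : ℕ}
    (hh : (absStar p l.ker).relIndex l.ker = p ^ h) (hhg : h ≤ g + 1) :
    measAt p g G n = (yCard σ : ℝ) / ((autCard σ : ℝ) * (Nat.card G : ℝ)) *
      (p : ℝ) ^ (g * (g + 1)) * (eta p g * eta p (g + 1) / eta p (g + 1 - h)) := by
  have hτ' : ∀ x, τ x * x ∈ absLower p G 1 := fun x => by
    obtain ⟨y, rfl⟩ := hl x
    rw [← hlτ, ← map_mul]
    exact absLower_le_comap l 1 (sigmaQuot_mul_self_mem y)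
  have hσ' : ∀ x, σ.toMulEquiv x * x ∈ absLower p G 1 := fun x => by
    rw [← lowerP_eq_absLower]
    exact hσ.mul_self_mem x
  obtain ⟨u, hu⟩ := exists_conj_of_inverts hG (odd_card_of_absLower hp hG)
    (σ := σ.toMulEquiv) (τ := τ) hσ.involutive hτ hσ' hτ'
  have hker : (u.toMonoidHom.comp l).ker = l.ker := by
    ext x
    exact map_eq_one_iff u u.injective
  rw [autCard_eq]
  refine measAt_eq hp hG hd (σ := σ.toMulEquiv) hσ.involutive hσ' (l := u.toMonoidHom.comp l)
    (u.surjective.comp hl) (fun x => ?_) (by rwa [hker]) (by rwa [hker]) hhg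
  change u (l _) = _
  rw [hlτ, hu]
  rfl

end GI

/-! ### Schur+1 `σ`-groups and their ancestors -/

section Schur

universe u

variable {p g c n : ℕ} [Fact p.Prime] {G : Type u} [Group G]

theorem exists_lift_cocycleExt [TopologicalSpace G] (hG : absLower p G c = ⊥) (hcn : c + 1 ≤ n)
    (l : FreeQuot p g n →* G) (z : Z2 p G) :
    ∃ l' : FreeQuot p g n →* CocycleExt z, (CocycleExt.proj z).comp l' = l := by
  obtain ⟨l', hl'⟩ := exists_freeQuot_lift
    (absLower_eq_bot_of_le (CocycleExt.absLower_eq_bot (z := z) hG) hcn)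
    fun i => (⟨l (freeQuotGen p n i), 0⟩ : CocycleExt z)
  refine ⟨l', freeQuot_hom_ext fun i => ?_⟩
  rw [MonoidHom.comp_apply, hl']
  rfl

theorem mulAut_of_involutive {t : G →* G} (ht : ∀ x, t (t x) = x) :
    ∃ τ : MulAut G, ∀ x, τ x = t x :=
  ⟨MulEquiv.mk' ⟨t, t, ht, ht⟩ (map_mul t), fun _ => rfl⟩

/-- Every continuous homomorphism H → 𝔽_p kills P₁(H), hence factors through ρ. -/
theorem genRank_eq_of_surjective [TopologicalSpace G] [DiscreteTopology G] {H : Type u} [Group H]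
    [TopologicalSpace H] [IsTopologicalGroup H] {ρ : H →* G} (hρ : Continuous ρ)
    (hρs : Function.Surjective ρ) (hρk : ρ.ker ≤ lowerP p H 1) : genRank p H = genRank p G := by
  let F : H1 p G →ₗ[ZMod p] H1 p H :=
    { toFun f := ⟨LocallyConstant.comap ⟨ρ, hρ⟩ f.1, fun x y => by
        change f.1 (ρ (x * y)) = f.1 (ρ x) + f.1 (ρ y)
        rw [map_mul, f.2]⟩
      map_add' _ _ := rfl
      map_smul' _ _ := rfl }
  refine (LinearEquiv.ofBijective F ⟨fun f f' h => ?_, fun f => ?_⟩).finrank_eq.symm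
  · refine Subtype.ext (LocallyConstant.ext fun y => ?_)
    obtain ⟨x, rfl⟩ := hρs y
    exact DFunLike.congr_fun (congrArg Subtype.val h) x
  · have hone : f.1 1 = 0 := by
      have := f.2 1 1
      rwa [mul_one, left_eq_add] at this
    have hinv : ∀ x, f.1 x⁻¹ = -f.1 x := fun x => by
      have := f.2 x⁻¹ x
      rw [inv_mul_cancel, hone] at this
      exact eq_neg_of_add_eq_zero_left this.symm
    have hpow : ∀ x, ∀ k : ℕ, f.1 (x ^ k) = k * f.1 x := fun x k => by
      induction k with
      | zero => simp [hone]
      | succ k ih =>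
        rw [pow_succ, f.2, ih]
        push_cast
        ring
    let K : Subgroup H :=
      { carrier := {x | f.1 x = 0}
        mul_mem' := fun {x y} hx hy => by
          change f.1 (x * y) = 0
          rw [f.2, hx, hy, add_zero]
        one_mem' := hone
        inv_mem' := fun {x} hx => by
          change f.1 x⁻¹ = 0
          rw [hinv, hx, neg_zero] }
    have hK : lowerP p H 1 ≤ K := by
      refine pStar_le_of_isClosed (f.1.isLocallyConstant.isClosed_fiber 0)
        (absStar_le_iff.2 ⟨fun a b _ => ?_, fun b _ => ?_⟩)
      · change f.1 _ = 0
        rw [f.2, f.2, f.2, hinv, hinv]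
        ring
      · change f.1 _ = 0
        rw [hpow, CharP.cast_eq_zero, zero_mul]
    have hfρ : ∀ x y, ρ x = ρ y → f.1 x = f.1 y := fun x y hxy => by
      have h1 : x⁻¹ * y ∈ ρ.ker := by simp [MonoidHom.mem_ker, hxy]
      have h2 : f.1 (x⁻¹ * y) = 0 := hK (hρk h1)
      rw [f.2, hinv] at h2
      linear_combination -h2
    have hs := Function.surjInv_eq hρs
    refine ⟨⟨⟨fun y => f.1 (Function.surjInv hρs y), IsLocallyConstant.of_discrete _⟩,
      fun x y => ?_⟩, Subtype.ext (LocallyConstant.ext fun x => hfρ _ _ (hs _))⟩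
    change f.1 (Function.surjInv hρs (x * y)) = _
    rw [hfρ _ (Function.surjInv hρs x * Function.surjInv hρs y) (by rw [map_mul, hs, hs, hs])]
    exact f.2 _ _

variable [Finite G] [TopologicalSpace G] [DiscreteTopology G]

/-- An ancestor group has an equivariant presentation on whose relation module, up to the nucleus,
the involution acts as inversion, and the rank of this module is at most `g + 1`. -/
theorem exists_presentation_of_ancestor (hp : Odd p) (hg : 0 < g)
    (hG : IsSchurPlusOneAncestor G p) (hc : HasPClass p G c) (hd : genRank p G = g) :
    ∃ (τ : MulAut G) (l : FreeQuot p g c →* G) (h : ℕ), (∀ x, τ (τ x) = x) ∧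
      Function.Surjective l ∧ (∀ x, l (sigmaQuot p g c x) = τ (l x)) ∧
      (∀ x ∈ l.ker, sigmaQuot p g c x * x ∈ absStar p l.ker) ∧
      (absStar p l.ker).relIndex l.ker = p ^ h ∧ h ≤ g + 1 := by
  have hGc : absLower p G c = ⊥ := by rw [← lowerP_eq_absLower]; exact hc.1
  have hd' : (absLower p G 1).index = p ^ g := by rw [index_absLower_one, hd]
  obtain ⟨H, _, _, _, d, n, hH, ⟨e⟩⟩ := hG
  obtain ⟨σH, hσH, hneg⟩ := hH.exists_GI
  let ρ : H →* G := e.symm.toMulEquiv.toMonoidHom.comp (QuotientGroup.mk' (lowerP p H n))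
  have hρ : Continuous ρ := e.symm.continuous.comp QuotientGroup.continuous_mk
  have hρs : Function.Surjective ρ := e.symm.surjective.comp (QuotientGroup.mk'_surjective _)
  have hρk : ρ.ker = lowerP p H n := by
    ext x
    exact (map_eq_one_iff e.symm e.symm.injective).trans (QuotientGroup.eq_one_iff x)
  have hcn : c ≤ n := by
    by_contra h
    refine hc.2 n (by omega) ?_
    rw [lowerP_eq_absLower, ← map_absLower hρs, Subgroup.map_eq_bot_iff, hρk]
    exact absLower_le_lowerP n
  -- Since g > 0 the group G is nontrivial; then ker ρ ≤ P₁(H), and H has the same generator rank as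
  -- G.
  have hc0 : 1 ≤ c := by
    by_contra h
    obtain rfl : c = 0 := by omega
    have h1 : (absLower p G 1).index = 1 :=
      Subgroup.index_eq_one.2 (top_le_iff.1 (hGc.le.trans bot_le))
    rw [hd'] at h1
    exact absurd h1 (Nat.one_lt_pow hg.ne' (Fact.out : p.Prime).one_lt).ne'
  have hρc : ρ.ker ≤ lowerP p H c := hρk.le.trans (lowerP_antitone hcn)
  have hdg : d = g := by
    rw [← hH.genRank_eq, ← hd]
    exact genRank_eq_of_surjective hρ hρs (hρc.trans (lowerP_antitone hc0))
  subst hdg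
  have hker : ρ.ker ≤ (ρ.comp σH.toMulEquiv.toMonoidHom).ker := fun x hx => by
    rw [← MonoidHom.comap_ker, hρk]
    exact lowerP_le_comap p σH.toMulEquiv.toMonoidHom σH.continuous n (hρk ▸ hx)
  let t : G →* G := ρ.liftOfSurjective hρs ⟨ρ.comp σH.toMulEquiv.toMonoidHom, hker⟩
  have ht : ∀ x, t (ρ x) = ρ (σH x) := fun x =>
    MonoidHom.liftOfRightInverse_comp_apply _ _ _ _ x
  obtain ⟨τ, hτt⟩ := mulAut_of_involutive (t := t) fun x => by
    obtain ⟨y, rfl⟩ := hρs x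
    rw [ht, ht, hσH.involutive]
  have hστ : ∀ x, ρ (σH x) = τ (ρ x) := fun x => by rw [hτt, ht]
  have hτ : ∀ x, τ (τ x) = x := fun x => by
    obtain ⟨y, rfl⟩ := hρs x
    rw [← hστ, ← hστ, hσH.involutive]
  have hτ' : ∀ x, τ x * x ∈ absLower p G 1 := fun x => by
    obtain ⟨y, rfl⟩ := hρs x
    rw [← hστ, ← map_mul]
    exact lowerP_le_comap_absLower hρ 1 (hσH.mul_self_mem y)
  obtain ⟨l, hl, hlτ⟩ := exists_equivariant_surjection hd' hp hGc (σ := τ.toMonoidHom) hτ hτ'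
  have hs := Function.surjInv_eq hl
  have hinj := infl_injective (p := p) hs ρ hρ (absLower_freeQuot (p := p) c)
    (ker_le_absLower_one hd' hl) hρs hρc
  have hr : relRank p H ≤ d + 1 := by rcases hH.relRank_eq with h | h <;> omega
  -- `finrank` is 0 in infinite dimension, so r(H) ≥ g > 0 is what makes H²(H) finite-dimensional
  -- and the rank comparison valid.
  have hr0 : 0 < Module.finrank (ZMod p) (H2 p H) := by
    change 0 < relRank p H
    rcases hH.relRank_eq with h | h <;> omega
  have := Module.finite_of_finrank_pos hr0
  refine ⟨τ, l, _, hτ, hl, hlτ, fun x hx => ?_, relIndex_absStar, ?_⟩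
  · exact inverts_of_H2 hs ρ hρ (τ := τ) hlτ hστ hinj hneg hx
  · rw [← finrank_invHom]
    exact (LinearMap.finrank_le_finrank_of_injective hinj).trans hr

/-- A Schur+1 `σ`-group has an equivariant presentation on whose relation module the involution
acts as inversion. -/
theorem exists_presentation_of_isSchurPlusOne (hp : Odd p) (hG : absLower p G c = ⊥)
    (hcn : c + 1 ≤ n) (hS : IsSchurPlusOne G p g) :
    ∃ (τ : MulAut G) (l : FreeQuot p g n →* G), (∀ x, τ (τ x) = x) ∧
      Function.Surjective l ∧ (∀ x, l (sigmaQuot p g n x) = τ (l x)) ∧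
      (∀ x ∈ l.ker, sigmaQuot p g n x * x ∈ absStar p l.ker) ∧
      (absStar p l.ker).relIndex l.ker = p ^ relRank p G := by
  have hGn := absLower_eq_bot_of_le hG (Nat.le_of_succ_le hcn)
  have hd' : (absLower p G 1).index = p ^ g := by rw [index_absLower_one, hS.genRank_eq]
  obtain ⟨σ, hσ, hneg⟩ := hS.exists_GI
  have hσ' : ∀ x, σ.toMulEquiv x * x ∈ absLower p G 1 := fun x => by
    rw [← lowerP_eq_absLower]
    exact hσ.mul_self_mem x
  obtain ⟨l, hl, hlσ⟩ := exists_equivariant_surjection hd' hp hGn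
    (σ := σ.toMulEquiv.toMonoidHom) hσ.involutive hσ'
  have hs := Function.surjInv_eq hl
  have hker := ker_le_absLower_one hd' hl
  have hinj := infl_injective (p := p) hs (MonoidHom.id G) continuous_id
    (absLower_freeQuot (p := p) n) hker Function.surjective_id
    (by rw [MonoidHom.ker_id]; exact bot_le)
  exact ⟨σ.toMulEquiv, l, hσ.involutive, hl, hlσ, fun x hx =>
    inverts_of_H2 hs (MonoidHom.id G) continuous_id (τ := σ.toMulEquiv) hlσ (fun _ => rfl)
      hinj hneg hx, relIndex_ker_eq_pow_relRank hs (absLower_freeQuot n) hker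
        (exists_lift_cocycleExt hG hcn l)⟩

theorem isProP_of_absLower (hG : absLower p G c = ⊥) : IsProP p G where
  compact := inferInstance
  t2 := inferInstance
  totallyDisconnected := inferInstance
  isPGroup_quotient N _ _ := (isPGroup_of_absLower hG).index N

/-- A group presented by `g + 1` relators inverted by `σ` is a Schur+1 `σ`-group. -/
theorem isSchurPlusOne_of_mem_T (hp : Odd p) (hg : 0 < g) (hG : absLower p G c = ⊥)
    (hd : genRank p G = g) (hcn : c + 1 ≤ n) {v : Fin (g + 1) → FreeQuot p g n}
    (hv : v ∈ T p g G n) : IsSchurPlusOne G p g := by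
  have hp1 := (Fact.out : p.Prime).one_lt
  have hd' : (absLower p G 1).index = p ^ g := by rw [index_absLower_one, hd]
  obtain ⟨l, τ, hl, hker, hlτ, hτ, hτ'⟩ := exists_mulAut_of_mem_T hv
  have hvl : ∀ i, v i ∈ l.ker := fun i => hker ▸ Subgroup.subset_normalClosure ⟨i, rfl⟩
  have hs := Function.surjInv_eq hl
  have hrel : (absStar p l.ker).relIndex l.ker = p ^ relRank p G :=
    relIndex_ker_eq_pow_relRank hs (absLower_freeQuot n) (ker_le_absLower_one hd' hl)
      (exists_lift_cocycleExt hG hcn l)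
  have hle : relRank p G ≤ g + 1 := by
    have h1 := finrank_starQuot_le_of_span ((normalClosure_eq_iff (absLower_freeQuot n)
      fun i => (⟨v i, hvl i⟩ : l.ker)).1 hker.symm)
    rw [relIndex_absStar] at hrel
    exact (Nat.pow_right_injective hp1 hrel).symm.trans_le h1
  have hge : g ≤ relRank p G := by
    -- The lower bound is available at level c+1 exactly, while n may be larger; both levels compute
    -- the same r(G).
    obtain ⟨l', hl', -⟩ := exists_equivariant_surjection hd' hp
      (absLower_eq_bot_of_le hG c.le_succ) (σ := τ.toMonoidHom) hτ hτ'
    have h1 := pow_le_relIndex_ker hG l'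
    rw [relIndex_ker_eq_pow_relRank (Function.surjInv_eq hl') (absLower_freeQuot _)
      (ker_le_absLower_one hd' hl') (exists_lift_cocycleExt hG le_rfl l')] at h1
    exact (Nat.pow_le_pow_iff_right hp1).1 h1
  have hinv : ∀ x ∈ l.ker, sigmaQuot p g n x * x ∈ absStar p l.ker := fun x hx =>
    inverts_absStar_of_normalClosure hker.symm
      (by rintro _ ⟨i, rfl⟩; exact (hv.1 i).2) hx
  let σ : G ≃ₜ* G := ⟨τ, continuous_of_discreteTopology, continuous_of_discreteTopology⟩
  have hab : ∀ x, τ x * x ∈ commutator G := by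
    refine mul_self_mem_of_inverts (σ := τ.toMonoidHom)
      (S := Set.range fun i => l (freeQuotGen p n i)) ?_ ?_ fun a b => ?_
    · rw [← range_eq_closure, MonoidHom.range_eq_top.2 hl]
    · rintro _ ⟨i, rfl⟩
      change τ (l _) = _
      rw [← hlτ, sigmaQuot_gen, map_inv]
    · exact Subgroup.commutator_mem_commutator (Subgroup.mem_top a) (Subgroup.mem_top b)
  have hσ : IsGI σ :=
    { involutive := hτ
      ne_refl := by
        by_contra! hall
        -- A trivial τ would put the square of every element in P₁(G); all elements being squares,
        -- P₁(G) = G, against g > 0.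
        have h1 : absLower p G 1 = ⊤ := top_le_iff.1 fun x _ => by
          have h2 := hτ' (oddRoot x)
          have h3 : τ (oddRoot x) = oddRoot x := hall _
          rwa [h3, oddRoot_mul_self (odd_card_of_absLower hp hG)] at h2
        rw [h1, Subgroup.index_top] at hd'
        exact (Nat.one_lt_pow hg.ne' hp1).ne hd'
      inverts_ab := fun x => by
        rw [← mul_eq_one_iff_eq_inv, ← QuotientGroup.mk_mul, QuotientGroup.eq_one_iff]
        exact Subgroup.le_topologicalClosure _ (hab x) }
  have hdisc : DiscreteTopology (FreeQuot p g n) := QuotientGroup.discreteTopology (isOpen_lowerP n)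
  exact
    { isProP := isProP_of_absLower hG
      finitelyPresented := isFinitelyPresented_of_surjective
        (π := l.comp (QuotientGroup.mk' (lowerP p (FreeProP p g) n)))
        ((continuous_of_discreteTopology (f := l)).comp QuotientGroup.continuous_mk)
        (hl.comp (QuotientGroup.mk'_surjective _))
      finite_ab := inferInstance
      genRank_eq := hd
      relRank_eq := by omega
      exists_GI := ⟨σ, hσ, H2.map_eq_neg hs (MonoidHom.id G) continuous_id (τ := τ) hlτ
        (fun _ => rfl) (infl_surjective hs (exists_lift_cocycleExt hG hcn l)) hinv⟩ }

end Schur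

end SchurPlusOne

end

/-! ### The main theorem -/

theorem theorem2 {p : ℕ} [Fact p.Prime] (hp : Odd p) {g c : ℕ} (hg : 0 < g)
    {G : Type*} [Group G] [Finite G] [TopologicalSpace G] [DiscreteTopology G]
    (hG : SchurPlusOne.IsSchurPlusOneAncestor G p)
    (hc : SchurPlusOne.HasPClass p G c)
    (hd : SchurPlusOne.genRank p G = g) :
    -- `σ` is a GI-automorphism of `G`, and `G = F / ker π` a presentation of `G`
    (∀ (σ : G ≃ₜ* G), SchurPlusOne.IsGI σ →
      ∀ (π : SchurPlusOne.FreeProP p g →* G), Continuous π → Function.Surjective π →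
      ∀ h : ℕ, h = SchurPlusOne.multRank p π.ker c →
        h ≤ g + 1 ∧
        SchurPlusOne.measAt p g G c =
          (SchurPlusOne.yCard σ : ℝ) / ((SchurPlusOne.autCard σ : ℝ) * (Nat.card G : ℝ)) *
            (p : ℝ) ^ (g * (g + 1)) *
            (SchurPlusOne.eta p g * SchurPlusOne.eta p (g + 1) /
              SchurPlusOne.eta p (g + 1 - h))) ∧
    (SchurPlusOne.IsSchurPlusOne G p g →
      ∀ (σ : G ≃ₜ* G), SchurPlusOne.IsGI σ →
      ∀ r : ℕ, r = SchurPlusOne.relRank p G →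
        SchurPlusOne.HasMeas p g G c
          ((SchurPlusOne.yCard σ : ℝ) / ((SchurPlusOne.autCard σ : ℝ) * (Nat.card G : ℝ)) *
            (p : ℝ) ^ (g * (g + 1)) *
            (SchurPlusOne.eta p g * SchurPlusOne.eta p (g + 1) /
              SchurPlusOne.eta p (g + 1 - r)))) ∧
    (¬ SchurPlusOne.IsSchurPlusOne G p g → SchurPlusOne.HasMeas p g G c 0) := by
  have hGc : SchurPlusOne.absLower p G c = ⊥ := by
    rw [← SchurPlusOne.lowerP_eq_absLower]
    exact hc.1
  have hd' : (SchurPlusOne.absLower p G 1).index = p ^ g := by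
    rw [SchurPlusOne.index_absLower_one, hd]
  refine ⟨?_, ?_, ?_⟩
  · intro σ hσ π hπ hπs h hh
    obtain ⟨τ, l₀, h₀, hτ, hl₀, hl₀τ, hinv, hrel, hle⟩ :=
      SchurPlusOne.exists_presentation_of_ancestor hp hg hG hc hd
    obtain ⟨l, hl⟩ := SchurPlusOne.exists_descent hGc hπ
    have hls : Function.Surjective l := fun y => by
      obtain ⟨x, rfl⟩ := hπs y
      exact ⟨_, hl x⟩
    -- The given presentation need not be equivariant. Comparing it with the equivariant l₀
    -- identifies its h with the rank of the relation module of l₀.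
    obtain ⟨α, hα⟩ := SchurPlusOne.exists_comp l l₀ hls
    have h1 := SchurPlusOne.pow_multRank hl
    rw [← hh, ← SchurPlusOne.relIndex_ker_of_comp hd' hls hl₀ hα, hrel] at h1
    obtain rfl := Nat.pow_right_injective (Fact.out : p.Prime).two_le h1
    exact ⟨hle, SchurPlusOne.measAt_eq_of_isGI hp hGc hd' hσ hτ hl₀ hl₀τ hinv hrel hle⟩
  · intro hS σ hσ r hr c' hc'
    subst hr
    obtain ⟨τ, l, hτ, hl, hlτ, hinv, hrel⟩ :=
      SchurPlusOne.exists_presentation_of_isSchurPlusOne hp hGc hc' hS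
    refine SchurPlusOne.measAt_eq_of_isGI hp
      (SchurPlusOne.absLower_eq_bot_of_le hGc (Nat.le_of_succ_le hc')) hd' hσ hτ hl hlτ hinv hrel ?_
    rcases hS.relRank_eq with h | h <;> omega
  · intro hS c' hc'
    have hT : SchurPlusOne.T p g G c' = ∅ := Set.eq_empty_of_forall_notMem fun v hv =>
      hS (SchurPlusOne.isSchurPlusOne_of_mem_T hp hg hGc hd hc' hv)
    rw [SchurPlusOne.measAt, hT, Set.ncard_empty, Nat.cast_zero, zero_div]
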